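/- **Setting.** Let $\mathbb L\subset\mathbb R^3$ be a Bravais lattice with unit cell $\Omega$, and let $\mathbb L^*$ be its reciprocal lattice with unit cell (Brillouin zone) $\Omega^*$. Let $\psi_{n\mathbf k}(\mathbf r)$ and $\varepsilon_{n\mathbf k}\in\mathbb R$ be the orbitals and orbital energies of $n_{\rm occ}$ occupied bands (indices $i,j,k,l$) and $n_{\rm vir}$ virtual bands (indices $a,b,c,d$), such that: * $\psi_{n\mathbf k}(\mathbf r+\mathbf R)=e^{\mathrm i\mathbf k\cdot\mathbf R}\psi_{n\mathbf k}(\mathbf r)$ for $\mathbf R\in\mathbb L$, and $\int_\Omega\overline{\psi_{n\mathbf k}}\,\psi_{n'\mathbf k}\,d\mathbf r=\delta_{nn'}$ for every $\mathbf k$; * $\psi_{n\mathbf k}(\mathbf r)$ and $\varepsilon_{n\mathbf k}$ are $\mathbb L^*$-periodic and $C^\infty$ in $\mathbf k\in\mathbb R^3$, and all $\mathbf k$-derivatives of $\psi_{n\mathbf k}(\mathbf r)$ are continuous in $(\mathbf k,\mathbf r)$; * there is a gap between occupied and virtual bands, in the sense that $\varepsilon_{i\mathbf k_i}+\varepsilon_{j\mathbf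 k_j}<\varepsilon_{a\mathbf k_a}+\varepsilon_{b\mathbf k_b}$ whenever $\mathbf k_i+\mathbf k_j-\mathbf k_a-\mathbf k_b\in\mathbb L^*$ (for example, if all occupied energies lie below all virtual energies). With $\mathbf q=\mathbf k_3-\mathbf k_1$ and $\mathbf k_4=\mathbf k_2-\mathbf q$ modulo $\mathbb L^*$ put $$\langle n_1\mathbf k_1,n_2\mathbf k_2|n_3\mathbf k_3,n_4\mathbf k_4\rangle=\frac{4\pi}{|\Omega|}\sum_{\mathbf G\in\mathbb L^*,\ \mathbf q+\mathbf G\ne 0}\frac{\hat\varrho_{n_1\mathbf k_1,n_3(\mathbf k_1+\mathbf q)}(\mathbf G)\,\hat\varrho_{n_2\mathbf k_2,n_4(\mathbf k_2-\mathbf q)}(-\mathbf G)}{|\mathbf q+\mathbf G|^2},$$ $$\hat\varrho_{n'\mathbf k',n\mathbf k}(\mathbf G)=\int_\Omega\overline{\psi_{n'\mathbf k'}(\mathbf r)}\,e^{\mathrm i(\mathbf k'-\mathbf k-\mathbf G)\cdot\mathbf r}\,\psi_{n\mathbf k}(\mathbf r)\,d\mathbf r .$$ **Amplitude map.** Write $P=(p,\mathbf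 k_p)$. Crystal momentum is conserved: $\mathbf k_p+\mathbf k_q-\mathbf k_r-\mathbf k_s\in\mathbb L^*$ in $\langle PQ|RS\rangle$, in $\chi_{PQ}^{RS}$ and in $t_{PQ}^{RS}$, and $\mathbf k_p-\mathbf k_q\in\mathbb L^*$ in $\kappa_P^Q$. Let $t_{IJ}^{AB}=t_{ijab}(\mathbf k_i,\mathbf k_j,\mathbf k_a)$, $\varepsilon_{IJ}^{AB}=\varepsilon_I+\varepsilon_J-\varepsilon_A-\varepsilon_B$, $\mathcal P(u)_{IJ}^{AB}=u_{IJ}^{AB}+u_{JI}^{BA}$, and let $\langle\cdot\rangle_{\mathbf k}=|\Omega^*|^{-1}\int_{\Omega^*}\cdot\,d\mathbf k$, $\langle\cdot\rangle_{\mathbf k,\mathbf k'}=|\Omega^*|^{-2}\int_{\Omega^*\times\Omega^*}\cdot\,d\mathbf k\,d\mathbf k'$. For a family $t=(t_{ijab})$ define $$\begin{aligned}[\mathcal F_{\rm TDL}(t)]_{IJ}^{AB}=\frac1{\varepsilon_{IJ}^{AB}}\Big[&\langle AB|IJ\rangle+\mathcal P\Big(\sum_c\kappa_C^At_{IJ}^{CB}-\sum_k\kappa_I^Kt_{KJ}^{AB}\Big)+\Big\langle\sum_{kl}\chi_{IJ}^{KL}t_{KL}^{AB}\Big\rangle_{\mathbf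 k_k}+\Big\langle\sum_{cd}\langle AB|CD\rangle t_{IJ}^{CD}\Big\rangle_{\mathbf k_c}\\&+\mathcal P\Big\langle\sum_{kc}(2\chi_{IC}^{AK}-\chi_{CI}^{AK})t_{KJ}^{CB}-\chi_{IC}^{AK}t_{KJ}^{BC}-\chi_{CJ}^{AK}t_{KI}^{BC}\Big\rangle_{\mathbf k_k}\Big],\end{aligned}$$ where $$\begin{aligned}\kappa_C^A&=-\Big\langle\sum_{kld}(2\langle KL|CD\rangle-\langle KL|DC\rangle)t_{KL}^{AD}\Big\rangle_{\mathbf k_k,\mathbf k_l},\qquad \kappa_I^K=\Big\langle\sum_{lcd}(2\langle KL|CD\rangle-\langle KL|DC\rangle)t_{IL}^{CD}\Big\rangle_{\mathbf k_c,\mathbf k_d},\\ \chi_{IJ}^{KL}&=\langle KL|IJ\rangle+\Big\langle\sum_{cd}\langle KL|CD\rangle t_{IJ}^{CD}\Big\rangle_{\mathbf k_c},\qquad \chi_{CI}^{AK}=\langle AK|CI\rangle-\tfrac12\Big\langle\sum_{ld}\langle LK|CD\rangle t_{IL}^{DA}\Big\rangle_{\mathbf k_l},\\ \chi_{IC}^{AK}&=\langle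 AK|IC\rangle+\tfrac12\Big\langle\sum_{ld}(2\langle LK|DC\rangle-\langle LK|CD\rangle)t_{IL}^{AD}-\langle LK|DC\rangle t_{IL}^{DA}\Big\rangle_{\mathbf k_l}.\end{aligned}$$ The exact CCD($n$) amplitude in the thermodynamic limit is $t_n$, where $t_0=0$ and $t_m=\mathcal F_{\rm TDL}(t_{m-1})$. **Function space.** $\mathbb T(\Omega^*)$ is the set of functions $f(\mathbf k_i,\mathbf k_j,\mathbf k_a)$ with complex values on $(\mathbb R^3)^3$ such that 1. $f$ is $\mathbb L^*$-periodic in each of $\mathbf k_i,\mathbf k_j,\mathbf k_a$; 2. $f$ is $C^\infty$ at all points with $\mathbf k_a-\mathbf k_i\notin\mathbb L^*$; 3. $f$ has an algebraic singularity of order $0$ at $\mathbf k_a=\mathbf k_i$, uniformly in $(\mathbf k_i,\mathbf k_j)$: there is $\delta>0$ such that for all multi-indices $\alpha,\beta$ there is a constant $C_{\alpha,\beta}$ with $$\big|\partial_{\mathbf q}^{\alpha}\,\partial_{(\mathbf k_i,\mathbf k_j)}^{\beta}\,f(\mathbf k_i,\mathbf k_j,\mathbf k_i+\mathbf q)\big|\le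 C_{\alpha,\beta}\,|\mathbf q|^{-|\alpha|}\qquad\text{for all } 0<|\mathbf q|<\delta \text{ and all } \mathbf k_i,\mathbf k_j;$$ 4. $(\mathbf k_i,\mathbf k_j)\mapsto f(\mathbf k_i,\mathbf k_j,\mathbf k_i)$ is $C^\infty$. **Lemma (singularity structure of the amplitude).** For every $n>0$, each entry $[t_n]_{ijab}$ of the exact CCD($n$) amplitude belongs to $\mathbb T(\Omega^*)$. Moreover, $\mathcal F_{\rm TDL}$ maps $\mathbb T(\Omega^*)^{n_{\rm occ}\times n_{\rm occ}\times n_{\rm vir}\times n_{\rm vir}}$ into itself. -/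

import Mathlib

open MeasureTheory
open scoped ContDiff ComplexConjugate

noncomputable section

namespace CCD

/-- Three-dimensional Euclidean space, both for positions `r` and for momentum vectors `k`. -/
abbrev Vec : Type := EuclideanSpace ℝ (Fin 3)

/-! ### Lattice, reciprocal lattice, unit cell, Brillouin zone -/

theorem inner_nondegenerate : (innerₗ Vec : LinearMap.BilinForm ℝ Vec).Nondegenerate := by
  constructor
  · intro x hx
    simpa using hx x
  · intro x hx
    simpa using hx x

/-- The basis of the reciprocal lattice that belongs to the basis `a` of the Bravais lattice,
`⟪b i, a j⟫ = 2π δ i j` (see `inner_recipBasis`). -/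
def recipBasis (a : Module.Basis (Fin 3) ℝ Vec) : Module.Basis (Fin 3) ℝ Vec :=
  (LinearMap.BilinForm.dualBasis (innerₗ Vec) inner_nondegenerate a).isUnitSMul
    (w := fun _ => 2 * Real.pi) (fun _ => (IsUnit.mk0 _ Real.two_pi_pos.ne'))

theorem inner_recipBasis (a : Module.Basis (Fin 3) ℝ Vec) (i j : Fin 3) :
    inner ℝ (recipBasis a i) (a j) = if i = j then 2 * Real.pi else 0 := by
  have h := LinearMap.BilinForm.apply_dualBasis_left (B := innerₗ Vec) inner_nondegenerate a i j
  rw [innerₗ_apply_apply] at h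
  rw [recipBasis, Module.Basis.isUnitSMul_apply, real_inner_smul_left, h]
  by_cases hij : i = j
  · simp [hij]
  · simp [hij, Ne.symm hij]

/-- The Bravais lattice `𝕃` spanned by `a`. -/
def lattice (a : Module.Basis (Fin 3) ℝ Vec) : Submodule ℤ Vec :=
  Submodule.span ℤ (Set.range a)

/-- The reciprocal lattice `𝕃*`. -/
def recipLattice (a : Module.Basis (Fin 3) ℝ Vec) : Submodule ℤ Vec :=
  Submodule.span ℤ (Set.range (recipBasis a))

/-- The unit cell `Ω`: the half-open parallelepiped spanned by `a`. -/
def cell (a : Module.Basis (Fin 3) ℝ Vec) : Set Vec := ZSpan.fundamentalDomain a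

/-- The reciprocal unit cell (Brillouin zone) `Ω*`: the half-open parallelepiped spanned by the
reciprocal basis. All integrands below are periodic, so that any other unit cell of `𝕃*` gives
the same integrals. -/
def zone (a : Module.Basis (Fin 3) ℝ Vec) : Set Vec := ZSpan.fundamentalDomain (recipBasis a)

/-- The average `|Ω*|⁻¹ ∫_{Ω*} f(k) dk`. -/
def zoneAvg (a : Module.Basis (Fin 3) ℝ Vec) (f : Vec → ℂ) : ℂ :=
  (1 / (volume.real (zone a) : ℂ)) * ∫ k in zone a, f k

/-- The average `|Ω*|⁻² ∫_{Ω* × Ω*} f(k, k') dk dk'`. -/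
def zoneAvg₂ (a : Module.Basis (Fin 3) ℝ Vec) (f : Vec → Vec → ℂ) : ℂ :=
  (1 / (volume.real (zone a) : ℂ) ^ 2) * ∫ p in zone a ×ˢ zone a, f p.1 p.2

/-! ### Algebraic singularities and the function space `𝕋(Ω*)` -/

section Singularity

variable {X Y : Type*} [NormedAddCommGroup X] [NormedSpace ℝ X]
  [NormedAddCommGroup Y] [NormedSpace ℝ Y]

/-- `f(x, y)` is smooth with respect to `y` for any fixed `x`, and has an algebraic singularity of
order `γ` with respect to `x` at `x₀`: on a punctured ball `0 < |x - x₀| < δ` it is smooth and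
`|∂_x^α ∂_y^β f(x, y)| ≤ C_{α,β} |x - x₀|^{γ - |α|}`, where `C_{α,β}` does not depend on `y`.
All partial derivatives with `|α| = m`, `|β| = l` are collected in one iterated derivative. -/
structure HasAlgebraicSingularity (f : X → Y → ℂ) (γ : ℝ) (x₀ : X) : Prop where
  smooth_right : ∀ x, ContDiff ℝ ∞ (f x)
  singular : ∃ δ > 0,
    (∀ x y, 0 < ‖x - x₀‖ → ‖x - x₀‖ < δ → ContDiffAt ℝ ∞ (fun p : X × Y => f p.1 p.2) (x, y)) ∧
    ∀ m l : ℕ, ∃ C : ℝ, ∀ x y, 0 < ‖x - x₀‖ → ‖x - x₀‖ < δ →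
      ‖iteratedFDeriv ℝ m (fun x' => iteratedFDeriv ℝ l (fun y' => f x' y') y) x‖
        ≤ C * ‖x - x₀‖ ^ (γ - (m : ℝ))

end Singularity

/-- The function space `𝕋(Ω*)`. The variables of `f` are `k_i, k_j, k_a`; the singularity is
described after the change of variables `k_a = k_i + q`, with `x = q` and `y = (k_i, k_j)`. -/
structure MemT (a : Module.Basis (Fin 3) ℝ Vec) (f : Vec → Vec → Vec → ℂ) : Prop where
  periodic_i : ∀ G ∈ recipLattice a, ∀ ki kj ka, f (ki + G) kj ka = f ki kj ka
  periodic_j : ∀ G ∈ recipLattice a, ∀ ki kj ka, f ki (kj + G) ka = f ki kj ka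
  periodic_a : ∀ G ∈ recipLattice a, ∀ ki kj ka, f ki kj (ka + G) = f ki kj ka
  /-- smooth away from `k_a = k_i` and the periodic images of this set -/
  smooth : ∀ ki kj ka, ka - ki ∉ recipLattice a →
    ContDiffAt ℝ ∞ (fun p : Vec × Vec × Vec => f p.1 p.2.1 p.2.2) (ki, kj, ka)
  /-- algebraic singularity of order `0` at `k_a = k_i`, uniformly in `(k_i, k_j)` -/
  singular : HasAlgebraicSingularity
    (fun (q : Vec) (y : Vec × Vec) => f y.1 y.2 (y.1 + q)) 0 0
  /-- smooth with respect to `(k_i, k_j)` at the nonsmooth points `k_a = k_i` -/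
  smooth_diag : ContDiff ℝ ∞ (fun y : Vec × Vec => f y.1 y.2 y.1)

/-! ### Orbitals and orbital energies of an insulator -/

/-- Orbitals `ψ_{nk}(r)` and orbital energies `ε_{nk}` of an insulating system with `nocc` occupied
bands (`Sum.inl`) and `nvir` virtual bands (`Sum.inr`). The orbitals are normalized on the unit
cell: the factor `N_k^{-1/2}` of a supercell with `N_k` cells is left out, and inner products over
the supercell become integrals over the unit cell. -/
structure Bands (a : Module.Basis (Fin 3) ℝ Vec) (nocc nvir : ℕ) where
  /-- `orb n k r = ψ_{nk}(r)` -/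
  orb : Fin nocc ⊕ Fin nvir → Vec → Vec → ℂ
  /-- `energy n k = ε_{nk}` -/
  energy : Fin nocc ⊕ Fin nvir → Vec → ℝ
  /-- `ψ_{nk}(r) = e^{ik·r} u_{nk}(r)` with `u_{nk}` periodic with respect to the unit cell -/
  bloch : ∀ n k r, ∀ R ∈ lattice a,
    orb n k (r + R) = Complex.exp (Complex.I * (inner ℝ k R : ℝ)) * orb n k r
  orthonormal : ∀ n n' k,
    ∫ r in cell a, conj (orb n k r) * orb n' k r = if n = n' then 1 else 0
  /-- smoothness in `k`: all `k`-derivatives of `ψ_{nk}(r)` exist and are continuous in `(k, r)` -/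
  orb_smooth : ∀ n r, ContDiff ℝ ∞ (fun k => orb n k r)
  orb_deriv_continuous : ∀ n (m : ℕ),
    Continuous (fun p : Vec × Vec => iteratedFDeriv ℝ m (fun k => orb n k p.2) p.1)
  energy_smooth : ∀ n, ContDiff ℝ ∞ (energy n)
  orb_periodic : ∀ n k r, ∀ G ∈ recipLattice a, orb n (k + G) r = orb n k r
  energy_periodic : ∀ n k, ∀ G ∈ recipLattice a, energy n (k + G) = energy n k
  /-- the gap between occupied and virtual bands: every double excitation that conserves crystal
  momentum costs energy. This holds if all occupied energies lie below all virtual ones, and it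
  implies `ε_{ik} < ε_{ck}` at every `k` (see `Bands.direct_gap`). -/
  gap : ∀ (i j : Fin nocc) (c d : Fin nvir) (ki kj kc : Vec),
    energy (Sum.inl i) ki + energy (Sum.inl j) kj
      < energy (Sum.inr c) kc + energy (Sum.inr d) (ki + kj - kc)

/-- A family of functions of `(k_i, k_j, k_a)` indexed by the bands `i, j, a, b`. -/
abbrev Amplitude (nocc nvir : ℕ) : Type :=
  Fin nocc → Fin nocc → Fin nvir → Fin nvir → Vec → Vec → Vec → ℂ

namespace Bands

variable {a : Module.Basis (Fin 3) ℝ Vec} {nocc nvir : ℕ} (S : Bands a nocc nvir)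

theorem direct_gap (i : Fin nocc) (c : Fin nvir) (k : Vec) :
    S.energy (.inl i) k < S.energy (.inr c) k := by
  have h := S.gap i i c c k k k
  rw [add_sub_cancel_right] at h
  linarith

/-- The pair product `ϱ̂_{n'k',nk}(G) = ⟨ψ_{n'k'}| e^{i(k'-k-G)·r} |ψ_{nk}⟩`. -/
def pairProduct (n' : Fin nocc ⊕ Fin nvir) (k' : Vec) (n : Fin nocc ⊕ Fin nvir) (k : Vec)
    (G : Vec) : ℂ :=
  ∫ r in cell a, conj (S.orb n' k' r) *
    Complex.exp (Complex.I * (inner ℝ (k' - k - G) r : ℝ)) * S.orb n k r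

open Classical in
/-- The normalized electron repulsion integral `⟨n₁k₁, n₂k₂ | n₃k₃, n₄k₄⟩`, as a function of
`k₁, k₂, k₃`; by crystal momentum conservation `k₄ = k₁ + k₂ - k₃ = k₂ - q` modulo `𝕃*`, where
`q = k₃ - k₁` is the momentum transfer. The sum leaves out the term with `q + G = 0`. -/
def eri (n₁ n₂ n₃ n₄ : Fin nocc ⊕ Fin nvir) (k₁ k₂ k₃ : Vec) : ℂ :=
  (4 * Real.pi / volume.real (cell a) : ℝ) *
    ∑' G : recipLattice a,
      if (k₃ - k₁) + (G : Vec) = 0 then 0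
      else (1 / ‖(k₃ - k₁) + (G : Vec)‖ ^ 2 : ℝ) *
        S.pairProduct n₁ k₁ n₃ (k₁ + (k₃ - k₁)) G *
        S.pairProduct n₂ k₂ n₄ (k₂ - (k₃ - k₁)) (-(G : Vec))

/-- The orbital energy difference `ε_{IJ}^{AB}`, with `k_b = k_i + k_j - k_a`. -/
def gapEnergy (i j : Fin nocc) (c d : Fin nvir) (ki kj kc : Vec) : ℝ :=
  S.energy (.inl i) ki + S.energy (.inl j) kj
    - S.energy (.inr c) kc - S.energy (.inr d) (ki + kj - kc)

/-! ### The intermediate blocks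

Below `i j k l` are occupied bands, `e b c d` are virtual bands (`e` is the band index written
`a` in the usual notation `t_{IJ}^{AB}`, since `a` is the lattice basis), and `kp` is the momentum
vector of the orbital `P = (p, kp)`. Momentum vectors that are not arguments are fixed by the
crystal momentum conservation. -/

/-- `κ_C^A`, where `k_c = k_a` -/
def kappaVir (t : Amplitude nocc nvir) (c e : Fin nvir) (ka : Vec) : ℂ :=
  - zoneAvg₂ a fun kk kl =>
    let kd := kk + kl - ka
    ∑ k, ∑ l, ∑ d,
      (2 * S.eri (.inl k) (.inl l) (.inr c) (.inr d) kk kl ka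
        - S.eri (.inl k) (.inl l) (.inr d) (.inr c) kk kl kd) * t k l e d kk kl ka

/-- `κ_I^K`, where `k_k = k_i` -/
def kappaOcc (t : Amplitude nocc nvir) (i k : Fin nocc) (ki : Vec) : ℂ :=
  zoneAvg₂ a fun kc kd =>
    let kl := kc + kd - ki
    ∑ l, ∑ c, ∑ d,
      (2 * S.eri (.inl k) (.inl l) (.inr c) (.inr d) ki kl kc
        - S.eri (.inl k) (.inl l) (.inr d) (.inr c) ki kl kd) * t i l c d ki kl kc

/-- `χ_{IJ}^{KL}`, where `k_l = k_i + k_j - k_k` -/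
def chiOcc (t : Amplitude nocc nvir) (i j k l : Fin nocc) (ki kj kk : Vec) : ℂ :=
  let kl := ki + kj - kk
  S.eri (.inl k) (.inl l) (.inl i) (.inl j) kk kl ki
    + zoneAvg a fun kc => ∑ c, ∑ d,
        S.eri (.inl k) (.inl l) (.inr c) (.inr d) kk kl kc * t i j c d ki kj kc

/-- `χ_{CD}^{AB}`, where `k_d = k_a + k_b - k_c` -/
def chiVir (c d e b : Fin nvir) (kc ka kb : Vec) : ℂ :=
  S.eri (.inr e) (.inr b) (.inr c) (.inr d) ka kb kc

/-- `χ_{IC}^{AK}`, where `k_c = k_a + k_k - k_i` -/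
def chiIC (t : Amplitude nocc nvir) (i : Fin nocc) (c e : Fin nvir) (k : Fin nocc)
    (ki ka kk : Vec) : ℂ :=
  let kc := ka + kk - ki
  S.eri (.inr e) (.inl k) (.inl i) (.inr c) ka kk ki
    + 1 / 2 * zoneAvg a fun kl =>
        let kd := ki + kl - ka
        ∑ l, ∑ d,
          ((2 * S.eri (.inl l) (.inl k) (.inr d) (.inr c) kl kk kd
              - S.eri (.inl l) (.inl k) (.inr c) (.inr d) kl kk kc) * t i l e d ki kl ka
            - S.eri (.inl l) (.inl k) (.inr d) (.inr c) kl kk kd * t i l d e ki kl kd)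

/-- `χ_{CI}^{AK}`, where `k_c = k_a + k_k - k_i` -/
def chiCI (t : Amplitude nocc nvir) (c : Fin nvir) (i : Fin nocc) (e : Fin nvir) (k : Fin nocc)
    (ki ka kk : Vec) : ℂ :=
  let kc := ka + kk - ki
  S.eri (.inr e) (.inl k) (.inr c) (.inl i) ka kk kc
    - 1 / 2 * zoneAvg a fun kl =>
        let kd := ki + kl - ka
        ∑ l, ∑ d, S.eri (.inl l) (.inl k) (.inr c) (.inr d) kl kk kc * t i l d e ki kl kd

/-! ### The amplitude map -/

/-- The terms `∑_C κ_C^A t_{IJ}^{CB} - ∑_K κ_I^K t_{KJ}^{AB}` -/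
def kappaTerms (t : Amplitude nocc nvir) : Amplitude nocc nvir :=
  fun i j e b ki kj ka =>
    ∑ c, S.kappaVir t c e ka * t i j c b ki kj ka
      - ∑ k, S.kappaOcc t i k ki * t k j e b ki kj ka

/-- The 4h2p term, the average over `k_k` of `∑_{kl} χ_{IJ}^{KL} t_{KL}^{AB}` -/
def term4h2p (t : Amplitude nocc nvir) : Amplitude nocc nvir :=
  fun i j e b ki kj ka => zoneAvg a fun kk =>
    let kl := ki + kj - kk
    ∑ k, ∑ l, S.chiOcc t i j k l ki kj kk * t k l e b kk kl ka

/-- The 2h4p term, the average over `k_c` of `∑_{cd} χ_{CD}^{AB} t_{IJ}^{CD}` -/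
def term2h4p (t : Amplitude nocc nvir) : Amplitude nocc nvir :=
  fun i j e b ki kj ka => zoneAvg a fun kc =>
    let kb := ki + kj - ka
    ∑ c, ∑ d, S.chiVir c d e b kc ka kb * t i j c d ki kj kc

/-- The 3h3p term, the average over `k_k` of
`∑_{kc} (2 χ_{IC}^{AK} - χ_{CI}^{AK}) t_{KJ}^{CB} - χ_{IC}^{AK} t_{KJ}^{BC} - χ_{CJ}^{AK} t_{KI}^{BC}`;
in the first two products `k_c = k_a + k_k - k_i`, in the last one `k_c = k_a + k_k - k_j`. -/
def term3h3p (t : Amplitude nocc nvir) : Amplitude nocc nvir :=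
  fun i j e b ki kj ka => zoneAvg a fun kk =>
    let kb := ki + kj - ka
    let kc := ka + kk - ki
    ∑ k, ∑ c,
      ((2 * S.chiIC t i c e k ki ka kk - S.chiCI t c i e k ki ka kk) * t k j c b kk kj kc
        - S.chiIC t i c e k ki ka kk * t k j b c kk kj kb
        - S.chiCI t c j e k kj ka kk * t k i b c kk ki kb)

/-- The permutation operator `𝒫(⋯)_{IJ}^{AB} = (⋯)_{IJ}^{AB} + (⋯)_{JI}^{BA}` -/
def perm (u : Amplitude nocc nvir) : Amplitude nocc nvir :=
  fun i j e b ki kj ka => u i j e b ki kj ka + u j i b e kj ki (ki + kj - ka)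

/-- The map `ℱ_TDL`, the right-hand side of the CCD amplitude equation in the thermodynamic
limit. -/
def amplitudeMap (t : Amplitude nocc nvir) : Amplitude nocc nvir :=
  fun i j e b ki kj ka =>
    let kb := ki + kj - ka
    1 / (S.gapEnergy i j e b ki kj ka : ℂ) *
      (S.eri (.inr e) (.inr b) (.inl i) (.inl j) ka kb ki
        + perm (S.kappaTerms t) i j e b ki kj ka
        + S.term4h2p t i j e b ki kj ka
        + S.term2h4p t i j e b ki kj ka
        + perm (S.term3h3p t) i j e b ki kj ka)

/-- The exact CCD(`n`) amplitude in the thermodynamic limit: `n` fixed point iterations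
`t_m = ℱ_TDL(t_{m-1})` with `t_0 = 0`. -/
def ccdAmplitude : ℕ → Amplitude nocc nvir
  | 0 => 0
  | n + 1 => S.amplitudeMap (ccdAmplitude n)

end Bands

end CCD

end

/-!
# The singularity structure of the exact CCD amplitude

The space `𝕋(Ω*)` is too small for an induction, because the electron repulsion integrals and the
blocks built from them are worse: they have an algebraic singularity of order `-2`. The proof works
in the class `PeriodicSymbol a ν` of functions of three momenta that are periodic, smooth away from
`k₃ - k₁ ∈ 𝕃*`, smooth along `k₃ = k₁`, and of size `|k₃ - k₁|^{-ν}` near this set, where every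
derivative across the set costs one power of `|k₃ - k₁|`; such a function is said to have order
`ν`. For `ν = 0` this class is `𝕋(Ω*)`
(`MemT.periodicSymbol`, `PeriodicSymbol.memT`). The symbol bounds are stated after a dilation by the
distance `d` to the lattice (`SymbolOn`), which makes the algebra of symbols a matter of the chain
rule and the Leibniz rule.

*Electron repulsion integrals* have order `2` (`Bands.periodicSymbol_eri`). The orbitals are smooth
maps of `k` into the continuous functions on the closed cell, so that by Bessel's inequality the
sequences of pair products are smooth maps into `ℓ²`. Up to finitely many terms, the lattice sum is
an inner product of two such sequences, twisted by the multiplier `1 / |q + G|²`, which is smooth in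
`q`: after the inversion `G ↦ G / |G|²` it is a continuous function on a ball
(`exists_multiplier`, `Bands.exists_smooth_part`). Near `q = 0` only the term `G = 0` is singular.
If both pairs consist of different bands, orthogonality makes both pair products vanish at `q = 0`,
Hadamard's lemma writes the term as a combination of `q_i q_j / |q|²`, and the order is `0`
(`Bands.periodicSymbol_eri_of_ne`).

*Averages.* In dimension three `d⁻²` is integrable over the Brillouin zone. The average of a product
of symbols, of order `2` and of order `0`, is a symbol of order `0` in each of the situations that
occur in the amplitude equation. Either the singular set of the first factor moves with the variable
of integration and that of the other factor does not (`PeriodicSymbol.average`), and then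
differentiation under the integral suffices. Or the two singularities are at `p = 0` and at `p = q`,
where `q = k₃ - k₁`, and the average is a convolution (`SymbolOn.convolution`). A cutoff at distance
comparable to `d(q)` around `p = 0` splits it: near `p = 0` the derivatives in `q` fall on the
second factor, which is at distance comparable to `d(q)` from its singularity, and away from
`p = 0` one substitutes `p ↦ q - p` and lets them fall on the first factor.

The gap makes the reciprocal of the energy difference smooth, so every term of the amplitude
equation is a symbol of order `0` as soon as the amplitude is one
(`Bands.periodicSymbol_amplitudeMap`).
-/

open Filter Topology Set

noncomputable section

namespace CCD

/-! ### Iterated derivatives and mixed partial derivatives -/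

section IteratedDerivatives

variable {E F G : Type*} [NormedAddCommGroup E] [NormedSpace ℝ E]
  [NormedAddCommGroup F] [NormedSpace ℝ F] [NormedAddCommGroup G] [NormedSpace ℝ G]

theorem exists_isOpen_contDiffOn {f : E → F} {x : E} (hf : ContDiffAt ℝ ∞ f x) (n : ℕ) :
    ∃ U : Set E, IsOpen U ∧ x ∈ U ∧ ContDiffOn ℝ n f U := by
  obtain ⟨U, hU, hxU, h⟩ := (hf.contDiffWithinAt (s := univ)).contDiffOn' (m := n)
    (by exact_mod_cast le_top) (by simp)
  exact ⟨U, hU, hxU, by simpa using h⟩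

theorem iteratedFDeriv_comp_clm {f : E → F} (g : G →L[ℝ] E) {x : G} {n : ℕ}
    (hf : ContDiffAt ℝ n f (g x)) :
    iteratedFDeriv ℝ n (fun w => f (g w)) x =
      (iteratedFDeriv ℝ n f (g x)).compContinuousLinearMap fun _ => g := by
  obtain ⟨U, hU, hxU, h⟩ := (hf.contDiffWithinAt (s := univ)).contDiffOn' (m := n)
    le_rfl (by simp)
  replace h : ContDiffOn ℝ n f U := by simpa using h
  have hU' : IsOpen (g ⁻¹' U) := hU.preimage g.continuous
  have := g.iteratedFDerivWithin_comp_right h hU.uniqueDiffOn hU'.uniqueDiffOn hxU (i := n) le_rfl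
  rwa [iteratedFDerivWithin_of_isOpen n hU' hxU, iteratedFDerivWithin_of_isOpen n hU hxU] at this

/-- Iterated derivatives along an affine map. -/
theorem iteratedFDeriv_comp_affine {f : E → F} (c : E) (g : G →L[ℝ] E) {x : G} {n : ℕ}
    (hf : ContDiffAt ℝ n f (c + g x)) :
    iteratedFDeriv ℝ n (fun w => f (c + g w)) x =
      (iteratedFDeriv ℝ n f (c + g x)).compContinuousLinearMap fun _ => g := by
  have h : ContDiffAt ℝ n (fun z => f (c + z)) (g x) :=
    ContDiffAt.comp (g x) hf (contDiffAt_const.add contDiffAt_id)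
  rw [iteratedFDeriv_comp_clm (f := fun z => f (c + z)) g h, iteratedFDeriv_comp_add_left]

theorem norm_iteratedFDeriv_comp_affine_le {f : E → F} (c : E) (g : G →L[ℝ] E) {x : G} {n : ℕ}
    (hf : ContDiffAt ℝ n f (c + g x)) :
    ‖iteratedFDeriv ℝ n (fun w => f (c + g w)) x‖ ≤
      ‖iteratedFDeriv ℝ n f (c + g x)‖ * ‖g‖ ^ n := by
  rw [iteratedFDeriv_comp_affine c g hf]
  refine (ContinuousMultilinearMap.norm_compContinuousLinearMap_le _ _).trans ?_
  simp

/-- Leibniz bound for a product, at a point of smoothness. -/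
theorem norm_iteratedFDeriv_mul_le_of_contDiffAt {f g : E → ℂ} {x : E} {n : ℕ}
    (hf : ContDiffAt ℝ ∞ f x) (hg : ContDiffAt ℝ ∞ g x) :
    ‖iteratedFDeriv ℝ n (fun y => f y * g y) x‖ ≤ ∑ i ∈ Finset.range (n + 1),
      (n.choose i : ℝ) * ‖iteratedFDeriv ℝ i f x‖ * ‖iteratedFDeriv ℝ (n - i) g x‖ := by
  obtain ⟨U, hU, hxU, hfU⟩ := exists_isOpen_contDiffOn hf n
  obtain ⟨V, hV, hxV, hgV⟩ := exists_isOpen_contDiffOn hg n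
  have hUV := hU.inter hV
  have := norm_iteratedFDerivWithin_mul_le (hfU.mono inter_subset_left)
    (hgV.mono inter_subset_right) hUV.uniqueDiffOn ⟨hxU, hxV⟩ (n := n) le_rfl
  have e : ∀ (h : E → ℂ) (k : ℕ),
      iteratedFDerivWithin ℝ k h (U ∩ V) x = iteratedFDeriv ℝ k h x :=
    fun h k => iteratedFDerivWithin_of_isOpen k hUV ⟨hxU, hxV⟩
  simpa only [e] using this

theorem iteratedFDeriv_congr {f g : E → F} {x : E} (h : f =ᶠ[𝓝 x] g) (n : ℕ) :
    iteratedFDeriv ℝ n f x = iteratedFDeriv ℝ n g x :=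
  (h.iteratedFDeriv ℝ n).eq_of_nhds

theorem natCast_ne_infty (n : ℕ) : (n : ℕ∞ω) ≠ ∞ := by simp

theorem iteratedFDeriv_apply_cast {f : E → F} {x : E} {n n' : ℕ} (h : n = n') (v : Fin n' → E) :
    iteratedFDeriv ℝ n f x (v ∘ Fin.cast h) = iteratedFDeriv ℝ n' f x v := by
  subst h
  rfl

/-- The first directions are those of the outer derivative. -/
theorem iteratedFDeriv_iteratedFDeriv_apply {f : E → F} {x : E} {m l : ℕ}
    (hf : ContDiffAt ℝ ((m + l : ℕ) : ℕ∞ω) f x) (u : Fin m → E) (v : Fin l → E) :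
    iteratedFDeriv ℝ m (iteratedFDeriv ℝ l f) x u v =
      iteratedFDeriv ℝ (m + l) f x (Fin.append u v) := by
  induction m generalizing x with
  | zero =>
    rw [iteratedFDeriv_zero_apply, ← iteratedFDeriv_apply_cast (Nat.zero_add l).symm]
    congr 1
    ext i
    rw [Fin.append_left_nil _ _ rfl]
    simp
  | succ m ih =>
    have hd : DifferentiableAt ℝ (iteratedFDeriv ℝ m (iteratedFDeriv ℝ l f)) x := by
      have : ContDiffAt ℝ ((m + 1 : ℕ) : ℕ∞ω) (iteratedFDeriv ℝ l f) x :=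
        hf.iteratedFDeriv_right (by norm_cast)
      exact this.differentiableAt_iteratedFDeriv (by norm_cast; omega)
    have hd' : DifferentiableAt ℝ (iteratedFDeriv ℝ (m + l) f) x :=
      hf.differentiableAt_iteratedFDeriv (by norm_cast; omega)
    have hcast : m + 1 + l = m + l + 1 := Nat.add_right_comm m 1 l
    rw [hd.iteratedFDeriv_succ_apply_left']
    have hu : Fin.append u v =
        (Fin.cons (u 0) (Fin.append (Fin.tail u) v)) ∘ Fin.cast hcast := by
      rw [← Fin.append_cons, Fin.cons_self_tail]
    rw [hu, iteratedFDeriv_apply_cast hcast, hd'.iteratedFDeriv_succ_apply_left']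
    simp only [Fin.cons_zero, Fin.tail_cons]
    have hev : (fun y => iteratedFDeriv ℝ m (iteratedFDeriv ℝ l f) y (Fin.tail u) v)
        =ᶠ[𝓝 x] fun y => iteratedFDeriv ℝ (m + l) f y (Fin.append (Fin.tail u) v) := by
      filter_upwards [hf.eventually (natCast_ne_infty _)] with y hy
      exact ih (hy.of_le (by norm_cast; omega)) _
    rw [← hev.fderiv_eq]
    have hd2 : DifferentiableAt ℝ
        (fun y => iteratedFDeriv ℝ m (iteratedFDeriv ℝ l f) y (Fin.tail u)) x :=
      hd.continuousMultilinear_apply_const _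
    rw [fderiv_continuousMultilinear_apply_const_apply hd2]

/-- The first two directions are exchanged by the symmetry of the second derivative of
`iteratedFDeriv ℝ k f`; the other adjacent transpositions follow by induction. -/
theorem iteratedFDeriv_comp_adjacent_swap {f : E → F} {n : ℕ} {x : E}
    (hf : ContDiffAt ℝ ((n + 1 : ℕ) : ℕ∞ω) f x) (i : Fin n) (v : Fin (n + 1) → E) :
    iteratedFDeriv ℝ (n + 1) f x (v ∘ Equiv.swap i.castSucc i.succ) =
      iteratedFDeriv ℝ (n + 1) f x v := by
  induction n generalizing x with
  | zero => exact i.elim0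
  | succ k ih =>
    have hd : DifferentiableAt ℝ (iteratedFDeriv ℝ (k + 1) f) x :=
      hf.differentiableAt_iteratedFDeriv (by norm_cast; omega)
    refine Fin.cases ?_ (fun j => ?_) i
    · have key : ∀ v : Fin (k + 2) → E, iteratedFDeriv ℝ (k + 2) f x v =
          fderiv ℝ (fderiv ℝ (iteratedFDeriv ℝ k f)) x (v 0) (v 1)
            (Fin.tail (Fin.tail v)) := by
        intro v
        have h1 : DifferentiableAt ℝ (fderiv ℝ (iteratedFDeriv ℝ k f)) x := by
          have : ContDiffAt ℝ ((2 : ℕ) : ℕ∞ω) (iteratedFDeriv ℝ k f) x :=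
            hf.iteratedFDeriv_right (by norm_cast; omega)
          exact (this.fderiv_right (m := ((1 : ℕ) : ℕ∞ω)) (by norm_cast)).differentiableAt (by simp)
        have h2 : DifferentiableAt ℝ (fun y => fderiv ℝ (iteratedFDeriv ℝ k f) y (v 1)) x :=
          h1.clm_apply (differentiableAt_const _)
        rw [hd.iteratedFDeriv_succ_apply_left']
        change fderiv ℝ (fun y => fderiv ℝ (iteratedFDeriv ℝ k f) y (v 1)
          (Fin.tail (Fin.tail v))) x (v 0) = _
        rw [fderiv_continuousMultilinear_apply_const_apply h2,
          fderiv_clm_apply h1 (differentiableAt_const _)]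
        simp
      have hs : IsSymmSndFDerivAt ℝ (iteratedFDeriv ℝ k f) x := by
        have : ContDiffAt ℝ ((2 : ℕ) : ℕ∞ω) (iteratedFDeriv ℝ k f) x :=
          hf.iteratedFDeriv_right (by norm_cast; omega)
        exact this.isSymmSndFDerivAt (by simp)
      rw [key, key]
      have e0 : Equiv.swap (Fin.castSucc (0 : Fin (k + 1))) (Fin.succ 0) 0 = 1 := by simp
      have e1 : Equiv.swap (Fin.castSucc (0 : Fin (k + 1))) (Fin.succ 0) 1 = 0 := by simp
      have e2 : Fin.tail (Fin.tail (v ∘ Equiv.swap (Fin.castSucc (0 : Fin (k + 1))) (Fin.succ 0)))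
          = Fin.tail (Fin.tail v) := by
        ext m
        simp only [Fin.tail, Function.comp_apply]
        rw [Equiv.swap_apply_of_ne_of_ne]
        · simp [Fin.ext_iff]
        · simp [Fin.ext_iff]
      rw [e2, Function.comp_apply, Function.comp_apply, e0, e1, hs.eq]
    · rw [hd.iteratedFDeriv_succ_apply_left', hd.iteratedFDeriv_succ_apply_left']
      have e0 : (v ∘ Equiv.swap j.succ.castSucc j.succ.succ) 0 = v 0 := by
        simp only [Function.comp_apply]
        rw [Equiv.swap_apply_of_ne_of_ne] <;> simp [Fin.ext_iff]
      have e1 : Fin.tail (v ∘ Equiv.swap j.succ.castSucc j.succ.succ) =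
          Fin.tail v ∘ Equiv.swap j.castSucc j.succ := by
        ext m
        simp only [Fin.tail, Function.comp_apply]
        congr 1
        rw [← Fin.succ_castSucc]
        exact ((Fin.succ_injective _).map_swap _ _ _).symm
      rw [e0, e1]
      have hev : (fun y => iteratedFDeriv ℝ (k + 1) f y (Fin.tail v ∘ Equiv.swap j.castSucc j.succ))
          =ᶠ[𝓝 x] fun y => iteratedFDeriv ℝ (k + 1) f y (Fin.tail v) := by
        filter_upwards [hf.eventually (natCast_ne_infty _)] with y hy
        exact ih (hy.of_le (by norm_cast; omega)) j _
      rw [hev.fderiv_eq]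

/-- Schwarz's theorem for iterated derivatives of all orders. -/
theorem iteratedFDeriv_comp_perm {f : E → F} {x : E} {n : ℕ} (hf : ContDiffAt ℝ n f x)
    (σ : Equiv.Perm (Fin n)) (v : Fin n → E) :
    iteratedFDeriv ℝ n f x (v ∘ σ) = iteratedFDeriv ℝ n f x v := by
  cases n with
  | zero => congr 1; ext i; exact i.elim0
  | succ n =>
    have hσ : σ ∈ Submonoid.closure
        (Set.range fun i : Fin n => Equiv.swap i.castSucc i.succ) := by
      rw [Equiv.Perm.mclosure_swap_castSucc_succ]; trivial
    induction hσ using Submonoid.closure_induction generalizing v with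
    | mem τ hτ =>
      obtain ⟨i, rfl⟩ := hτ
      exact iteratedFDeriv_comp_adjacent_swap hf i v
    | one => rfl
    | mul τ τ' _ _ h h' =>
      rw [Equiv.Perm.coe_mul, ← Function.comp_assoc, h', h]

end IteratedDerivatives

section MixedDerivatives

variable {X Y : Type*} [NormedAddCommGroup X] [NormedSpace ℝ X]
  [NormedAddCommGroup Y] [NormedSpace ℝ Y]

/-- The mixed partial derivative `∂_x^m ∂_y^l` is the total derivative of order `m + l`, evaluated
at `m` directions of `X` and `l` directions of `Y`. -/
theorem iteratedFDeriv_partial_apply {f : X × Y → ℂ} {x : X} {y : Y} {m l : ℕ}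
    (hf : ContDiffAt ℝ ((m + l : ℕ) : ℕ∞ω) f (x, y)) (u : Fin m → X) (v : Fin l → Y) :
    iteratedFDeriv ℝ m (fun x' => iteratedFDeriv ℝ l (fun y' => f (x', y')) y) x u v =
      iteratedFDeriv ℝ (m + l) f (x, y) (Fin.append (fun i => (u i, 0)) (fun j => (0, v j))) := by
  have hcont : Continuous fun x' : X => (x', y) := by fun_prop
  have hev : (fun x' => iteratedFDeriv ℝ l (fun y' => f (x', y')) y) =ᶠ[𝓝 x]
      fun x' => ContinuousMultilinearMap.compContinuousLinearMapL (𝕜 := ℝ) (F := ℂ)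
        (fun _ : Fin l => ContinuousLinearMap.inr ℝ X Y) (iteratedFDeriv ℝ l f (x', y)) := by
    have := hcont.continuousAt.eventually (hf.eventually (natCast_ne_infty _))
    filter_upwards [this] with x' hx'
    have h := iteratedFDeriv_comp_affine (f := f) (x', (0 : Y)) (ContinuousLinearMap.inr ℝ X Y)
      (x := y) (n := l) (by simpa using hx'.of_le (by norm_cast; omega))
    simp only [ContinuousLinearMap.inr_apply, Prod.mk_add_mk, add_zero, zero_add] at h
    rw [h]
    rfl
  have hg : ContDiffAt ℝ m (iteratedFDeriv ℝ l f) (x, y) :=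
    hf.iteratedFDeriv_right (by norm_cast)
  have h1 := iteratedFDeriv_comp_affine (f := iteratedFDeriv ℝ l f) ((0 : X), y)
    (ContinuousLinearMap.inl ℝ X Y) (x := x) (n := m) (by simpa using hg)
  simp only [ContinuousLinearMap.inl_apply, Prod.mk_add_mk, add_zero, zero_add] at h1
  rw [iteratedFDeriv_congr hev]
  have h2 : ContDiffAt ℝ m (fun x' => iteratedFDeriv ℝ l f (x', y)) x :=
    ContDiffAt.comp x hg (by fun_prop)
  have h3 := (ContinuousMultilinearMap.compContinuousLinearMapL (𝕜 := ℝ) (F := ℂ)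
        (fun _ : Fin l => ContinuousLinearMap.inr ℝ X Y)).iteratedFDeriv_comp_left h2 (i := m) le_rfl
  have h4 := iteratedFDeriv_iteratedFDeriv_apply hf (fun i => (u i, (0 : Y)))
    (fun j => ((0 : X), v j))
  rw [← h4]
  change iteratedFDeriv ℝ m ((ContinuousMultilinearMap.compContinuousLinearMapL (𝕜 := ℝ) (F := ℂ)
      (fun _ : Fin l => ContinuousLinearMap.inr ℝ X Y)) ∘
        (fun x' => iteratedFDeriv ℝ l f (x', y))) x u v = _
  rw [h3, h1]
  rfl

/-- A bound for the total derivative of order `n` in terms of the mixed partial derivatives. -/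
theorem norm_iteratedFDeriv_apply_le_of_partial {f : X × Y → ℂ} {x : X} {y : Y} {n : ℕ}
    (hf : ContDiffAt ℝ n f (x, y)) {C r : ℝ} (hC : ∀ m l : ℕ, m + l = n →
      ‖iteratedFDeriv ℝ m (fun x' => iteratedFDeriv ℝ l (fun y' => f (x', y')) y) x‖ * r ^ m ≤ C)
    (hr : 0 ≤ r) (w : Fin n → X × Y) :
    ‖iteratedFDeriv ℝ n f (x, y) (fun i => (r • (w i).1, (w i).2))‖ ≤ 2 ^ n * C * ∏ i, ‖w i‖ := by
  have hsplit : (fun i => (r • (w i).1, (w i).2)) =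
      (fun i => (r • (w i).1, (0 : Y))) + fun i => ((0 : X), (w i).2) := by
    ext i <;> simp
  -- by multilinearity, a sum over the sets `s` of slots that receive the component in `X`
  rw [hsplit, ContinuousMultilinearMap.map_add_univ]
  have hs : ∀ s : Finset (Fin n), ‖iteratedFDeriv ℝ n f (x, y)
      (s.piecewise (fun i => (r • (w i).1, (0 : Y))) fun i => ((0 : X), (w i).2))‖
        ≤ C * ∏ i, ‖w i‖ := by
    intro s
    obtain ⟨m, hm⟩ : ∃ m, s.card = m := ⟨_, rfl⟩
    obtain ⟨l, hl⟩ : ∃ l, sᶜ.card = l := ⟨_, rfl⟩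
    have hn : m + l = n := by
      rw [← hm, ← hl, Finset.card_add_card_compl, Fintype.card_fin]
    have hb := hC m l hn
    subst hn
    -- `σ` moves the slots of `s` to the front, where they form a mixed partial derivative
    let σ : Equiv.Perm (Fin (m + l)) := finSumFinEquiv.symm.trans (finSumEquivOfFinset hm hl)
    have hσl : ∀ i : Fin m, σ (Fin.castAdd l i) = s.orderEmbOfFin hm i := by
      intro i; simp [σ]
    have hσr : ∀ i : Fin l, σ (Fin.natAdd m i) = sᶜ.orderEmbOfFin hl i := by
      intro i; simp [σ]
    rw [← iteratedFDeriv_comp_perm hf σ]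
    have happ : (s.piecewise (fun i => (r • (w i).1, (0 : Y))) fun i => ((0 : X), (w i).2)) ∘ σ =
        Fin.append (fun i : Fin m => (r • (w (σ (Fin.castAdd l i))).1, (0 : Y)))
          (fun j : Fin l => ((0 : X), (w (σ (Fin.natAdd m j))).2)) := by
      ext1 i
      refine Fin.addCases (fun i => ?_) (fun i => ?_) i
      · rw [Fin.append_left, Function.comp_apply, Finset.piecewise_eq_of_mem]
        rw [hσl]; exact Finset.orderEmbOfFin_mem s hm i
      · rw [Fin.append_right, Function.comp_apply, Finset.piecewise_eq_of_notMem]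
        rw [hσr]; exact Finset.mem_compl.1 (Finset.orderEmbOfFin_mem sᶜ hl i)
    rw [happ, ← iteratedFDeriv_partial_apply hf]
    refine (ContinuousMultilinearMap.le_opNorm _ _).trans ?_
    refine (mul_le_mul_of_nonneg_right (ContinuousMultilinearMap.le_opNorm _ _)
      (by positivity)).trans ?_
    have hprod : ∏ i, ‖w i‖ = (∏ i : Fin m, ‖w (σ (Fin.castAdd l i))‖) *
        ∏ j : Fin l, ‖w (σ (Fin.natAdd m j))‖ := by
      rw [← Equiv.prod_comp σ, Fin.prod_univ_add]
    have h1 : ∏ i : Fin m, ‖r • (w (σ (Fin.castAdd l i))).1‖ ≤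
        r ^ m * ∏ i : Fin m, ‖w (σ (Fin.castAdd l i))‖ := by
      calc _ ≤ ∏ i : Fin m, r * ‖w (σ (Fin.castAdd l i))‖ := by
            refine Finset.prod_le_prod (fun _ _ => norm_nonneg _) fun i _ => ?_
            rw [norm_smul, Real.norm_of_nonneg hr]
            exact mul_le_mul_of_nonneg_left (norm_fst_le _) hr
        _ = _ := by simp [Finset.prod_mul_distrib]
    have h2 : ∏ j : Fin l, ‖(w (σ (Fin.natAdd m j))).2‖ ≤
        ∏ j : Fin l, ‖w (σ (Fin.natAdd m j))‖ :=
      Finset.prod_le_prod (fun _ _ => norm_nonneg _) fun i _ => norm_snd_le _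
    rw [hprod]
    calc _ ≤ ‖iteratedFDeriv ℝ m (fun x' => iteratedFDeriv ℝ l (fun y' => f (x', y')) y) x‖ *
          (r ^ m * ∏ i : Fin m, ‖w (σ (Fin.castAdd l i))‖) *
          ∏ j : Fin l, ‖w (σ (Fin.natAdd m j))‖ := by gcongr
      _ = ‖iteratedFDeriv ℝ m (fun x' => iteratedFDeriv ℝ l (fun y' => f (x', y')) y) x‖ *
          r ^ m * ((∏ i : Fin m, ‖w (σ (Fin.castAdd l i))‖) *
          ∏ j : Fin l, ‖w (σ (Fin.natAdd m j))‖) := by ring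
      _ ≤ _ := mul_le_mul_of_nonneg_right hb (by positivity)
  refine (norm_sum_le _ _).trans ((Finset.sum_le_sum fun s _ => hs s).trans_eq ?_)
  simp [Fintype.card_finset, mul_assoc]

end MixedDerivatives

/-! ### Distance to the reciprocal lattice -/

section LatticeDistance

variable (a : Module.Basis (Fin 3) ℝ Vec)

/-- The distance of `x` to the reciprocal lattice. It is the length scale of all estimates. -/
def latDist (x : Vec) : ℝ := Metric.infDist x (recipLattice a : Set Vec)

instance : DiscreteTopology (recipLattice a) :=
  inferInstanceAs (DiscreteTopology (Submodule.span ℤ (Set.range (recipBasis a))))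

theorem recipLattice_nonempty : (recipLattice a : Set Vec).Nonempty := ⟨0, zero_mem _⟩

theorem isClosed_recipLattice : IsClosed (recipLattice a : Set Vec) := by
  have : DiscreteTopology (recipLattice a).toAddSubgroup :=
    inferInstanceAs (DiscreteTopology (recipLattice a))
  exact AddSubgroup.isClosed_of_discrete (H := (recipLattice a).toAddSubgroup)

theorem countable_recipLattice : (recipLattice a : Set Vec).Countable :=
  inferInstanceAs (Countable (Submodule.span ℤ (Set.range (recipBasis a))))

theorem volume_recipLattice : volume (recipLattice a : Set Vec) = 0 :=
  (countable_recipLattice a).measure_zero _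

variable {a}

theorem latDist_nonneg (x : Vec) : 0 ≤ latDist a x := Metric.infDist_nonneg

theorem latDist_pos {x : Vec} : 0 < latDist a x ↔ x ∉ recipLattice a := by
  rw [latDist, ← (isClosed_recipLattice a).notMem_iff_infDist_pos (recipLattice_nonempty a)]
  rfl

theorem latDist_le_norm_sub {x G : Vec} (hG : G ∈ recipLattice a) : latDist a x ≤ ‖x - G‖ := by
  rw [← dist_eq_norm]
  exact Metric.infDist_le_dist_of_mem hG

theorem latDist_le_norm (x : Vec) : latDist a x ≤ ‖x‖ := by
  simpa using latDist_le_norm_sub (a := a) (x := x) (zero_mem _)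

theorem latDist_le_add (x y : Vec) : latDist a x ≤ latDist a y + ‖x - y‖ := by
  rw [← dist_eq_norm]
  exact Metric.infDist_le_infDist_add_dist

theorem exists_norm_sub_eq_latDist (x : Vec) : ∃ G ∈ recipLattice a, ‖x - G‖ = latDist a x := by
  obtain ⟨G, hG, h⟩ := (isClosed_recipLattice a).exists_infDist_eq_dist (recipLattice_nonempty a) x
  exact ⟨G, hG, by rw [latDist, h, dist_eq_norm]⟩

/-- The distance to the lattice is subadditive, being a norm on the torus. -/
theorem latDist_le_latDist_add_latDist (x y : Vec) :
    latDist a x ≤ latDist a y + latDist a (x - y) := by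
  obtain ⟨G, hG, h⟩ := exists_norm_sub_eq_latDist (a := a) y
  obtain ⟨G', hG', h'⟩ := exists_norm_sub_eq_latDist (a := a) (x - y)
  rw [← h, ← h']
  refine (latDist_le_norm_sub (add_mem hG hG')).trans ((le_of_eq ?_).trans (norm_add_le _ _))
  congr 1
  abel

theorem latDist_neg (x : Vec) : latDist a (-x) = latDist a x := by
  have key : ∀ x : Vec, latDist a (-x) ≤ latDist a x := fun x => by
    obtain ⟨G, hG, h⟩ := exists_norm_sub_eq_latDist (a := a) x
    rw [← h, ← norm_neg (x - G)]
    refine (latDist_le_norm_sub (neg_mem hG)).trans_eq ?_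
    congr 1
    abel
  exact le_antisymm (key x) (by simpa using key (-x))

theorem latDist_add_of_mem {G : Vec} (hG : G ∈ recipLattice a) (x : Vec) :
    latDist a (x + G) = latDist a x := by
  have key : ∀ x : Vec, ∀ G ∈ recipLattice a, latDist a (x + G) ≤ latDist a x := fun x G hG => by
    obtain ⟨G', hG', h⟩ := exists_norm_sub_eq_latDist (a := a) x
    rw [← h]
    refine (latDist_le_norm_sub (add_mem hG' hG)).trans_eq ?_
    congr 1
    abel
  exact le_antisymm (key x G hG) (by simpa using key (x + G) (-G) (neg_mem hG))

theorem continuous_latDist : Continuous (latDist a) := Metric.continuous_infDist_pt _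

variable (a) in
/-- Distinct lattice points are at least `2 r` apart for some `r`, so that `0` is the nearest lattice
point of every vector shorter than `r`. -/
theorem exists_latticeGap : ∃ r > 0, ∀ G ∈ recipLattice a, ‖G‖ < 2 * r → G = 0 := by
  obtain ⟨r, hr, h⟩ := Metric.exists_ball_inter_eq_singleton_of_mem_discrete
    (s := (recipLattice a : Set Vec)) (isDiscrete_iff_discreteTopology.2
      (inferInstanceAs (DiscreteTopology (recipLattice a))))
    (zero_mem (recipLattice a))
  refine ⟨r / 2, by positivity, fun G hG hn => ?_⟩
  have : G ∈ Metric.ball (0 : Vec) r ∩ (recipLattice a : Set Vec) :=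
    ⟨by simpa using by linarith, hG⟩
  rw [h] at this
  exact this

theorem latDist_eq_norm {r : ℝ} (hr : ∀ G ∈ recipLattice a, ‖G‖ < 2 * r → G = 0) {x : Vec}
    (hx : ‖x‖ < r) : latDist a x = ‖x‖ := by
  obtain ⟨G, hG, h⟩ := exists_norm_sub_eq_latDist (a := a) x
  have h1 := latDist_le_norm (a := a) x
  have h2 : ‖G‖ < 2 * r := by
    have := norm_sub_norm_le G x
    rw [norm_sub_rev] at this
    linarith
  rw [← h, hr G hG h2, sub_zero]

end LatticeDistance

/-! ### Symbols with a power singularity on the reciprocal lattice -/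

section Symbols

variable {Z Y W : Type*} [NormedAddCommGroup Z] [NormedSpace ℝ Z]
  [NormedAddCommGroup Y] [NormedSpace ℝ Y] [NormedAddCommGroup W] [NormedSpace ℝ W]

variable (Z) in
/-- The anisotropic dilation `(v, u) ↦ (s • v, u)`. -/
def scaleMap (s : ℝ) : Vec × Z →L[ℝ] Vec × Z :=
  (s • ContinuousLinearMap.fst ℝ Vec Z).prod (ContinuousLinearMap.snd ℝ Vec Z)

@[simp]
theorem scaleMap_apply (s : ℝ) (w : Vec × Z) : scaleMap Z s w = (s • w.1, w.2) := rfl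

/-- `f(x, z)` is smooth for `x ∈ S` and is `O(d(x)^{-ν})` there, `d` being the distance to the
reciprocal lattice, where a derivative in `x` costs one power of `d(x)` and a derivative in `z`
costs nothing. All of these bounds are expressed at once: the derivatives of
`w ↦ f(x + d(x) w₁, z + w₂)` at `0` are `O(d(x)^{-ν})`. Bounds are locally uniform in `(x, z)`. -/
structure SymbolOn (a : Module.Basis (Fin 3) ℝ Vec) (S : Set Vec) (ν : ℕ) (f : Vec × Z → ℂ) :
    Prop where
  smooth : ∀ x ∈ S, ∀ z, ContDiffAt ℝ ∞ f (x, z)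
  bound : ∀ (R : ℝ) (n : ℕ), ∃ C, ∀ x ∈ S, ∀ z, ‖x‖ ≤ R → ‖z‖ ≤ R →
    ‖iteratedFDeriv ℝ n (fun w => f ((x, z) + scaleMap Z (latDist a x) w)) 0‖
      ≤ C / latDist a x ^ ν

variable {a : Module.Basis (Fin 3) ℝ Vec} {S : Set Vec} {ν ν' : ℕ} {f g : Vec × Z → ℂ}

theorem contDiffAt_comp_affine {E : Type*} [NormedAddCommGroup E] [NormedSpace ℝ E]
    {n : ℕ∞ω} {f : E → ℂ} {c : E} {w : W} (L : W →L[ℝ] E) (hf : ContDiffAt ℝ n f (c + L w)) :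
    ContDiffAt ℝ n (fun w => f (c + L w)) w :=
  ContDiffAt.comp w hf (contDiffAt_const.add L.contDiff.contDiffAt)

theorem _root_.ContDiffAt.of_infty {E F : Type*} [NormedAddCommGroup E] [NormedSpace ℝ E]
    [NormedAddCommGroup F] [NormedSpace ℝ F] {f : E → F} {x : E}
    (h : ContDiffAt ℝ ∞ f x) (n : ℕ) : ContDiffAt ℝ n f x := h.of_le (by exact_mod_cast le_top)

/-- The symbol bounds along an affine map whose linear part is dominated by the dilation. -/
theorem SymbolOn.exists_bound_comp (hf : SymbolOn a S ν f) (R M : ℝ) (n : ℕ) :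
    ∃ C, 0 ≤ C ∧ ∀ x ∈ S, ∀ z, ‖x‖ ≤ R → ‖z‖ ≤ R → ∀ (L : W →L[ℝ] Vec × Z), ‖L‖ ≤ M →
      ‖iteratedFDeriv ℝ n (fun w => f ((x, z) + scaleMap Z (latDist a x) (L w))) 0‖
        ≤ C / latDist a x ^ ν := by
  obtain ⟨C, hC⟩ := hf.bound R n
  refine ⟨max C 0 * (max M 0) ^ n, by positivity, fun x hx z hxR hzR L hL => ?_⟩
  have hs : ContDiffAt ℝ n (fun w => f ((x, z) + scaleMap Z (latDist a x) w)) (0 + L 0) := by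
    refine contDiffAt_comp_affine _ ?_
    simpa using (hf.smooth x hx z).of_infty n
  have h := norm_iteratedFDeriv_comp_affine_le
    (f := fun w => f ((x, z) + scaleMap Z (latDist a x) w)) 0 L (x := 0) (n := n) hs
  simp only [zero_add, map_zero] at h
  have hM : ‖L‖ ≤ max M 0 := hL.trans (le_max_left _ _)
  have h0 := latDist_nonneg (a := a) x
  calc _ ≤ _ := h
    _ ≤ (C / latDist a x ^ ν) * (max M 0) ^ n := by
        gcongr
        · exact (norm_nonneg _).trans (hC x hx z hxR hzR)
        · exact hC x hx z hxR hzR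
    _ ≤ (max C 0 / latDist a x ^ ν) * (max M 0) ^ n := by gcongr; exact le_max_left _ _
    _ = _ := by ring

theorem SymbolOn.exists_bound (hf : SymbolOn a S ν f) (R : ℝ) (n : ℕ) :
    ∃ C, 0 ≤ C ∧ ∀ x ∈ S, ∀ z, ‖x‖ ≤ R → ‖z‖ ≤ R →
      ‖iteratedFDeriv ℝ n (fun w => f ((x, z) + scaleMap Z (latDist a x) w)) 0‖
        ≤ C / latDist a x ^ ν := by
  obtain ⟨C, hC, h⟩ := hf.exists_bound_comp (W := Vec × Z) R 1 n
  exact ⟨C, hC, fun x hx z h1 h2 => h x hx z h1 h2 (.id ℝ _) ContinuousLinearMap.norm_id_le⟩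

theorem SymbolOn.exists_bound_norm (hf : SymbolOn a S ν f) (R : ℝ) :
    ∃ C, 0 ≤ C ∧ ∀ x ∈ S, ∀ z, ‖x‖ ≤ R → ‖z‖ ≤ R → ‖f (x, z)‖ ≤ C / latDist a x ^ ν := by
  obtain ⟨C, hC, h⟩ := hf.exists_bound R 0
  exact ⟨C, hC, fun x hx z h1 h2 => by simpa using h x hx z h1 h2⟩

theorem SymbolOn.congr (hf : SymbolOn a S ν f) (hS : IsOpen S)
    (h : ∀ x ∈ S, ∀ z, g (x, z) = f (x, z)) : SymbolOn a S ν g := by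
  have hev : ∀ x ∈ S, ∀ z, g =ᶠ[𝓝 (x, z)] f := fun x hx z => by
    filter_upwards [(hS.preimage continuous_fst).mem_nhds (show (x, z).1 ∈ S from hx)] with p hp
    exact h p.1 hp p.2
  refine ⟨fun x hx z => (hf.smooth x hx z).congr_of_eventuallyEq (hev x hx z), fun R n => ?_⟩
  obtain ⟨C, hC⟩ := hf.bound R n
  refine ⟨C, fun x hx z h1 h2 => ?_⟩
  have hc : Tendsto (fun w => (x, z) + scaleMap Z (latDist a x) w) (𝓝 0) (𝓝 (x, z)) := by
    have : Continuous (fun w => (x, z) + scaleMap Z (latDist a x) w) := by fun_prop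
    simpa using this.tendsto 0
  have := iteratedFDeriv_congr ((hev x hx z).comp_tendsto hc) n
  exact (congrArg norm this).trans_le (hC x hx z h1 h2)

theorem SymbolOn.add (hf : SymbolOn a S ν f) (hg : SymbolOn a S ν g) :
    SymbolOn a S ν (fun p => f p + g p) := by
  refine ⟨fun x hx z => (hf.smooth x hx z).add (hg.smooth x hx z), fun R n => ?_⟩
  obtain ⟨C, hC⟩ := hf.bound R n
  obtain ⟨C', hC'⟩ := hg.bound R n
  refine ⟨C + C', fun x hx z h1 h2 => ?_⟩
  have hf' := contDiffAt_comp_affine (c := (x, z)) (w := 0) (scaleMap Z (latDist a x))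
    (by simpa using (hf.smooth x hx z).of_infty n)
  have hg' := contDiffAt_comp_affine (c := (x, z)) (w := 0) (scaleMap Z (latDist a x))
    (by simpa using (hg.smooth x hx z).of_infty n)
  rw [fun_iteratedFDeriv_add_apply hf' hg', add_div]
  exact (norm_add_le _ _).trans (add_le_add (hC x hx z h1 h2) (hC' x hx z h1 h2))

theorem SymbolOn.mul (hf : SymbolOn a S ν f) (hg : SymbolOn a S ν' g) :
    SymbolOn a S (ν + ν') (fun p => f p * g p) := by
  refine ⟨fun x hx z => (hf.smooth x hx z).mul (hg.smooth x hx z), fun R n => ?_⟩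
  choose C hC0 hC using hf.exists_bound R
  choose C' hC0' hC' using hg.exists_bound R
  refine ⟨∑ i ∈ Finset.range (n + 1), (n.choose i : ℝ) * C i * C' (n - i), fun x hx z h1 h2 => ?_⟩
  have hf' := contDiffAt_comp_affine (c := (x, z)) (w := 0) (scaleMap Z (latDist a x))
    (by simpa using hf.smooth x hx z)
  have hg' := contDiffAt_comp_affine (c := (x, z)) (w := 0) (scaleMap Z (latDist a x))
    (by simpa using hg.smooth x hx z)
  refine (norm_iteratedFDeriv_mul_le_of_contDiffAt hf' hg').trans ?_
  rw [Finset.sum_div]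
  refine Finset.sum_le_sum fun i _ => ?_
  have h0 := latDist_nonneg (a := a) x
  calc _ ≤ (n.choose i : ℝ) * (C i / latDist a x ^ ν) * (C' (n - i) / latDist a x ^ ν') := by
        have h3 := hC i x hx z h1 h2
        have h4 := hC' (n - i) x hx z h1 h2
        have h5 := hC0 i
        gcongr
    _ = _ := by rw [pow_add]; field_simp

/-- A function that is smooth on a closed set is a symbol of order `0` there. -/
theorem SymbolOn.of_contDiffAt [FiniteDimensional ℝ Z] {K : Set Vec} (hK : IsClosed K)
    (hSK : S ⊆ K) (hf : ∀ x ∈ K, ∀ z, ContDiffAt ℝ ∞ f (x, z)) : SymbolOn a S 0 f := by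
  refine ⟨fun x hx => hf x (hSK hx), fun R n => ?_⟩
  have : ProperSpace Z := FiniteDimensional.proper ℝ Z
  have hc : IsCompact ((K ∩ Metric.closedBall 0 R) ×ˢ Metric.closedBall (0 : Z) R) :=
    ((isCompact_closedBall _ _).inter_left hK).prod (isCompact_closedBall _ _)
  obtain ⟨C, hC⟩ := hc.exists_bound_of_continuousOn (f := iteratedFDeriv ℝ n f) (by
    rintro ⟨x, z⟩ hp
    exact (((hf x hp.1.1 z).of_infty n).continuousAt_iteratedFDeriv le_rfl).continuousWithinAt)
  refine ⟨C * (max R 1) ^ n, fun x hx z h1 h2 => ?_⟩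
  have hb := hC (x, z) ⟨⟨hSK hx, by simpa using h1⟩, by simpa using h2⟩
  have h := norm_iteratedFDeriv_comp_affine_le (f := f) (x, z) (scaleMap Z (latDist a x)) (x := 0)
    (n := n) (by simpa using (hf x (hSK hx) z).of_infty n)
  simp only [map_zero, add_zero] at h
  refine h.trans ?_
  rw [pow_zero, div_one]
  have hn : ‖scaleMap Z (latDist a x)‖ ≤ max R 1 := by
    refine ContinuousLinearMap.opNorm_le_bound _ (by positivity) fun w => ?_
    rw [scaleMap_apply, Prod.norm_def]
    refine max_le ?_ ?_
    · rw [norm_smul, Real.norm_of_nonneg (latDist_nonneg x)]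
      gcongr
      · exact ((latDist_le_norm x).trans h1).trans (le_max_left _ _)
      · exact norm_fst_le w
    · calc ‖w.2‖ ≤ 1 * ‖w‖ := by rw [one_mul]; exact norm_snd_le w
        _ ≤ _ := by gcongr; exact le_max_right _ _
  have hC0 : 0 ≤ C := (norm_nonneg _).trans hb
  gcongr

theorem SymbolOn.of_contDiff [FiniteDimensional ℝ Z] (hf : ContDiff ℝ ∞ f) : SymbolOn a S 0 f :=
  .of_contDiffAt isClosed_univ (subset_univ _) fun _ _ _ => hf.contDiffAt

theorem SymbolOn.const_mul (hf : SymbolOn a S ν f) (c : ℂ) : SymbolOn a S ν (fun p => c * f p) := by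
  refine ⟨fun x hx z => contDiffAt_const.mul (hf.smooth x hx z), fun R n => ?_⟩
  obtain ⟨C, hC⟩ := hf.bound R n
  refine ⟨‖c‖ * C, fun x hx z h1 h2 => ?_⟩
  have hf' := contDiffAt_comp_affine (c := (x, z)) (w := 0) (scaleMap Z (latDist a x))
    (by simpa using (hf.smooth x hx z).of_infty n)
  have := iteratedFDeriv_const_smul_apply' (𝕜 := ℝ) (a := c) hf'
  simp only [smul_eq_mul] at this
  rw [this, norm_smul, mul_div_assoc]
  gcongr
  exact hC x hx z h1 h2

theorem SymbolOn.zero : SymbolOn a S ν (fun _ : Vec × Z => (0 : ℂ)) :=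
  ⟨fun _ _ _ => contDiffAt_const, fun R n => ⟨0, fun x hx z h1 h2 => by simp⟩⟩

theorem SymbolOn.sum {ι : Type*} {s : Finset ι} {f : ι → Vec × Z → ℂ}
    (hf : ∀ i ∈ s, SymbolOn a S ν (f i)) : SymbolOn a S ν (fun p => ∑ i ∈ s, f i p) := by
  classical
  induction s using Finset.induction_on with
  | empty => simpa using SymbolOn.zero
  | insert i s hi ih =>
    simp only [Finset.sum_insert hi]
    exact (hf i (by simp)).add (ih fun j hj => hf j (by simp [hj]))

/-- The order may be increased, since the distance to the lattice is locally bounded. -/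
theorem SymbolOn.of_le (hf : SymbolOn a S ν f) (hS : ∀ x ∈ S, x ∉ recipLattice a) (h : ν ≤ ν') :
    SymbolOn a S ν' f := by
  refine ⟨hf.smooth, fun R n => ?_⟩
  obtain ⟨C, hC0, hC⟩ := hf.exists_bound R n
  refine ⟨C * (max R 0) ^ (ν' - ν), fun x hx z h1 h2 => (hC x hx z h1 h2).trans ?_⟩
  have hd : 0 < latDist a x := latDist_pos.2 (hS x hx)
  have hR : latDist a x ≤ max R 0 := ((latDist_le_norm x).trans h1).trans (le_max_left _ _)
  rw [div_le_div_iff₀ (by positivity) (by positivity)]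
  calc C * latDist a x ^ ν' = C * latDist a x ^ (ν' - ν) * latDist a x ^ ν := by
        rw [mul_assoc, ← pow_add, Nat.sub_add_cancel h]
    _ ≤ _ := by gcongr

/-- Symbols are stable under linear substitutions in the parameter. -/
theorem SymbolOn.comp_linear {f : Vec × Y → ℂ} (hf : SymbolOn a S ν f) (Λ : Vec × Z →L[ℝ] Y) :
    SymbolOn a S ν (fun p => f (p.1, Λ p)) := by
  refine ⟨fun x hx z => ?_, fun R n => ?_⟩
  · exact ContDiffAt.comp (x, z) (hf.smooth x hx _)
      (contDiffAt_fst.prodMk Λ.contDiff.contDiffAt)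
  · obtain ⟨C, hC0, hC⟩ := hf.exists_bound_comp (W := Vec × Z) (max R (‖Λ‖ * R))
      (max 1 (‖Λ‖ * max R 1)) n
    refine ⟨C, fun x hx z h1 h2 => ?_⟩
    have hz : ‖Λ (x, z)‖ ≤ ‖Λ‖ * R :=
      (Λ.le_opNorm _).trans (by gcongr; exact max_le h1 h2)
    let L : Vec × Z →L[ℝ] Vec × Y :=
      (ContinuousLinearMap.fst ℝ Vec Z).prod (Λ.comp (scaleMap Z (latDist a x)))
    have hL : ‖L‖ ≤ max 1 (‖Λ‖ * max R 1) := by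
      refine ContinuousLinearMap.opNorm_le_bound _ (by positivity) fun w => ?_
      change max ‖w.1‖ ‖Λ (latDist a x • w.1, w.2)‖ ≤ _
      refine max_le ?_ ?_
      · calc ‖w.1‖ ≤ 1 * ‖w‖ := by rw [one_mul]; exact norm_fst_le w
          _ ≤ _ := by gcongr; exact le_max_left _ _
      · calc ‖Λ (latDist a x • w.1, w.2)‖ ≤ ‖Λ‖ * (max R 1 * ‖w‖) := by
              refine (Λ.le_opNorm _).trans ?_
              gcongr
              refine max_le ?_ ?_
              · rw [norm_smul, Real.norm_of_nonneg (latDist_nonneg x)]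
                gcongr
                · exact ((latDist_le_norm x).trans h1).trans (le_max_left _ _)
                · exact norm_fst_le w
              · calc ‖w.2‖ ≤ 1 * ‖w‖ := by rw [one_mul]; exact norm_snd_le w
                  _ ≤ _ := by gcongr; exact le_max_right _ _
          _ = (‖Λ‖ * max R 1) * ‖w‖ := by ring
          _ ≤ _ := by gcongr; exact le_max_right _ _
    have h := hC x hx (Λ (x, z)) (h1.trans (le_max_left _ _)) (hz.trans (le_max_right _ _)) L hL
    convert h using 4 with w
    · simp [L, ← map_add]

/-- Symbols are stable under the reflection `x ↦ -x`. -/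
theorem SymbolOn.comp_neg (hf : SymbolOn a S ν f) (hS : ∀ x ∈ S, -x ∈ S) :
    SymbolOn a S ν (fun p => f (-p.1, p.2)) := by
  refine ⟨fun x hx z => ?_, fun R n => ?_⟩
  · exact ContDiffAt.comp (x, z) (hf.smooth (-x) (hS x hx) _)
      (contDiffAt_fst.neg.prodMk contDiffAt_snd)
  · obtain ⟨C, hC0, hC⟩ := hf.exists_bound_comp (W := Vec × Z) R 1 n
    refine ⟨C, fun x hx z h1 h2 => ?_⟩
    let L : Vec × Z →L[ℝ] Vec × Z :=
      (-ContinuousLinearMap.fst ℝ Vec Z).prod (ContinuousLinearMap.snd ℝ Vec Z)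
    have hL : ‖L‖ ≤ 1 := by
      refine ContinuousLinearMap.opNorm_le_bound _ zero_le_one fun w => ?_
      change max ‖-w.1‖ ‖w.2‖ ≤ _
      rw [norm_neg, one_mul, Prod.norm_def]
    have h := hC (-x) (hS x hx) z (by rwa [norm_neg]) h2 L hL
    rw [latDist_neg] at h
    convert h using 4 with w
    · simp only [Prod.mk_add_mk, scaleMap_apply, L, ContinuousLinearMap.prod_apply,
        neg_apply, ContinuousLinearMap.coe_fst', ContinuousLinearMap.coe_snd']
      simp [add_comm]

/-- A function of `x` that is homogeneous of degree `-ν` and smooth away from `0` is a symbol of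
order `ν` near `0`. -/
theorem SymbolOn.of_homogeneous {r : ℝ} (hr : ∀ G ∈ recipLattice a, ‖G‖ < 2 * r → G = 0)
    {η : Vec → ℂ} (hη : ∀ x ≠ 0, ContDiffAt ℝ ∞ η x)
    (hom : ∀ t > (0 : ℝ), ∀ x, η (t • x) = (t ^ ν)⁻¹ * η x) :
    SymbolOn a {x | 0 < ‖x‖ ∧ ‖x‖ < r} ν (fun p : Vec × Z => η p.1) := by
  refine ⟨fun x hx z => ContDiffAt.comp (x, z) (hη x (norm_pos_iff.1 hx.1)) contDiffAt_fst,
    fun R n => ?_⟩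
  obtain ⟨C, hC⟩ := (isCompact_sphere (0 : Vec) 1).exists_bound_of_continuousOn
    (f := iteratedFDeriv ℝ n η) (by
      intro x hx
      have hx0 : x ≠ 0 := by rintro rfl; simp at hx
      exact (((hη x hx0).of_infty n).continuousAt_iteratedFDeriv le_rfl).continuousWithinAt)
  refine ⟨C, fun x hx z _ _ => ?_⟩
  have hd : latDist a x = ‖x‖ := latDist_eq_norm hr hx.2
  have hx0 : 0 < ‖x‖ := hx.1
  rw [hd]
  have hu : ‖(‖x‖⁻¹ • x)‖ = 1 := by rw [norm_smul, norm_inv, norm_norm, inv_mul_cancel₀ hx0.ne']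
  have hu0 : ‖x‖⁻¹ • x ≠ 0 := by rw [← norm_pos_iff, hu]; exact one_pos
  -- by homogeneity, the dilated function is determined by `η` near the unit vector `x / ‖x‖`
  have e : (fun w : Vec × Z => η ((x, z) + scaleMap Z ‖x‖ w).1) =
      fun w => ((‖x‖ ^ ν)⁻¹ : ℝ) • η (‖x‖⁻¹ • x + ContinuousLinearMap.fst ℝ Vec Z w) := by
    ext w
    have := hom ‖x‖ hx0 (‖x‖⁻¹ • x + w.1)
    rw [smul_add, smul_smul, mul_inv_cancel₀ hx0.ne', one_smul] at this
    simpa [Complex.real_smul] using this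
  have hs : ContDiffAt ℝ n η (‖x‖⁻¹ • x + ContinuousLinearMap.fst ℝ Vec Z 0) := by
    simpa using (hη _ hu0).of_infty n
  rw [e, iteratedFDeriv_const_smul_apply' (contDiffAt_comp_affine _ hs), norm_smul]
  have h := norm_iteratedFDeriv_comp_affine_le (‖x‖⁻¹ • x) (ContinuousLinearMap.fst ℝ Vec Z) hs
  have h1 : ‖ContinuousLinearMap.fst ℝ Vec Z‖ ^ n ≤ 1 :=
    pow_le_one₀ (norm_nonneg _) (ContinuousLinearMap.norm_fst_le _ _ _)
  have h2 := hC (‖x‖⁻¹ • x) (by simp [hu])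
  simp only [map_zero, add_zero] at h
  rw [norm_inv, Real.norm_of_nonneg (by positivity), div_eq_inv_mul]
  gcongr
  calc _ ≤ _ := h
    _ ≤ C * 1 := by gcongr; exact (norm_nonneg _).trans h2
    _ = C := mul_one C

/-- A function that is periodic in `x` and smooth off the lattice is a symbol if it is one near
`x = 0`. -/
theorem SymbolOn.of_near_zero [FiniteDimensional ℝ Z] {r : ℝ} (hr : 0 < r)
    (hf : SymbolOn a {x | 0 < ‖x‖ ∧ ‖x‖ < r} ν f)
    (hsm : ∀ x ∉ recipLattice a, ∀ z, ContDiffAt ℝ ∞ f (x, z))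
    (hper : ∀ G ∈ recipLattice a, ∀ x z, f (x + G, z) = f (x, z)) :
    SymbolOn a {x | x ∉ recipLattice a} ν f := by
  refine ⟨fun x hx z => hsm x hx z, fun R n => ?_⟩
  obtain ⟨C₁, hC₁, h₁⟩ := hf.exists_bound (max R r) n
  have hK : IsClosed {x | r ≤ latDist a x} := isClosed_le continuous_const continuous_latDist
  have hoff := SymbolOn.of_contDiffAt (a := a) (f := f) hK Subset.rfl
    (fun x hx z => hsm x (latDist_pos.1 (hr.trans_le hx)) z)
  obtain ⟨C₂, hC₂, h₂⟩ := (hoff.of_le (fun x hx => latDist_pos.1 (hr.trans_le hx))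
    (Nat.zero_le ν)).exists_bound R n
  refine ⟨max C₁ C₂, fun x hx z hxR hzR => ?_⟩
  have hd : 0 < latDist a x := latDist_pos.2 hx
  -- far from the lattice all derivatives are bounded; near it, a translation leads to `x` near `0`
  by_cases hxr : r ≤ latDist a x
  · exact (h₂ x hxr z hxR hzR).trans (by gcongr; exact le_max_right _ _)
  · obtain ⟨G, hG, hxG⟩ := exists_norm_sub_eq_latDist (a := a) x
    have hdG : latDist a (x - G) = latDist a x := by
      rw [sub_eq_add_neg]; exact latDist_add_of_mem (neg_mem hG) x
    have h := h₁ (x - G) ⟨by rwa [hxG], by rw [hxG]; exact lt_of_not_ge hxr⟩ z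
      (by rw [hxG]; exact (lt_of_not_ge hxr).le.trans (le_max_right _ _))
      (hzR.trans (le_max_left _ _))
    rw [hdG] at h
    have e : (fun w => f ((x - G, z) + scaleMap Z (latDist a x) w)) =
        fun w => f ((x, z) + scaleMap Z (latDist a x) w) := by
      ext w
      have := hper (-G) (neg_mem hG) (x + latDist a x • w.1) (z + w.2)
      simp only [Prod.mk_add_mk, scaleMap_apply]
      rw [← this]
      congr 2
      abel
    rw [e] at h
    exact h.trans (by gcongr; exact le_max_left _ _)

end Symbols

/-! ### Smooth dependence of integrals on parameters -/

section ParametricIntegral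

/-- The partial derivative in the second variable of a smooth function is jointly smooth. -/
theorem contDiffAt_partialFDeriv {P W E : Type*}
    [NormedAddCommGroup P] [NormedSpace ℝ P] [NormedAddCommGroup W] [NormedSpace ℝ W]
    [NormedAddCommGroup E] [NormedSpace ℝ E]
    {V : Set (P × W)} (hV : IsOpen V) {h : P × W → E}
    (hh : ∀ p ∈ V, ContDiffAt ℝ ∞ h p) :
    ∀ p ∈ V, ContDiffAt ℝ ∞ (fun p : P × W => fderiv ℝ (fun w => h (p.1, w)) p.2) p := by
  intro p hp
  have hev : (fun p : P × W => fderiv ℝ (fun w => h (p.1, w)) p.2) =ᶠ[𝓝 p]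
      fun p => (fderiv ℝ h p).comp (ContinuousLinearMap.inr ℝ P W) := by
    filter_upwards [hV.mem_nhds hp] with q hq
    have h1 : HasFDerivAt h (fderiv ℝ h q) (q.1, q.2) :=
      ((hh q hq).differentiableAt (by simp)).hasFDerivAt
    exact (h1.comp q.2 (hasFDerivAt_prodMk_right q.1 q.2)).fderiv
  refine ContDiffAt.congr_of_eventuallyEq ?_ hev
  exact ((hh p hp).fderiv_right (m := ∞) (by simp)).clm_comp contDiffAt_const

variable {P : Type*} [NormedAddCommGroup P] [MeasurableSpace P] [BorelSpace P]
  [SecondCountableTopology P] {μ : Measure P} {N : Set P}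

theorem aestronglyMeasurable_of_continuousAt {E : Type*} [TopologicalSpace E]
    [TopologicalSpace.PseudoMetrizableSpace E] (hN : IsClosed N) (hμ : μ N = 0) {f : P → E}
    (hf : ∀ p ∉ N, ContinuousAt f p) : AEStronglyMeasurable f μ := by
  have h : ContinuousOn f Nᶜ := fun p hp => (hf p hp).continuousWithinAt
  have h1 : μ.restrict Nᶜ = μ := Measure.restrict_eq_self_of_ae_mem (by
    rw [ae_iff]; simpa using hμ)
  rw [← h1]
  exact h.aestronglyMeasurable hN.isOpen_compl.measurableSet

theorem integrable_of_continuousAt_of_le {E : Type*} [NormedAddCommGroup E] (hN : IsClosed N)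
    (hμ : μ N = 0) {f : P → E} {g : P → ℝ} (hg : Integrable g μ)
    (hf : ∀ p ∉ N, ContinuousAt f p) (hfg : ∀ᵐ p ∂μ, p ∉ N → ‖f p‖ ≤ g p) : Integrable f μ := by
  refine hg.mono' (aestronglyMeasurable_of_continuousAt hN hμ hf) ?_
  filter_upwards [hfg, measure_eq_zero_iff_ae_notMem.1 hμ] with p hp hpN using hp hpN

variable [NormedSpace ℝ P] {W : Type} [NormedAddCommGroup W] [NormedSpace ℝ W] {U : Set W} {g : P → ℝ}

/-- Differentiation under the integral sign, to first order. The integrand is smooth off a closed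
null set of the integration variable. -/
theorem hasFDerivAt_integral_of_smooth {E : Type} [NormedAddCommGroup E] [NormedSpace ℝ E]
    (hN : IsClosed N) (hμ : μ N = 0) (hU : IsOpen U) (hg : Integrable g μ)
    {h : P × W → E} (hh : ∀ p ∉ N, ∀ w ∈ U, ContDiffAt ℝ ∞ h (p, w)) {C : ℕ → ℝ}
    (hC : ∀ n, ∀ᵐ p ∂μ, p ∉ N → ∀ w ∈ U, ‖iteratedFDeriv ℝ n (fun w => h (p, w)) w‖ ≤ C n * g p)
    {w : W} (hw : w ∈ U) :
    HasFDerivAt (fun w => ∫ p, h (p, w) ∂μ) (∫ p, fderiv ℝ (fun w => h (p, w)) w ∂μ) w := by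
  have hN' := measure_eq_zero_iff_ae_notMem.1 hμ
  have hV : IsOpen (Nᶜ ×ˢ U) := hN.isOpen_compl.prod hU
  have hsec : ∀ w ∈ U, ∀ p ∉ N, ContDiffAt ℝ ∞ (fun p => h (p, w)) p := fun w hw p hp =>
    ContDiffAt.comp p (hh p hp w hw) (by fun_prop)
  have hsec' : ∀ w ∈ U, ∀ p ∉ N, ContinuousAt (fun p => fderiv ℝ (fun w => h (p, w)) w) p :=
    fun w hw p hp => ContinuousAt.comp (x := p) (f := fun p : P => (p, w))
      (contDiffAt_partialFDeriv hV (fun q hq => hh q.1 hq.1 q.2 hq.2) (p, w) ⟨hp, hw⟩).continuousAt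
      (by fun_prop)
  refine hasFDerivAt_integral_of_dominated_of_fderiv_le (𝕜 := ℝ)
    (F' := fun w p => fderiv ℝ (fun w => h (p, w)) w) (bound := fun p => C 1 * g p)
    (hU.mem_nhds hw) ?_ ?_ ?_ ?_ (hg.const_mul _) ?_
  · filter_upwards [hU.mem_nhds hw] with w hw
    exact aestronglyMeasurable_of_continuousAt hN hμ fun p hp => (hsec w hw p hp).continuousAt
  · refine integrable_of_continuousAt_of_le hN hμ (hg.const_mul (C 0))
      (fun p hp => (hsec w hw p hp).continuousAt) ?_
    filter_upwards [hC 0] with p hp hpN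
    simpa using hp hpN w hw
  · exact aestronglyMeasurable_of_continuousAt hN hμ (hsec' w hw)
  · filter_upwards [hC 1, hN'] with p hp hpN w hw
    rw [← norm_iteratedFDeriv_one]
    exact hp hpN w hw
  · filter_upwards [hN'] with p hpN w hw
    have : ContDiffAt ℝ ∞ (fun w => h (p, w)) w := ContDiffAt.comp w (hh p hpN w hw) (by fun_prop)
    exact (this.differentiableAt (by simp)).hasFDerivAt

/-- Differentiation under the integral sign, to all orders, with bounds. -/
theorem contDiffOn_integral_of_dominated {E : Type} [NormedAddCommGroup E] [NormedSpace ℝ E]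
    (hN : IsClosed N) (hμ : μ N = 0) (hU : IsOpen U) (hg : Integrable g μ)
    {h : P × W → E} (hh : ∀ p ∉ N, ∀ w ∈ U, ContDiffAt ℝ ∞ h (p, w)) {C : ℕ → ℝ}
    (hC : ∀ n, ∀ᵐ p ∂μ, p ∉ N → ∀ w ∈ U,
      ‖iteratedFDeriv ℝ n (fun w => h (p, w)) w‖ ≤ C n * g p) (n : ℕ) :
    ContDiffOn ℝ n (fun w => ∫ p, h (p, w) ∂μ) U ∧
    ∀ w ∈ U, ‖iteratedFDeriv ℝ n (fun w => ∫ p, h (p, w) ∂μ) w‖ ≤ C n * ∫ p, g p ∂μ := by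
  have hN' := measure_eq_zero_iff_ae_notMem.1 hμ
  induction n generalizing E C with
  | zero =>
    constructor
    · rw [Nat.cast_zero, contDiffOn_zero]
      exact fun w hw =>
        (hasFDerivAt_integral_of_smooth hN hμ hU hg hh hC hw).continuousAt.continuousWithinAt
    · intro w hw
      rw [norm_iteratedFDeriv_zero, ← integral_const_mul]
      refine norm_integral_le_of_norm_le (hg.const_mul _) ?_
      filter_upwards [hC 0, hN'] with p hp hpN
      simpa using hp hpN w hw
  | succ n ih =>
    have hV : IsOpen (Nᶜ ×ˢ U) := hN.isOpen_compl.prod hU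
    have h1 := contDiffAt_partialFDeriv hV (fun q hq => hh q.1 hq.1 q.2 hq.2)
    obtain ⟨ih1, ih2⟩ := ih (h := fun p : P × W => fderiv ℝ (fun w => h (p.1, w)) p.2)
      (C := fun n => C (n + 1)) (fun p hp w hw => h1 (p, w) ⟨hp, hw⟩) (fun n => by
        filter_upwards [hC (n + 1)] with p hp hpN w hw
        have := hp hpN w hw
        rw [← norm_iteratedFDeriv_fderiv] at this
        exact this)
    have hd : ∀ w ∈ U, fderiv ℝ (fun w => ∫ p, h (p, w) ∂μ) w =
        ∫ p, fderiv ℝ (fun w => h (p, w)) w ∂μ := fun w hw =>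
      (hasFDerivAt_integral_of_smooth hN hμ hU hg hh hC hw).fderiv
    constructor
    · rw [Nat.cast_succ, contDiffOn_succ_iff_fderiv_of_isOpen hU]
      refine ⟨fun w hw => (hasFDerivAt_integral_of_smooth hN hμ hU hg hh hC
        hw).differentiableAt.differentiableWithinAt, by simp, ih1.congr hd⟩
    · intro w hw
      rw [← norm_iteratedFDeriv_fderiv]
      have hev : fderiv ℝ (fun w => ∫ p, h (p, w) ∂μ) =ᶠ[𝓝 w]
          fun w => ∫ p, fderiv ℝ (fun w => h (p, w)) w ∂μ := by
        filter_upwards [hU.mem_nhds hw] with w hw using hd w hw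
      rw [iteratedFDeriv_congr hev]
      exact ih2 w hw

end ParametricIntegral

/-! ### Integrals of periodic functions over a unit cell -/

section PeriodicIntegrals

variable {E : Type*} [NormedAddCommGroup E]

theorem vaddInvariantMeasure_span (b : Module.Basis (Fin 3) ℝ Vec) :
    VAddInvariantMeasure (Submodule.span ℤ (Set.range b)) Vec volume :=
  inferInstanceAs (VAddInvariantMeasure (Submodule.span ℤ (Set.range b)).toAddSubgroup Vec volume)

theorem isAddFundamentalDomain_reflection (b : Module.Basis (Fin 3) ℝ Vec) (c : Vec) :
    IsAddFundamentalDomain (Submodule.span ℤ (Set.range b))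
      ((fun x => c - x) ⁻¹' ZSpan.fundamentalDomain b) volume := by
  refine (ZSpan.isAddFundamentalDomain b volume).preimage_of_equiv
    (Measure.measurePreserving_sub_left volume c).quasiMeasurePreserving (e := fun g => -g)
    neg_involutive.bijective fun g x => ?_
  simp only [Submodule.vadd_def, vadd_eq_add, Submodule.coe_neg]
  abel

theorem setIntegral_comp_sub_left_of_periodic [NormedSpace ℝ E] (b : Module.Basis (Fin 3) ℝ Vec)
    {F : Vec → E}
    (hF : ∀ G ∈ Submodule.span ℤ (Set.range b), ∀ x, F (x + G) = F x) (c : Vec) :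
    ∫ x in ZSpan.fundamentalDomain b, F (c - x) = ∫ x in ZSpan.fundamentalDomain b, F x := by
  have h1 := (Measure.measurePreserving_sub_left volume c).setIntegral_preimage_emb
    (Homeomorph.subLeft c).measurableEmbedding F ((fun x => c - x) ⁻¹' ZSpan.fundamentalDomain b)
  have h2 : (fun x => c - x) ⁻¹' ((fun x => c - x) ⁻¹' ZSpan.fundamentalDomain b) =
      ZSpan.fundamentalDomain b := by
    ext x; simp
  rw [h2] at h1
  rw [h1]
  have := vaddInvariantMeasure_span b
  refine (isAddFundamentalDomain_reflection b c).setIntegral_eq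
    (ZSpan.isAddFundamentalDomain b volume) fun g x => ?_
  rw [Submodule.vadd_def, vadd_eq_add, add_comm, hF _ g.2]

theorem integrableOn_comp_sub_left_of_periodic (b : Module.Basis (Fin 3) ℝ Vec) {F : Vec → E}
    (hF : ∀ G ∈ Submodule.span ℤ (Set.range b), ∀ x, F (x + G) = F x) (c : Vec) :
    IntegrableOn (fun x => F (c - x)) (ZSpan.fundamentalDomain b) ↔
      IntegrableOn F (ZSpan.fundamentalDomain b) := by
  have h1 := (Measure.measurePreserving_sub_left volume c).integrableOn_comp_preimage
    (Homeomorph.subLeft c).measurableEmbedding (f := F)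
    (s := (fun x => c - x) ⁻¹' ZSpan.fundamentalDomain b)
  have h2 : (fun x => c - x) ⁻¹' ((fun x => c - x) ⁻¹' ZSpan.fundamentalDomain b) =
      ZSpan.fundamentalDomain b := by
    ext x; simp
  rw [h2] at h1
  have := vaddInvariantMeasure_span b
  refine h1.trans ((isAddFundamentalDomain_reflection b c).integrableOn_iff
    (ZSpan.isAddFundamentalDomain b volume) fun g x => ?_)
  rw [Submodule.vadd_def, vadd_eq_add, add_comm, hF _ g.2]

theorem setIntegral_comp_add_of_periodic [NormedSpace ℝ E] (b : Module.Basis (Fin 3) ℝ Vec)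
    {F : Vec → E}
    (hF : ∀ G ∈ Submodule.span ℤ (Set.range b), ∀ x, F (x + G) = F x) (c : Vec) :
    ∫ x in ZSpan.fundamentalDomain b, F (c + x) = ∫ x in ZSpan.fundamentalDomain b, F x := by
  have hF' : ∀ G ∈ Submodule.span ℤ (Set.range b), ∀ x, F (-(x + G)) = F (-x) := fun G hG x => by
    rw [neg_add, hF _ (neg_mem hG)]
  have h1 := setIntegral_comp_sub_left_of_periodic b (F := fun x => F (-x)) hF' (-c)
  have h2 := setIntegral_comp_sub_left_of_periodic b hF 0
  simp only [zero_sub] at h2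
  rw [← h2, ← h1]
  congr 1
  ext x
  congr 1
  abel

end PeriodicIntegrals

/-! ### Integrability of `d⁻²` over the Brillouin zone -/

section Integrability

theorem integrableOn_one_div_norm_sub_sq (G : Vec) {s : Set Vec} (hs : Bornology.IsBounded s) :
    IntegrableOn (fun x : Vec => 1 / ‖x - G‖ ^ 2) s := by
  have key : ∀ r, IntegrableOn (fun x : Vec => 1 / ‖x‖ ^ 2) (Metric.ball 0 r) := fun r => by
    rw [integrableOn_fun_norm_addHaar (μ := volume) (f := fun y : ℝ => 1 / y ^ 2)]
    refine (integrableOn_const (C := (1 : ℝ)) (by simp)).congr_fun (fun y hy => ?_)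
      measurableSet_Ioo
    have : 0 < y := hy.1
    simp only [finrank_euclideanSpace, Fintype.card_fin, smul_eq_mul]
    field_simp
  obtain ⟨r, hr⟩ := hs.subset_ball G
  have h := (measurePreserving_sub_right volume G).integrableOn_comp_preimage
    (Homeomorph.subRight G).measurableEmbedding (f := fun x : Vec => 1 / ‖x‖ ^ 2)
    (s := Metric.ball 0 r)
  refine (h.2 (key r)).mono_set fun x hx => ?_
  simpa [dist_eq_norm] using hr hx

variable (a : Module.Basis (Fin 3) ℝ Vec)

theorem isBounded_zone : Bornology.IsBounded (zone a) := by
  obtain ⟨C, hC⟩ : ∃ C, ∀ x ∈ zone a, ‖x‖ ≤ C := by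
    refine ⟨∑ i, ‖recipBasis a i‖, fun x hx => ?_⟩
    rw [← (ZSpan.fract_eq_self (b := recipBasis a)).2 hx]
    exact ZSpan.norm_fract_le (K := ℝ) _ x
  exact isBounded_iff_forall_norm_le.2 ⟨C, hC⟩

theorem measurableSet_zone : MeasurableSet (zone a) :=
  ZSpan.fundamentalDomain_measurableSet _

/-- On the bounded zone, `d⁻²` is dominated by a finite sum of the functions `|x - G|⁻²`, which are
locally integrable in dimension three. -/
theorem integrableOn_one_div_latDist_sq :
    IntegrableOn (fun x => 1 / latDist a x ^ 2) (zone a) := by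
  obtain ⟨C, hC⟩ := isBounded_iff_forall_norm_le.1 (isBounded_zone a)
  have hfin : (Metric.closedBall (0 : Vec) (2 * C) ∩ (recipLattice a : Set Vec)).Finite :=
    ZSpan.setFinite_inter _ Metric.isBounded_closedBall
  have hsum : IntegrableOn (fun x => ∑ G ∈ hfin.toFinset, 1 / ‖x - G‖ ^ 2) (zone a) :=
    integrable_finsetSum _ fun G _ => integrableOn_one_div_norm_sub_sq G (isBounded_zone a)
  refine hsum.mono' ?_ ?_
  · exact (measurable_const.div (continuous_latDist.measurable.pow_const 2)).aestronglyMeasurable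
  · refine (ae_restrict_iff' (measurableSet_zone a)).2 (Eventually.of_forall fun x hx => ?_)
    obtain ⟨G, hG, h⟩ := exists_norm_sub_eq_latDist (a := a) x
    have hGm : G ∈ hfin.toFinset := by
      rw [Set.Finite.mem_toFinset]
      refine ⟨?_, hG⟩
      have h1 := latDist_le_norm (a := a) x
      have h2 := hC x hx
      have h3 := norm_sub_norm_le G x
      rw [norm_sub_rev] at h3
      simp only [Metric.mem_closedBall, dist_zero_right]
      linarith
    rw [Real.norm_of_nonneg (by positivity), ← h]
    exact Finset.single_le_sum (f := fun G => 1 / ‖x - G‖ ^ 2) (fun _ _ => by positivity) hGm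

end Integrability

/-! ### A periodic cutoff near the reciprocal lattice -/

section Cutoff

/-- A smooth bump on `Vec`, equal to `1` on the ball of radius `1/2` and supported in the unit
ball. -/
def unitBump : ContDiffBump (0 : Vec) := ⟨1 / 2, 1, by norm_num, by norm_num⟩

/-- The sum of the bumps of size `μ` around all points of the reciprocal lattice. It is used for
`μ` so small that these bumps have disjoint supports. -/
def cutoff (a : Module.Basis (Fin 3) ℝ Vec) (μ : ℝ) (x : Vec) : ℂ :=
  ∑ᶠ G : recipLattice a, ((unitBump (μ⁻¹ • (x - G)) : ℝ) : ℂ)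

theorem contDiff_unitBump : ContDiff ℝ ∞ (fun v : Vec => ((unitBump v : ℝ) : ℂ)) :=
  Complex.ofRealCLM.contDiff.comp unitBump.contDiff

theorem exists_bound_iteratedFDeriv_unitBump (n : ℕ) :
    ∃ C, 0 ≤ C ∧ ∀ v : Vec, ‖iteratedFDeriv ℝ n (fun v : Vec => ((unitBump v : ℝ) : ℂ)) v‖ ≤ C := by
  have hs : HasCompactSupport (fun v : Vec => ((unitBump v : ℝ) : ℂ)) :=
    unitBump.hasCompactSupport.comp_left (g := fun t : ℝ => (t : ℂ)) (by simp)
  have hc : Continuous (iteratedFDeriv ℝ n (fun v : Vec => ((unitBump v : ℝ) : ℂ))) :=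
    contDiff_unitBump.continuous_iteratedFDeriv (by exact_mod_cast le_top)
  obtain ⟨C, hC⟩ := hc.bounded_above_of_compact_support (hs.iteratedFDeriv n)
  exact ⟨C, (norm_nonneg _).trans (hC 0), hC⟩

variable {a : Module.Basis (Fin 3) ℝ Vec} {r μ : ℝ}

theorem cutoff_add_of_mem {G : Vec} (hG : G ∈ recipLattice a) (x : Vec) :
    cutoff a μ (x + G) = cutoff a μ x := by
  unfold cutoff
  rw [← finsum_comp_equiv (Equiv.addRight (⟨G, hG⟩ : recipLattice a))]
  refine finsum_congr fun G' => ?_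
  simp

theorem unitBump_eq_zero {v : Vec} (h : 1 ≤ ‖v‖) : unitBump v = 0 :=
  unitBump.zero_of_le_dist (by simpa [unitBump] using h)

theorem unitBump_eq_one {v : Vec} (h : ‖v‖ ≤ 1 / 2) : unitBump v = 1 :=
  unitBump.one_of_mem_closedBall (by simpa [unitBump] using h)

theorem norm_inv_smul (hμ : 0 < μ) (v : Vec) : ‖μ⁻¹ • v‖ = ‖v‖ / μ := by
  rw [norm_smul, norm_inv, Real.norm_of_nonneg hμ.le, div_eq_inv_mul]

/-- Near every point, the cutoff is the bump around a nearest lattice point. -/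
theorem cutoff_eventuallyEq (hr : ∀ G ∈ recipLattice a, ‖G‖ < 2 * r → G = 0) (hμ : 0 < μ)
    (hμr : μ < r) {x G : Vec} (hG : G ∈ recipLattice a) (hx : ‖x - G‖ = latDist a x) :
    cutoff a μ =ᶠ[𝓝 x] fun y => ((unitBump (μ⁻¹ • (y - G)) : ℝ) : ℂ) := by
  filter_upwards [Metric.ball_mem_nhds x (sub_pos.2 hμr)] with y hy
  unfold cutoff
  rw [finsum_eq_single _ (⟨G, hG⟩ : recipLattice a)]
  intro G' hne
  rw [unitBump_eq_zero, Complex.ofReal_zero]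
  rw [norm_inv_smul hμ, le_div_iff₀ hμ, one_mul]
  have h1 : 2 * r ≤ ‖(G' : Vec) - G‖ := by
    by_contra! hlt
    exact hne (Subtype.ext (sub_eq_zero.1 (hr _ (sub_mem G'.2 hG) hlt)))
  have h2 : latDist a x ≤ ‖x - G'‖ := latDist_le_norm_sub G'.2
  have h3 : ‖(G' : Vec) - G‖ ≤ ‖x - G'‖ + ‖x - G‖ := by
    have := norm_sub_le (x - G) (x - G')
    rw [show (x - G) - (x - G') = (G' : Vec) - G by abel] at this
    linarith
  have h4 : ‖x - G'‖ ≤ ‖y - G'‖ + ‖y - x‖ := by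
    have := norm_sub_le (y - G') (y - x)
    rwa [show (y - G') - (y - x) = x - (G' : Vec) by abel] at this
  rw [Metric.mem_ball, dist_eq_norm] at hy
  linarith

theorem cutoff_eq (hr : ∀ G ∈ recipLattice a, ‖G‖ < 2 * r → G = 0) (hμ : 0 < μ) (hμr : μ < r)
    (x : Vec) : ∃ v : Vec, ‖v‖ = latDist a x / μ ∧ cutoff a μ x = ((unitBump v : ℝ) : ℂ) := by
  obtain ⟨G, hG, hx⟩ := exists_norm_sub_eq_latDist (a := a) x
  exact ⟨μ⁻¹ • (x - G), by rw [norm_inv_smul hμ, hx],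
    (cutoff_eventuallyEq hr hμ hμr hG hx).eq_of_nhds⟩

theorem cutoff_eq_zero (hr : ∀ G ∈ recipLattice a, ‖G‖ < 2 * r → G = 0) (hμ : 0 < μ) (hμr : μ < r)
    {x : Vec} (hx : μ ≤ latDist a x) : cutoff a μ x = 0 := by
  obtain ⟨v, hv, h⟩ := cutoff_eq hr hμ hμr x
  rw [h, unitBump_eq_zero, Complex.ofReal_zero]
  rwa [hv, le_div_iff₀ hμ, one_mul]

theorem cutoff_eq_one (hr : ∀ G ∈ recipLattice a, ‖G‖ < 2 * r → G = 0) (hμ : 0 < μ) (hμr : μ < r)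
    {x : Vec} (hx : latDist a x ≤ μ / 2) : cutoff a μ x = 1 := by
  obtain ⟨v, hv, h⟩ := cutoff_eq hr hμ hμr x
  rw [h, unitBump_eq_one, Complex.ofReal_one]
  rw [hv, div_le_iff₀ hμ]
  linarith

theorem norm_cutoff_le (hr : ∀ G ∈ recipLattice a, ‖G‖ < 2 * r → G = 0) (hμ : 0 < μ) (hμr : μ < r)
    (x : Vec) : ‖cutoff a μ x‖ ≤ 1 := by
  obtain ⟨v, _, h⟩ := cutoff_eq hr hμ hμr x
  rw [h, Complex.norm_real, Real.norm_of_nonneg unitBump.nonneg]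
  exact unitBump.le_one

theorem norm_one_sub_cutoff_le (hr : ∀ G ∈ recipLattice a, ‖G‖ < 2 * r → G = 0) (hμ : 0 < μ)
    (hμr : μ < r) (x : Vec) : ‖1 - cutoff a μ x‖ ≤ 1 := by
  obtain ⟨v, _, h⟩ := cutoff_eq hr hμ hμr x
  rw [h, ← Complex.ofReal_one, ← Complex.ofReal_sub, Complex.norm_real, Real.norm_of_nonneg
    (sub_nonneg.2 unitBump.le_one)]
  linarith [unitBump.nonneg (x := v)]

theorem contDiff_cutoff (hr : ∀ G ∈ recipLattice a, ‖G‖ < 2 * r → G = 0) (hμ : 0 < μ)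
    (hμr : μ < r) : ContDiff ℝ ∞ (cutoff a μ) := by
  refine contDiff_iff_contDiffAt.2 fun x => ?_
  obtain ⟨G, hG, hx⟩ := exists_norm_sub_eq_latDist (a := a) x
  refine ContDiffAt.congr_of_eventuallyEq ?_ (cutoff_eventuallyEq hr hμ hμr hG hx)
  have h : ContDiff ℝ ∞ (fun y : Vec => μ⁻¹ • (y - G)) := by fun_prop
  exact (contDiff_unitBump.comp h).contDiffAt

/-- Each derivative of the cutoff costs at most a factor `1 / μ`. -/
theorem exists_bound_iteratedFDeriv_cutoff (hr : ∀ G ∈ recipLattice a, ‖G‖ < 2 * r → G = 0)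
    (n : ℕ) : ∃ C, 0 ≤ C ∧ ∀ μ, 0 < μ → μ < r → ∀ x,
      ‖iteratedFDeriv ℝ n (cutoff a μ) x‖ ≤ C * (1 / μ) ^ n := by
  obtain ⟨C, hC0, hC⟩ := exists_bound_iteratedFDeriv_unitBump n
  refine ⟨C, hC0, fun μ hμ hμr x => ?_⟩
  obtain ⟨G, hG, hx⟩ := exists_norm_sub_eq_latDist (a := a) x
  rw [iteratedFDeriv_congr (cutoff_eventuallyEq hr hμ hμr hG hx)]
  have e : (fun y => ((unitBump (μ⁻¹ • (y - G)) : ℝ) : ℂ)) = fun y =>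
      (fun v : Vec => ((unitBump v : ℝ) : ℂ)) (-(μ⁻¹ • G) + (μ⁻¹ • ContinuousLinearMap.id ℝ Vec) y) := by
    ext y
    simp [sub_eq_neg_add]
  rw [e]
  refine (norm_iteratedFDeriv_comp_affine_le (f := fun v : Vec => ((unitBump v : ℝ) : ℂ)) _ _
    (contDiff_unitBump.contDiffAt.of_infty n)).trans ?_
  have h2 : ‖μ⁻¹ • ContinuousLinearMap.id ℝ Vec‖ ≤ 1 / μ := by
    rw [norm_smul, norm_inv, Real.norm_of_nonneg hμ.le, one_div]
    exact mul_le_of_le_one_right (by positivity) ContinuousLinearMap.norm_id_le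
  exact mul_le_mul (hC _) (pow_le_pow_left₀ (norm_nonneg _) h2 n) (by positivity) hC0

end Cutoff

/-! ### Integrals and convolutions of symbols over the Brillouin zone -/

section SymbolIntegrals

variable {Z Y W : Type} [NormedAddCommGroup Z] [NormedSpace ℝ Z]
  [NormedAddCommGroup Y] [NormedSpace ℝ Y] [NormedAddCommGroup W] [NormedSpace ℝ W]
  {a : Module.Basis (Fin 3) ℝ Vec}

variable (a) in
/-- The complement of the reciprocal lattice. -/
def offLattice : Set Vec := {x | x ∉ recipLattice a}

theorem isOpen_offLattice : IsOpen (offLattice a) := (isClosed_recipLattice a).isOpen_compl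

theorem norm_scaleMap_le (s : ℝ) : ‖scaleMap Z s‖ ≤ max |s| 1 := by
  refine ContinuousLinearMap.opNorm_le_bound _ (by positivity) fun w => ?_
  rw [scaleMap_apply, Prod.norm_def]
  refine max_le ?_ ?_
  · rw [norm_smul, Real.norm_eq_abs]
    exact mul_le_mul (le_max_left _ _) (norm_fst_le w) (norm_nonneg _) (by positivity)
  · calc ‖w.2‖ ≤ 1 * ‖w‖ := by rw [one_mul]; exact norm_snd_le w
      _ ≤ _ := by gcongr; exact le_max_right _ _

/-- The symbol bounds along an affine map `φ` whose linear part is dominated by the dilation. -/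
theorem SymbolOn.exists_bound_affine {S : Set Vec} {ν : ℕ} {f : Vec × Z → ℂ}
    (hf : SymbolOn a S ν f) (R M : ℝ) (n : ℕ) :
    ∃ C, 0 ≤ C ∧ ∀ x ∈ S, ∀ z, ‖x‖ ≤ R → ‖z‖ ≤ R → ∀ (L : W →L[ℝ] Vec × Z), ‖L‖ ≤ M →
      ∀ (φ : W → Vec × Z) (w : W),
        (∀ w', φ w' = (x, z) + scaleMap Z (latDist a x) (L (w' - w))) →
      ‖iteratedFDeriv ℝ n (fun w' => f (φ w')) w‖ ≤ C / latDist a x ^ ν := by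
  obtain ⟨C, hC0, hC⟩ := hf.exists_bound_comp (W := W) R M n
  refine ⟨C, hC0, fun x hx z h1 h2 L hL φ w hφ => ?_⟩
  have h := hC x hx z h1 h2 L hL
  have e : (fun w' => f ((x, z) + scaleMap Z (latDist a x) (L w'))) =
      fun w' => f (φ (w + w')) := by
    ext w'
    rw [hφ, add_sub_cancel_left]
  rw [e, iteratedFDeriv_comp_add_left n w 0 (f := fun w' => f (φ w')), add_zero] at h
  exact h

/-- Bounds for the derivatives of a product. -/
theorem norm_iteratedFDeriv_mul_le_mul {f g : W → ℂ} {w : W} (hf : ContDiffAt ℝ ∞ f w)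
    (hg : ContDiffAt ℝ ∞ g w) {C C' : ℕ → ℝ} {X X' : ℝ}
    (hC : ∀ i, ‖iteratedFDeriv ℝ i f w‖ ≤ C i * X) (hC' : ∀ i, ‖iteratedFDeriv ℝ i g w‖ ≤ C' i * X')
    (n : ℕ) : ‖iteratedFDeriv ℝ n (fun w => f w * g w) w‖ ≤
      (∑ i ∈ Finset.range (n + 1), (n.choose i : ℝ) * C i * C' (n - i)) * (X * X') := by
  refine (norm_iteratedFDeriv_mul_le_of_contDiffAt hf hg).trans ?_
  rw [Finset.sum_mul]
  refine Finset.sum_le_sum fun i _ => ?_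
  have h1 := hC i
  have h2 := hC' (n - i)
  calc _ ≤ (n.choose i : ℝ) * (C i * X) * (C' (n - i) * X') := by
        have := (norm_nonneg _).trans h1
        gcongr
    _ = _ := by ring

/-- To be a symbol can be checked for the dilated functions. -/
theorem SymbolOn.of_dilated {S : Set Vec} {ν : ℕ} {f : Vec × Z → ℂ} (hS : ∀ x ∈ S, x ∉ recipLattice a)
    (h : ∀ R, ∃ C : ℕ → ℝ, ∀ x ∈ S, ∀ z, ‖x‖ ≤ R → ‖z‖ ≤ R → ∀ n : ℕ,
      ContDiffAt ℝ n (fun w => f ((x, z) + scaleMap Z (latDist a x) w)) 0 ∧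
      ‖iteratedFDeriv ℝ n (fun w => f ((x, z) + scaleMap Z (latDist a x) w)) 0‖
        ≤ C n / latDist a x ^ ν) : SymbolOn a S ν f := by
  refine ⟨fun x hx z => ?_, fun R n => ?_⟩
  · obtain ⟨C, hC⟩ := h (max ‖x‖ ‖z‖)
    refine contDiffAt_infty.2 fun n => ?_
    have h1 := (hC x hx z (le_max_left _ _) (le_max_right _ _) n).1
    have hd : latDist a x ≠ 0 := (latDist_pos.2 (hS x hx)).ne'
    have e : f = fun p => (fun w => f ((x, z) + scaleMap Z (latDist a x) w))
        (scaleMap Z (latDist a x)⁻¹ (p - (x, z))) := by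
      ext p
      simp [smul_smul, mul_inv_cancel₀ hd]
    rw [e]
    have h2 : ContDiffAt ℝ n (fun p => scaleMap Z (latDist a x)⁻¹ (p - (x, z))) (x, z) := by
      fun_prop
    exact ContDiffAt.comp (g := fun w => f ((x, z) + scaleMap Z (latDist a x) w)) (x, z)
      (by rw [sub_self, map_zero]; exact h1) h2
  · obtain ⟨C, hC⟩ := h R
    exact ⟨C n, fun x hx z h1 h2 => (hC x hx z h1 h2 n).2⟩

theorem volume_restrict_zone_recipLattice :
    (volume.restrict (zone a)) (recipLattice a : Set Vec) = 0 :=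
  Measure.restrict_le_self.absolutelyContinuous (volume_recipLattice a)

/-- The average of a symbol of order `2` over `x` is smooth in the parameters: the singularity is
integrable in dimension three, and it does not move with the parameters. -/
theorem SymbolOn.contDiff_integral {A : Vec × Z → ℂ} (hA : SymbolOn a (offLattice a) 2 A) :
    ContDiff ℝ ∞ (fun z => ∫ p in zone a, A (p, z)) := by
  refine contDiff_iff_contDiffAt.2 fun z₀ => contDiffAt_infty.2 fun n => ?_
  obtain ⟨ρ, hρ⟩ := isBounded_iff_forall_norm_le.1 (isBounded_zone a)
  choose C hC0 hC using hA.exists_bound_affine (W := Z) (max ρ (‖z₀‖ + 1)) 1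
  have key := contDiffOn_integral_of_dominated (μ := volume.restrict (zone a))
    (isClosed_recipLattice a) volume_restrict_zone_recipLattice
    (Metric.isOpen_ball (x := z₀) (ε := 1)) (integrableOn_one_div_latDist_sq a)
    (h := A) (fun p hp w _ => hA.smooth p hp w) (C := C) (fun n => by
      refine (ae_restrict_iff' (measurableSet_zone a)).2 (Eventually.of_forall fun p hp hpL w hw => ?_)
      have hw' : ‖w‖ ≤ ‖z₀‖ + 1 := by
        rw [Metric.mem_ball, dist_eq_norm] at hw
        have := norm_sub_norm_le w z₀
        linarith
      have := hC n p hpL w ((hρ p hp).trans (le_max_left _ _)) (hw'.trans (le_max_right _ _))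
        (ContinuousLinearMap.inr ℝ Vec Z) (ContinuousLinearMap.norm_inr_le_one _ _ _)
        (fun w' => (p, w')) w (by intro w'; simp)
      rwa [div_eq_mul_one_div] at this) n
  exact key.1.contDiffAt (Metric.ball_mem_nhds z₀ one_pos)

/-- The integral over `p` of a product of a symbol in `p` and a symbol in `x` is a symbol in `x`. -/
theorem SymbolOn.integral_mul {A B : Vec × (Vec × Y) → ℂ}
    (hA : SymbolOn a (offLattice a) 2 A) (hB : SymbolOn a (offLattice a) 0 B) :
    SymbolOn a (offLattice a) 0
      (fun q : Vec × Y => ∫ p in zone a, A (p, (q.1, q.2)) * B (q.1, (p, q.2))) := by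
  refine SymbolOn.of_dilated (fun x hx => hx) fun R => ?_
  obtain ⟨ρ, hρ⟩ := isBounded_iff_forall_norm_le.1 (isBounded_zone a)
  set R' := max ρ (2 * R + 1) with hR'
  choose C hC0 hC using hA.exists_bound_affine (W := Vec × Y) R' (max R 1)
  choose C' hC0' hC' using hB.exists_bound_affine (W := Vec × Y) R' 2
  refine ⟨fun n => (∑ i ∈ Finset.range (n + 1), (n.choose i : ℝ) * C i * C' (n - i)) *
    ∫ p in zone a, 1 / latDist a p ^ 2, fun x hx y hxR hyR n => ?_⟩
  set s := latDist a x with hs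
  have hs0 : 0 < s := latDist_pos.2 hx
  have hsR : s ≤ R := (latDist_le_norm x).trans hxR
  -- in the dilated ball of radius `1 / 2` the distance to the lattice changes by at most a factor `2`
  have hd : ∀ w ∈ Metric.ball (0 : Vec × Y) (1 / 2), s / 2 ≤ latDist a (x + s • w.1) := by
    intro w hw
    have h1 : ‖w.1‖ ≤ 1 / 2 := (norm_fst_le w).trans (by simpa using (mem_ball_zero_iff.1 hw).le)
    have h2 := latDist_le_add (a := a) x (x + s • w.1)
    rw [sub_add_cancel_left, norm_neg, norm_smul, Real.norm_of_nonneg hs0.le] at h2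
    nlinarith
  have hw1 : ∀ w ∈ Metric.ball (0 : Vec × Y) (1 / 2), ‖x + s • w.1‖ ≤ R' := by
    intro w hw
    have h1 : ‖w.1‖ ≤ 1 / 2 := (norm_fst_le w).trans (by simpa using (mem_ball_zero_iff.1 hw).le)
    refine ((norm_add_le _ _).trans ?_).trans (le_max_right _ _)
    rw [norm_smul, Real.norm_of_nonneg hs0.le]
    nlinarith
  have hw2 : ∀ w ∈ Metric.ball (0 : Vec × Y) (1 / 2), ‖y + w.2‖ ≤ R' := by
    intro w hw
    have h1 : ‖w.2‖ ≤ 1 / 2 := (norm_snd_le w).trans (by simpa using (mem_ball_zero_iff.1 hw).le)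
    have hR0 : 0 ≤ R := (norm_nonneg _).trans hyR
    exact ((norm_add_le _ _).trans (by linarith)).trans (le_max_right _ _)
  have hsmA : ∀ p ∉ recipLattice a, ∀ w : Vec × Y,
      ContDiffAt ℝ ∞ (fun q : Vec × (Vec × Y) => A (q.1, (x + s • q.2.1, y + q.2.2))) (p, w) :=
    fun p hp w => ContDiffAt.comp (p, w) (hA.smooth p hp _) (by fun_prop)
  have hsmB : ∀ p, ∀ w ∈ Metric.ball (0 : Vec × Y) (1 / 2),
      ContDiffAt ℝ ∞ (fun q : Vec × (Vec × Y) => B (x + s • q.2.1, (q.1, y + q.2.2))) (p, w) :=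
    fun p w hw => ContDiffAt.comp (p, w)
      (hB.smooth _ (latDist_pos.1 ((half_pos hs0).trans_le (hd w hw))) _) (by fun_prop)
  have key := contDiffOn_integral_of_dominated (μ := volume.restrict (zone a))
    (isClosed_recipLattice a) volume_restrict_zone_recipLattice
    (Metric.isOpen_ball (x := (0 : Vec × Y)) (ε := 1 / 2)) (integrableOn_one_div_latDist_sq a)
    (h := fun q => A (q.1, (x + s • q.2.1, y + q.2.2)) * B (x + s • q.2.1, (q.1, y + q.2.2)))
    (fun p hp w hw => (hsmA p hp w).mul (hsmB p w hw))
    (C := fun n => ∑ i ∈ Finset.range (n + 1), (n.choose i : ℝ) * C i * C' (n - i)) (fun n => by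
      refine (ae_restrict_iff' (measurableSet_zone a)).2
        (Eventually.of_forall fun p hp hpL w hw => ?_)
      have hpR : ‖p‖ ≤ R' := (hρ p hp).trans (le_max_left _ _)
      have h1 := norm_iteratedFDeriv_mul_le_mul (w := w) (C := C) (C' := C')
        (X := 1 / latDist a p ^ 2) (X' := 1)
        (f := fun w => A (p, (x + s • w.1, y + w.2))) (g := fun w => B (x + s • w.1, (p, y + w.2)))
        (ContDiffAt.comp (g := fun q : Vec × (Vec × Y) => A (q.1, (x + s • q.2.1, y + q.2.2)))
          (f := fun w => (p, w)) w (hsmA p hpL w) (by fun_prop))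
        (ContDiffAt.comp (g := fun q : Vec × (Vec × Y) => B (x + s • q.2.1, (q.1, y + q.2.2)))
          (f := fun w => (p, w)) w (hsmB p w hw) (by fun_prop)) (fun i => ?_)
        (fun i => ?_) n
      · rwa [mul_one] at h1
      · rw [← div_eq_mul_one_div]
        refine hC i p hpL (x + s • w.1, y + w.2) hpR (max_le (hw1 w hw) (hw2 w hw))
          ((ContinuousLinearMap.inr ℝ Vec (Vec × Y)).comp (scaleMap Y s)) ?_ _ w fun w' => ?_
        · refine (ContinuousLinearMap.opNorm_comp_le _ _).trans ?_
          refine (mul_le_of_le_one_left (norm_nonneg _)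
            (ContinuousLinearMap.norm_inr_le_one _ _ _)).trans ((norm_scaleMap_le s).trans ?_)
          rw [abs_of_pos hs0]
          exact max_le_max hsR le_rfl
        · simp [smul_sub]
      · have hdw := hd w hw
        have hdw0 : 0 < latDist a (x + s • w.1) := (half_pos hs0).trans_le hdw
        have := hC' i (x + s • w.1) (latDist_pos.1 hdw0) (p, y + w.2) (hw1 w hw)
          (max_le hpR (hw2 w hw))
          (((s / latDist a (x + s • w.1)) • ContinuousLinearMap.fst ℝ Vec Y).prod
            ((ContinuousLinearMap.inr ℝ Vec Y).comp (ContinuousLinearMap.snd ℝ Vec Y))) ?_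
          (fun w' => (x + s • w'.1, (p, y + w'.2))) w fun w' => ?_
        · simpa using this
        · refine ContinuousLinearMap.opNorm_le_bound _ zero_le_two fun v => ?_
          have hsd : s / latDist a (x + s • w.1) ≤ 2 := by
            rw [div_le_iff₀ hdw0]; linarith
          simp only [ContinuousLinearMap.prod_apply, Prod.norm_def]
          refine max_le ?_ ?_
          · change ‖(s / latDist a (x + s • w.1)) • v.1‖ ≤ _
            rw [norm_smul, Real.norm_of_nonneg (by positivity)]
            gcongr
            exact le_max_left _ _
          · change max ‖(0 : Vec)‖ ‖v.2‖ ≤ _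
            rw [norm_zero, max_eq_right (norm_nonneg _)]
            have := le_max_right ‖v.1‖ ‖v.2‖
            have := norm_nonneg v.2
            linarith
        · simp [smul_smul, mul_div_cancel₀ _ hdw0.ne', smul_sub]) n
  have e : (fun w : Vec × Y => (fun q : Vec × Y => ∫ p in zone a, A (p, (q.1, q.2)) * B (q.1, (p, q.2)))
      ((x, y) + scaleMap Y s w)) = fun w => ∫ p in zone a,
        A (p, (x + s • w.1, y + w.2)) * B (x + s • w.1, (p, y + w.2)) := by
    ext w; rfl
  rw [e]
  refine ⟨key.1.contDiffAt (Metric.ball_mem_nhds _ (by norm_num)), ?_⟩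
  simpa using key.2 0 (Metric.mem_ball_self (by norm_num))

end SymbolIntegrals

/-! ### Convolutions -/

section Convolution

variable {Z : Type} [NormedAddCommGroup Z] [NormedSpace ℝ Z] {a : Module.Basis (Fin 3) ℝ Vec}

theorem isClosed_latticeReflection (q : Vec) :
    IsClosed {p : Vec | p ∈ recipLattice a ∨ q - p ∈ recipLattice a} :=
  (isClosed_recipLattice a).union
    ((isClosed_recipLattice a).preimage (by fun_prop : Continuous fun p : Vec => q - p))

theorem volume_latticeReflection (q : Vec) :
    (volume.restrict (zone a)) {p : Vec | p ∈ recipLattice a ∨ q - p ∈ recipLattice a} = 0 := by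
  refine Measure.restrict_le_self.absolutelyContinuous
    (measure_union_null (volume_recipLattice a) ?_)
  exact ((Measure.measurePreserving_sub_left volume q).measure_preimage_emb
    (Homeomorph.subLeft q).measurableEmbedding _).trans (volume_recipLattice a)

/-- The integrand of a convolution of symbols is integrable. -/
theorem SymbolOn.integrable_conv {A B : Vec × Z → ℂ} (hA : SymbolOn a (offLattice a) 2 A)
    (hB : SymbolOn a (offLattice a) 0 B) {k : Vec → ℂ} (hk : Continuous k) (hk1 : ∀ p, ‖k p‖ ≤ 1)
    (q : Vec) (z : Z) : IntegrableOn (fun p => k p * (A (p, z) * B (q - p, z))) (zone a) := by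
  obtain ⟨ρ, hρ⟩ := isBounded_iff_forall_norm_le.1 (isBounded_zone a)
  obtain ⟨C, hC0, hC⟩ := hA.exists_bound_norm (max ρ ‖z‖)
  obtain ⟨C', hC0', hC'⟩ := hB.exists_bound_norm (max (‖q‖ + ρ) ‖z‖)
  refine integrable_of_continuousAt_of_le (isClosed_latticeReflection q)
    (volume_latticeReflection q) ((integrableOn_one_div_latDist_sq a).const_mul (C * C')) ?_ ?_
  · intro p hp
    have h1 : p ∈ offLattice a := fun h => hp (Or.inl h)
    have h2 : q - p ∈ offLattice a := fun h => hp (Or.inr h)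
    refine hk.continuousAt.mul (ContinuousAt.mul ?_ ?_)
    · exact ContinuousAt.comp (f := fun p => (p, z)) (hA.smooth p h1 z).continuousAt (by fun_prop)
    · exact ContinuousAt.comp (f := fun p => (q - p, z)) (hB.smooth _ h2 z).continuousAt
        (by fun_prop)
  · refine (ae_restrict_iff' (measurableSet_zone a)).2 (Eventually.of_forall fun p hpz hp => ?_)
    have h1 : p ∈ offLattice a := fun h => hp (Or.inl h)
    have h2 : q - p ∈ offLattice a := fun h => hp (Or.inr h)
    have h3 := hC p h1 z ((hρ p hpz).trans (le_max_left _ _)) (le_max_right _ _)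
    have h4 := hC' (q - p) h2 z (((norm_sub_le _ _).trans
      (add_le_add_right (hρ p hpz) _)).trans (le_max_left _ _)) (le_max_right _ _)
    rw [pow_zero, div_one] at h4
    rw [norm_mul, norm_mul]
    calc _ ≤ 1 * ((C / latDist a p ^ 2) * C') := by
          gcongr
          exact hk1 p
      _ = _ := by ring

/-- The convolution is split by the cutoff, and in the part away from the singularity of `A` the
variables of `A` and `B` are exchanged. -/
theorem convolution_split {A B : Vec × Z → ℂ} (hA : SymbolOn a (offLattice a) 2 A)
    (hB : SymbolOn a (offLattice a) 0 B)
    (pA : ∀ G ∈ recipLattice a, ∀ x z, A (x + G, z) = A (x, z))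
    (pB : ∀ G ∈ recipLattice a, ∀ x z, B (x + G, z) = B (x, z)) {r μ : ℝ}
    (hr : ∀ G ∈ recipLattice a, ‖G‖ < 2 * r → G = 0) (hμ : 0 < μ) (hμr : μ < r) (q : Vec) (z : Z) :
    ∫ p in zone a, A (p, z) * B (q - p, z) =
      (∫ p in zone a, cutoff a μ p * (A (p, z) * B (q - p, z))) +
      ∫ p in zone a, (1 - cutoff a μ (q - p)) * A (q - p, z) * B (p, z) := by
  have hc := (contDiff_cutoff hr hμ hμr).continuous
  have h1 := hA.integrable_conv hB hc (norm_cutoff_le hr hμ hμr) q z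
  have h2 := hA.integrable_conv hB (k := fun p => 1 - cutoff a μ p) (continuous_const.sub hc)
    (norm_one_sub_cutoff_le hr hμ hμr) q z
  have h3 := setIntegral_comp_sub_left_of_periodic (recipBasis a)
    (F := fun p => (1 - cutoff a μ p) * (A (p, z) * B (q - p, z))) (fun G hG p => by
      have e : q - (p + G) = q - p + -G := by abel
      rw [cutoff_add_of_mem hG, pA G hG, e, pB _ (neg_mem hG)]) q
  have h4 : ∀ p, (1 - cutoff a μ (q - p)) * A (q - p, z) * B (p, z) =
      (1 - cutoff a μ (q - p)) * (A (q - p, z) * B (q - (q - p), z)) := fun p => by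
    rw [sub_sub_cancel, mul_assoc]
  simp only [h4]
  rw [zone] at *
  rw [h3, ← integral_add h1 h2]
  congr 1
  ext p
  ring

/-- The part of the convolution near the singularity of `A`, where `B` is differentiated. -/
theorem convolution_near {A B : Vec × Z → ℂ} (hA : SymbolOn a (offLattice a) 2 A)
    (hB : SymbolOn a (offLattice a) 0 B) {r κ : ℝ}
    (hr : ∀ G ∈ recipLattice a, ‖G‖ < 2 * r → G = 0) (hκ : 0 < κ) (hκ4 : κ ≤ 1 / 4)
    {R : ℝ} (hκR : κ * R < r) :
    ∃ C : ℕ → ℝ, ∀ x ∈ offLattice a, ∀ z, ‖x‖ ≤ R → ‖z‖ ≤ R → ∀ n : ℕ,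
      ContDiffAt ℝ n (fun w : Vec × Z => ∫ p in zone a, cutoff a (κ * latDist a x) p *
        (A (p, z + w.2) * B (x + latDist a x • w.1 - p, z + w.2))) 0 ∧
      ‖iteratedFDeriv ℝ n (fun w : Vec × Z => ∫ p in zone a, cutoff a (κ * latDist a x) p *
        (A (p, z + w.2) * B (x + latDist a x • w.1 - p, z + w.2))) 0‖ ≤ C n := by
  obtain ⟨ρ, hρ⟩ := isBounded_iff_forall_norm_le.1 (isBounded_zone a)
  set R' := max ρ (2 * R + ρ + 1) with hR'
  choose C hC0 hC using hA.exists_bound_affine (W := Vec × Z) R' 1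
  choose C' hC0' hC' using hB.exists_bound_affine (W := Vec × Z) R' 2
  refine ⟨fun n => (∑ i ∈ Finset.range (n + 1), (n.choose i : ℝ) * C i * C' (n - i)) *
    ∫ p in zone a, 1 / latDist a p ^ 2, fun x hx z hxR hzR n => ?_⟩
  set s := latDist a x with hs
  have hs0 : 0 < s := latDist_pos.2 hx
  have hsR : s ≤ R := (latDist_le_norm x).trans hxR
  have hμ : 0 < κ * s := by positivity
  have hμr : κ * s < r := (mul_le_mul_of_nonneg_left hsR hκ.le).trans_lt hκR
  -- on the support of the cutoff, the argument of `B` stays at distance `s / 2` from the lattice,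
  -- since `κ ≤ 1 / 4`
  have hd : ∀ w ∈ Metric.ball (0 : Vec × Z) κ, ∀ p, latDist a p ≤ κ * s →
      s / 2 ≤ latDist a (x + s • w.1 - p) := by
    intro w hw p hp
    have h1 : ‖w.1‖ ≤ κ := (norm_fst_le w).trans (mem_ball_zero_iff.1 hw).le
    have h2 := latDist_le_add (a := a) x (x + s • w.1)
    rw [sub_add_cancel_left, norm_neg, norm_smul, Real.norm_of_nonneg hs0.le] at h2
    have h3 := latDist_le_latDist_add_latDist (a := a) (x + s • w.1) p
    nlinarith
  have hw2 : ∀ w ∈ Metric.ball (0 : Vec × Z) κ, ‖z + w.2‖ ≤ 2 * R + 1 := by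
    intro w hw
    have h1 : ‖w.2‖ ≤ κ := (norm_snd_le w).trans (mem_ball_zero_iff.1 hw).le
    have hR0 : 0 ≤ R := (norm_nonneg _).trans hzR
    exact (norm_add_le _ _).trans (by linarith)
  have hw1 : ∀ w ∈ Metric.ball (0 : Vec × Z) κ, ‖x + s • w.1‖ ≤ 2 * R + 1 := by
    intro w hw
    have h1 : ‖w.1‖ ≤ κ := (norm_fst_le w).trans (mem_ball_zero_iff.1 hw).le
    refine (norm_add_le _ _).trans ?_
    rw [norm_smul, Real.norm_of_nonneg hs0.le]
    nlinarith
  have hsmA : ∀ p ∉ recipLattice a, ∀ w : Vec × Z,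
      ContDiffAt ℝ ∞ (fun q : Vec × (Vec × Z) => A (q.1, z + q.2.2)) (p, w) :=
    fun p hp w => ContDiffAt.comp (p, w) (hA.smooth p hp _) (by fun_prop)
  have hsmB : ∀ p, latDist a p ≤ κ * s → ∀ w ∈ Metric.ball (0 : Vec × Z) κ,
      ContDiffAt ℝ ∞ (fun q : Vec × (Vec × Z) => B (x + s • q.2.1 - q.1, z + q.2.2)) (p, w) :=
    fun p hp w hw => ContDiffAt.comp (p, w)
      (hB.smooth _ (latDist_pos.1 ((half_pos hs0).trans_le (hd w hw p hp))) _) (by fun_prop)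
  have hcut : ContDiff ℝ ∞ (cutoff a (κ * s)) := contDiff_cutoff hr hμ hμr
  have key := contDiffOn_integral_of_dominated (μ := volume.restrict (zone a))
    (isClosed_recipLattice a) volume_restrict_zone_recipLattice
    (Metric.isOpen_ball (x := (0 : Vec × Z)) (ε := κ)) (integrableOn_one_div_latDist_sq a)
    (h := fun q => cutoff a (κ * s) q.1 *
      (A (q.1, z + q.2.2) * B (x + s • q.2.1 - q.1, z + q.2.2)))
    (fun p hp w hw => by
      by_cases hps : latDist a p ≤ κ * s
      · refine ContDiffAt.mul ?_ ((hsmA p hp w).mul (hsmB p hps w hw))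
        exact ContDiffAt.comp (g := cutoff a (κ * s)) (f := Prod.fst) (p, w) hcut.contDiffAt
          contDiffAt_fst
      · refine contDiffAt_const (c := (0 : ℂ)) |>.congr_of_eventuallyEq ?_
        have hop : IsOpen {q : Vec × (Vec × Z) | κ * s < latDist a q.1} :=
          isOpen_lt continuous_const (continuous_latDist.comp continuous_fst)
        filter_upwards [hop.mem_nhds (not_le.1 hps)] with q hq
        rw [cutoff_eq_zero hr hμ hμr (le_of_lt hq), zero_mul])
    (C := fun n => ∑ i ∈ Finset.range (n + 1), (n.choose i : ℝ) * C i * C' (n - i)) (fun n => by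
      refine (ae_restrict_iff' (measurableSet_zone a)).2
        (Eventually.of_forall fun p hp hpL w hw => ?_)
      have hnn : 0 ≤ (∑ i ∈ Finset.range (n + 1), (n.choose i : ℝ) * C i * C' (n - i)) *
          (1 / latDist a p ^ 2) :=
        mul_nonneg (Finset.sum_nonneg fun i _ => mul_nonneg (mul_nonneg (by positivity) (hC0 i))
          (hC0' _)) (by positivity)
      by_cases hps : latDist a p ≤ κ * s
      swap
      · have e : (fun w : Vec × Z => cutoff a (κ * s) p *
            (A (p, z + w.2) * B (x + s • w.1 - p, z + w.2))) = fun _ => 0 := by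
          ext w
          rw [cutoff_eq_zero hr hμ hμr (not_le.1 hps).le, zero_mul]
        simpa [e] using hnn
      have hpR : ‖p‖ ≤ R' := (hρ p hp).trans (le_max_left _ _)
      have hzw : ‖z + w.2‖ ≤ R' := (hw2 w hw).trans ((by
        linarith [(norm_nonneg _).trans (hρ p hp)] : 2 * R + 1 ≤ 2 * R + ρ + 1).trans
          (le_max_right _ _))
      have hxw : ‖x + s • w.1 - p‖ ≤ R' := (norm_sub_le _ _).trans
        ((add_le_add (hw1 w hw) (hρ p hp)).trans ((by linarith :
          2 * R + 1 + ρ ≤ 2 * R + ρ + 1).trans (le_max_right _ _)))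
      have hfA : ContDiffAt ℝ ∞ (fun w : Vec × Z => A (p, z + w.2)) w :=
        ContDiffAt.comp (g := fun q : Vec × (Vec × Z) => A (q.1, z + q.2.2))
          (f := fun w => (p, w)) w (hsmA p hpL w) (by fun_prop)
      have hfB : ContDiffAt ℝ ∞ (fun w : Vec × Z => B (x + s • w.1 - p, z + w.2)) w :=
        ContDiffAt.comp (g := fun q : Vec × (Vec × Z) => B (x + s • q.2.1 - q.1, z + q.2.2))
          (f := fun w => (p, w)) w (hsmB p hps w hw) (by fun_prop)
      have h1 := norm_iteratedFDeriv_mul_le_mul (C := C) (C' := C')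
        (X := 1 / latDist a p ^ 2) (X' := 1) hfA hfB (fun i => ?_) (fun i => ?_) n
      · rw [mul_one] at h1
        have h2 := iteratedFDeriv_const_smul_apply' (𝕜 := ℝ) (a := cutoff a (κ * s) p)
          ((hfA.mul hfB).of_infty n)
        simp only [smul_eq_mul] at h2
        rw [h2, norm_smul]
        exact (mul_le_of_le_one_left (norm_nonneg _) (norm_cutoff_le hr hμ hμr p)).trans h1
      · rw [← div_eq_mul_one_div]
        -- the first argument of `A` does not depend on `w`, so only the parameter is differentiated
        refine hC i p hpL (z + w.2) hpR hzw (scaleMap Z 0) ?_ _ w fun w' => ?_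
        · exact (norm_scaleMap_le 0).trans (by simp)
        · simp
      · have hdw := hd w hw p hps
        have hdw0 : 0 < latDist a (x + s • w.1 - p) := (half_pos hs0).trans_le hdw
        have hsd : s / latDist a (x + s • w.1 - p) ≤ 2 := by
          rw [div_le_iff₀ hdw0]; linarith
        have := hC' i (x + s • w.1 - p) (latDist_pos.1 hdw0) (z + w.2) hxw hzw
          (scaleMap Z (s / latDist a (x + s • w.1 - p))) ((norm_scaleMap_le _).trans (by
            rw [abs_of_pos (by positivity)]; exact max_le hsd one_le_two))
          (fun w' => (x + s • w'.1 - p, z + w'.2)) w fun w' => ?_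
        · simpa using this
        · simp only [scaleMap_apply, smul_smul, mul_div_cancel₀ _ hdw0.ne', Prod.mk_add_mk,
            Prod.fst_sub, Prod.snd_sub, smul_sub]
          congr 1 <;> abel) n
  refine ⟨key.1.contDiffAt (Metric.ball_mem_nhds _ hκ), ?_⟩
  simpa using key.2 0 (Metric.mem_ball_self hκ)

/-- Bounds for the derivatives of the function that cuts out the reciprocal lattice. -/
theorem exists_bound_iteratedFDeriv_one_sub_cutoff {r : ℝ}
    (hr : ∀ G ∈ recipLattice a, ‖G‖ < 2 * r → G = 0) (n : ℕ) :
    ∃ C, 0 ≤ C ∧ ∀ μ, 0 < μ → μ < r → ∀ x,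
      ‖iteratedFDeriv ℝ n (fun x => 1 - cutoff a μ x) x‖ ≤ C * (1 / μ) ^ n := by
  rcases Nat.eq_zero_or_pos n with rfl | hn
  · refine ⟨1, zero_le_one, fun μ hμ hμr x => ?_⟩
    simpa using norm_one_sub_cutoff_le hr hμ hμr x
  · obtain ⟨C, hC0, hC⟩ := exists_bound_iteratedFDeriv_cutoff hr n
    refine ⟨C, hC0, fun μ hμ hμr x => ?_⟩
    have h1 := fun_iteratedFDeriv_sub_apply (𝕜 := ℝ) (i := n) (x := x) (f := fun _ => (1 : ℂ))
      contDiffAt_const ((contDiff_cutoff hr hμ hμr).contDiffAt.of_infty n)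
    rw [h1, iteratedFDeriv_const_of_ne hn.ne', Pi.zero_apply, zero_sub, norm_neg]
    exact hC μ hμ hμr x

/-- The part of the convolution away from the singularity of `A`, where `A` is differentiated. -/
theorem convolution_far {A B : Vec × Z → ℂ} (hA : SymbolOn a (offLattice a) 2 A)
    (hB : SymbolOn a (offLattice a) 0 B) {r κ : ℝ}
    (hr : ∀ G ∈ recipLattice a, ‖G‖ < 2 * r → G = 0) (hκ : 0 < κ) (hκ4 : κ ≤ 1 / 4)
    {R : ℝ} (hκR : κ * R < r) :
    ∃ C : ℕ → ℝ, ∀ x ∈ offLattice a, ∀ z, ‖x‖ ≤ R → ‖z‖ ≤ R → ∀ n : ℕ,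
      ContDiffAt ℝ n (fun w : Vec × Z => ∫ p in zone a,
        (1 - cutoff a (κ * latDist a x) (x + latDist a x • w.1 - p)) *
        A (x + latDist a x • w.1 - p, z + w.2) * B (p, z + w.2)) 0 ∧
      ‖iteratedFDeriv ℝ n (fun w : Vec × Z => ∫ p in zone a,
        (1 - cutoff a (κ * latDist a x) (x + latDist a x • w.1 - p)) *
        A (x + latDist a x • w.1 - p, z + w.2) * B (p, z + w.2)) 0‖ ≤ C n := by
  obtain ⟨ρ, hρ⟩ := isBounded_iff_forall_norm_le.1 (isBounded_zone a)
  set R' := max ρ (2 * R + ρ + 1) with hR'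
  choose C hC0 hC using hA.exists_bound_affine (W := Vec × Z) R' (max (2 / κ) 1)
  choose C' hC0' hC' using hB.exists_bound_affine (W := Vec × Z) R' 1
  choose C'' hC0'' hC'' using exists_bound_iteratedFDeriv_one_sub_cutoff hr
  set D : ℕ → ℝ := fun n => ∑ i ∈ Finset.range (n + 1), (n.choose i : ℝ) *
    (C'' i * (1 / κ) ^ i) * C (n - i) with hD
  have hD0 : ∀ n, 0 ≤ D n := fun n => Finset.sum_nonneg fun i _ => by
    have := hC0 (n - i)
    have := hC0'' i
    positivity
  set D' : ℕ → ℝ := fun n => ∑ i ∈ Finset.range (n + 1), (n.choose i : ℝ) * D i * C' (n - i)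
    with hD'
  have hD0' : ∀ n, 0 ≤ D' n := fun n => Finset.sum_nonneg fun i _ => by
    have := hC0' (n - i)
    have := hD0 i
    positivity
  refine ⟨fun n => D' n * (3 * ∫ p in zone a, 1 / latDist a p ^ 2), fun x hx z hxR hzR n => ?_⟩
  set s := latDist a x with hs
  have hs0 : 0 < s := latDist_pos.2 hx
  have hsR : s ≤ R := (latDist_le_norm x).trans hxR
  have hμ : 0 < κ * s := by positivity
  have hμr : κ * s < r := (mul_le_mul_of_nonneg_left hsR hκ.le).trans_lt hκR
  have hper : ∀ G ∈ recipLattice a, ∀ p, 1 / latDist a (p + G) ^ 2 = 1 / latDist a p ^ 2 :=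
    fun G hG p => by rw [latDist_add_of_mem hG]
  have hκ4' : 0 < κ / 4 := by positivity
  have hw1 : ∀ w ∈ Metric.ball (0 : Vec × Z) (κ / 4), ‖w.1‖ ≤ κ / 4 := fun w hw =>
    (norm_fst_le w).trans (mem_ball_zero_iff.1 hw).le
  have hw2 : ∀ w ∈ Metric.ball (0 : Vec × Z) (κ / 4), ‖w.2‖ ≤ κ / 4 := fun w hw =>
    (norm_snd_le w).trans (mem_ball_zero_iff.1 hw).le
  have hd : ∀ w ∈ Metric.ball (0 : Vec × Z) (κ / 4), ∀ p,
      latDist a (x - p) ≤ latDist a (x + s • w.1 - p) + κ * s / 4 := by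
    intro w hw p
    have h2 := latDist_le_add (a := a) (x - p) (x + s • w.1 - p)
    rw [show x - p - (x + s • w.1 - p) = -(s • w.1) by abel, norm_neg, norm_smul,
      Real.norm_of_nonneg hs0.le] at h2
    nlinarith [hw1 w hw]
  have hcut : ContDiff ℝ ∞ (fun v => 1 - cutoff a (κ * s) v) :=
    contDiff_const.sub (contDiff_cutoff hr hμ hμr)
  -- the integrand vanishes near the singularity of `A`
  have hzero : ∀ p, ∀ w : Vec × Z, latDist a (x + s • w.1 - p) < κ * s / 2 →
      (fun q : Vec × (Vec × Z) => (1 - cutoff a (κ * s) (x + s • q.2.1 - q.1)) *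
        A (x + s • q.2.1 - q.1, z + q.2.2) * B (q.1, z + q.2.2)) =ᶠ[𝓝 (p, w)] fun _ => 0 := by
    intro p w hpw
    have hop : IsOpen {q : Vec × (Vec × Z) | latDist a (x + s • q.2.1 - q.1) < κ * s / 2} :=
      isOpen_lt (continuous_latDist.comp (by fun_prop)) continuous_const
    filter_upwards [hop.mem_nhds hpw] with q hq
    rw [cutoff_eq_one hr hμ hμr (le_of_lt hq), sub_self, zero_mul, zero_mul]
  have hsmA : ∀ p, ∀ w : Vec × Z, κ * s / 2 ≤ latDist a (x + s • w.1 - p) →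
      ContDiffAt ℝ ∞ (fun q : Vec × (Vec × Z) => A (x + s • q.2.1 - q.1, z + q.2.2)) (p, w) :=
    fun p w hw => ContDiffAt.comp (p, w)
      (hA.smooth _ (latDist_pos.1 (lt_of_lt_of_le (by positivity) hw)) _) (by fun_prop)
  have hsmB : ∀ p ∉ recipLattice a, ∀ w : Vec × Z,
      ContDiffAt ℝ ∞ (fun q : Vec × (Vec × Z) => B (q.1, z + q.2.2)) (p, w) :=
    fun p hp w => ContDiffAt.comp (p, w) (hB.smooth p hp _) (by fun_prop)
  have hsmC : ∀ p, ∀ w : Vec × Z, ContDiffAt ℝ ∞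
      (fun q : Vec × (Vec × Z) => 1 - cutoff a (κ * s) (x + s • q.2.1 - q.1)) (p, w) :=
    fun p w => ContDiffAt.comp (g := fun v => 1 - cutoff a (κ * s) v)
      (f := fun q : Vec × (Vec × Z) => x + s • q.2.1 - q.1) (p, w) hcut.contDiffAt (by fun_prop)
  have hint : Integrable (fun p => 3 * (1 / latDist a (x - p) ^ 2)) (volume.restrict (zone a)) :=
    ((integrableOn_comp_sub_left_of_periodic (recipBasis a)
      (F := fun p => 1 / latDist a p ^ 2) hper x).2 (integrableOn_one_div_latDist_sq a)).const_mul 3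
  have key := contDiffOn_integral_of_dominated (μ := volume.restrict (zone a))
    (isClosed_recipLattice a) volume_restrict_zone_recipLattice
    (Metric.isOpen_ball (x := (0 : Vec × Z)) (ε := κ / 4)) hint
    (h := fun q : Vec × (Vec × Z) => (1 - cutoff a (κ * s) (x + s • q.2.1 - q.1)) *
        A (x + s • q.2.1 - q.1, z + q.2.2) * B (q.1, z + q.2.2))
    (fun p hp w hw => by
      by_cases hps : κ * s / 2 ≤ latDist a (x + s • w.1 - p)
      · exact ((hsmC p w).mul (hsmA p w hps)).mul (hsmB p hp w)
      · exact contDiffAt_const.congr_of_eventuallyEq (hzero p w (not_le.1 hps)))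
    (C := D') (fun n => by
      refine (ae_restrict_iff' (measurableSet_zone a)).2
        (Eventually.of_forall fun p hp hpL w hw => ?_)
      by_cases hps : κ * s / 2 ≤ latDist a (x + s • w.1 - p)
      swap
      · have e : (fun w : Vec × Z => (1 - cutoff a (κ * s) (x + s • w.1 - p)) *
            A (x + s • w.1 - p, z + w.2) * B (p, z + w.2)) =ᶠ[𝓝 w] fun _ => 0 :=
          (Continuous.continuousAt (f := fun w : Vec × Z => (p, w)) (by fun_prop)).eventually
            (hzero p w (not_le.1 hps))
        rw [iteratedFDeriv_congr e]
        have := hD0' n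
        simpa using (by positivity : 0 ≤ D' n * (3 * (1 / latDist a (x - p) ^ 2)))
      have hR0 : 0 ≤ R := (norm_nonneg _).trans hzR
      have hpR : ‖p‖ ≤ R' := (hρ p hp).trans (le_max_left _ _)
      have hρ0 : 0 ≤ ρ := (norm_nonneg _).trans (hρ p hp)
      have hzw : ‖z + w.2‖ ≤ R' := by
        refine ((norm_add_le _ _).trans ?_).trans (le_max_right _ _)
        have := hw2 w hw
        linarith
      have hxw : ‖x + s • w.1 - p‖ ≤ R' := by
        refine ((norm_sub_le _ _).trans (add_le_add_left (norm_add_le _ _) _)).trans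
          (le_trans ?_ (le_max_right _ _))
        rw [norm_smul, Real.norm_of_nonneg hs0.le]
        have := hw1 w hw
        have := hρ p hp
        nlinarith
      set d := latDist a (x + s • w.1 - p) with hdd
      have hd0 : 0 < d := lt_of_lt_of_le (by positivity) hps
      have hdp : latDist a (x - p) ≤ 3 / 2 * d := by
        have := hd w hw p
        linarith
      have hdp0 : 0 < latDist a (x - p) := by
        have h2 := latDist_le_add (a := a) (x + s • w.1 - p) (x - p)
        rw [show x + s • w.1 - p - (x - p) = s • w.1 by abel, norm_smul,
          Real.norm_of_nonneg hs0.le] at h2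
        nlinarith [hw1 w hw]
      have hfA : ContDiffAt ℝ ∞ (fun w : Vec × Z => A (x + s • w.1 - p, z + w.2)) w :=
        ContDiffAt.comp (g := fun q : Vec × (Vec × Z) => A (x + s • q.2.1 - q.1, z + q.2.2))
          (f := fun w => (p, w)) w (hsmA p w hps) (by fun_prop)
      have hfB : ContDiffAt ℝ ∞ (fun w : Vec × Z => B (p, z + w.2)) w :=
        ContDiffAt.comp (g := fun q : Vec × (Vec × Z) => B (q.1, z + q.2.2))
          (f := fun w => (p, w)) w (hsmB p hpL w) (by fun_prop)
      have hfC : ContDiffAt ℝ ∞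
          (fun w : Vec × Z => 1 - cutoff a (κ * s) (x + s • w.1 - p)) w :=
        ContDiffAt.comp (g := fun q : Vec × (Vec × Z) => 1 - cutoff a (κ * s) (x + s • q.2.1 - q.1))
          (f := fun w => (p, w)) w (hsmC p w) (by fun_prop)
      have h1 := norm_iteratedFDeriv_mul_le_mul (C := fun i => C'' i * (1 / κ) ^ i) (C' := C)
        (X := 1) (X' := 1 / d ^ 2) hfC hfA (fun i => ?_) (fun i => ?_)
      · have h2 := norm_iteratedFDeriv_mul_le_mul (C := D) (C' := C') (X' := 1) (hfC.mul hfA) hfB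
          h1 (fun i => ?_) n
        · refine h2.trans ?_
          rw [mul_one, one_mul]
          -- `d ≥ κ s / 2`, while `w` shifts the argument by at most `κ s / 4`: a bound independent of `w`
          have h3 : 1 / d ^ 2 ≤ 3 * (1 / latDist a (x - p) ^ 2) := by
            rw [mul_one_div, div_le_div_iff₀ (by positivity) (by positivity)]
            nlinarith
          exact mul_le_mul_of_nonneg_left h3 (hD0' n)
        · rw [mul_one]
          have := hC' i p hpL (z + w.2) hpR hzw (scaleMap Z 0) ((norm_scaleMap_le 0).trans (by simp))
            (fun w' => (p, z + w'.2)) w fun w' => ?_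
          · simpa using this
          · simp
      · rw [mul_one]
        have e : (fun w : Vec × Z => 1 - cutoff a (κ * s) (x + s • w.1 - p)) =
            fun w => (fun v => 1 - cutoff a (κ * s) v)
              ((x - p) + (s • ContinuousLinearMap.fst ℝ Vec Z) w) := by
          ext w
          simp only [FunLike.coe_smul, Pi.smul_apply, ContinuousLinearMap.coe_fst']
          rw [add_sub_right_comm]
        rw [e]
        refine (norm_iteratedFDeriv_comp_affine_le (f := fun v => 1 - cutoff a (κ * s) v) _ _
          (hcut.contDiffAt.of_infty i)).trans ?_
        have h3 : ‖s • ContinuousLinearMap.fst ℝ Vec Z‖ ≤ s := by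
          rw [norm_smul, Real.norm_of_nonneg hs0.le]
          exact mul_le_of_le_one_right hs0.le (ContinuousLinearMap.norm_fst_le _ _ _)
        refine (mul_le_mul (hC'' i _ hμ hμr _) (pow_le_pow_left₀ (norm_nonneg _) h3 i)
          (by positivity) (mul_nonneg (hC0'' i) (by positivity))).trans (le_of_eq ?_)
        rw [mul_assoc, ← mul_pow]
        congr 2
        field_simp
      · rw [← div_eq_mul_one_div]
        have hsd : s / d ≤ 2 / κ := by
          rw [div_le_div_iff₀ hd0 hκ]; linarith
        refine hC i (x + s • w.1 - p) (latDist_pos.1 hd0) (z + w.2) hxw hzw (scaleMap Z (s / d))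
          ((norm_scaleMap_le _).trans (by
            rw [abs_of_pos (by positivity)]; exact max_le_max hsd le_rfl))
          (fun w' => (x + s • w'.1 - p, z + w'.2)) w fun w' => ?_
        simp only [scaleMap_apply, smul_smul, ← hdd, mul_div_cancel₀ _ hd0.ne', Prod.mk_add_mk,
          Prod.fst_sub, Prod.snd_sub, smul_sub]
        congr 1 <;> abel) n
  refine ⟨key.1.contDiffAt (Metric.ball_mem_nhds _ hκ4'), ?_⟩
  have := key.2 0 (Metric.mem_ball_self hκ4')
  rw [integral_const_mul, zone, setIntegral_comp_sub_left_of_periodic (recipBasis a)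
    (F := fun p => 1 / latDist a p ^ 2) hper x] at this
  exact this

/-- The convolution of a symbol of order `2` and a symbol of order `0` is a symbol of order `0`.
At distance `d` of `q` from the lattice, the integrand is split at distance `κ d` from the
singularity of `A`, so that neither singularity is ever differentiated. -/
theorem SymbolOn.convolution {A B : Vec × Z → ℂ} (hA : SymbolOn a (offLattice a) 2 A)
    (hB : SymbolOn a (offLattice a) 0 B)
    (pA : ∀ G ∈ recipLattice a, ∀ x z, A (x + G, z) = A (x, z))
    (pB : ∀ G ∈ recipLattice a, ∀ x z, B (x + G, z) = B (x, z)) :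
    SymbolOn a (offLattice a) 0
      (fun q : Vec × Z => ∫ p in zone a, A (p, q.2) * B (q.1 - p, q.2)) := by
  refine SymbolOn.of_dilated (fun x hx => hx) fun R => ?_
  obtain ⟨r, hr0, hr⟩ := exists_latticeGap a
  set κ := min (1 / 4) (r / (2 * (|R| + 1))) with hκ
  have hκ0 : 0 < κ := lt_min (by norm_num) (by positivity)
  have hκR : κ * R < r := by
    calc κ * R ≤ κ * (|R| + 1) := by
          gcongr
          linarith [le_abs_self R]
      _ ≤ r / (2 * (|R| + 1)) * (|R| + 1) := by
          gcongr
          exact min_le_right _ _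
      _ = r / 2 := by field_simp
      _ < r := half_lt_self hr0
  obtain ⟨C, hC⟩ := convolution_near hA hB hr hκ0 (min_le_left _ _) hκR
  obtain ⟨C', hC'⟩ := convolution_far hA hB hr hκ0 (min_le_left _ _) hκR
  refine ⟨fun n => C n + C' n, fun x hx z hxR hzR n => ?_⟩
  obtain ⟨h1, h2⟩ := hC x hx z hxR hzR n
  obtain ⟨h3, h4⟩ := hC' x hx z hxR hzR n
  have hμ : 0 < κ * latDist a x := mul_pos hκ0 (latDist_pos.2 hx)
  have hμr : κ * latDist a x < r :=
    (mul_le_mul_of_nonneg_left ((latDist_le_norm x).trans hxR) hκ0.le).trans_lt hκR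
  have e : (fun w => (fun q : Vec × Z => ∫ p in zone a, A (p, q.2) * B (q.1 - p, q.2))
      ((x, z) + scaleMap Z (latDist a x) w)) = fun w =>
      (∫ p in zone a, cutoff a (κ * latDist a x) p *
        (A (p, z + w.2) * B (x + latDist a x • w.1 - p, z + w.2))) +
      ∫ p in zone a, (1 - cutoff a (κ * latDist a x) (x + latDist a x • w.1 - p)) *
        A (x + latDist a x • w.1 - p, z + w.2) * B (p, z + w.2) := by
    ext w
    exact convolution_split hA hB pA pB hr hμ hμr _ _
  rw [e]
  refine ⟨h1.add h3, ?_⟩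
  rw [pow_zero, div_one, fun_iteratedFDeriv_add_apply h1 h3]
  exact (norm_add_le _ _).trans (add_le_add h2 h4)

end Convolution

/-! ### Periodic symbols in three momentum variables -/

section PeriodicSymbols

variable {a : Module.Basis (Fin 3) ℝ Vec} {ν : ℕ} {g h h' : Vec → Vec → Vec → ℂ}

/-- Functions of three momentum variables that are periodic in each of them, smooth where
`k₃ - k₁` is not a reciprocal lattice vector, with a singularity of order `-ν` there, and smooth
along the diagonal `k₃ = k₁`. For `ν = 0` this is the space `𝕋(Ω*)`. -/
structure PeriodicSymbol (a : Module.Basis (Fin 3) ℝ Vec) (ν : ℕ) (g : Vec → Vec → Vec → ℂ) :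
    Prop where
  periodic₁ : ∀ G ∈ recipLattice a, ∀ k₁ k₂ k₃, g (k₁ + G) k₂ k₃ = g k₁ k₂ k₃
  periodic₂ : ∀ G ∈ recipLattice a, ∀ k₁ k₂ k₃, g k₁ (k₂ + G) k₃ = g k₁ k₂ k₃
  periodic₃ : ∀ G ∈ recipLattice a, ∀ k₁ k₂ k₃, g k₁ k₂ (k₃ + G) = g k₁ k₂ k₃
  symbol : SymbolOn a (offLattice a) ν
    (fun p : Vec × (Vec × Vec) => g p.2.1 p.2.2 (p.2.1 + p.1))
  diag : ContDiff ℝ ∞ (fun y : Vec × Vec => g y.1 y.2 y.1)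

/-- An integral linear combination of four vectors; the first of them is the variable of
integration in the applications. -/
def IsIntComb (f : Vec → Vec → Vec → Vec → Vec) : Prop :=
  ∃ c₀ c₁ c₂ c₃ : ℤ, ∀ κ k₁ k₂ k₃, f κ k₁ k₂ k₃ = c₀ • κ + c₁ • k₁ + c₂ • k₂ + c₃ • k₃

theorem neg_mem_offLattice {x : Vec} (hx : x ∈ offLattice a) : -x ∈ offLattice a :=
  fun h => hx (by simpa using neg_mem h)

theorem PeriodicSymbol.periodic (hg : PeriodicSymbol a ν g) {G₁ G₂ G₃ : Vec}
    (h₁ : G₁ ∈ recipLattice a) (h₂ : G₂ ∈ recipLattice a) (h₃ : G₃ ∈ recipLattice a)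
    (k₁ k₂ k₃ : Vec) : g (k₁ + G₁) (k₂ + G₂) (k₃ + G₃) = g k₁ k₂ k₃ := by
  rw [hg.periodic₁ _ h₁, hg.periodic₂ _ h₂, hg.periodic₃ _ h₃]

theorem PeriodicSymbol.eq_diag (hg : PeriodicSymbol a ν g) {k₁ k₃ : Vec}
    (hk : k₃ - k₁ ∈ recipLattice a) (k₂ : Vec) : g k₁ k₂ k₃ = g k₁ k₂ k₁ := by
  rw [← hg.periodic₃ _ hk k₁ k₂ k₁, add_sub_cancel]

section Linear

variable {Z : Type} [NormedAddCommGroup Z] [NormedSpace ℝ Z]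

theorem PeriodicSymbol.symbolOn_comp (hg : PeriodicSymbol a ν g) (L₁ L₂ L₃ : Vec × Z →L[ℝ] Vec)
    (σ : ℤˣ) (hL : ∀ w, L₃ w - L₁ w = (σ : ℤ) • w.1) :
    SymbolOn a (offLattice a) ν (fun w => g (L₁ w) (L₂ w) (L₃ w)) := by
  have h1 : ∀ w, L₃ w = L₁ w + (σ : ℤ) • w.1 := fun w => by rw [← hL, add_sub_cancel]
  rcases Int.units_eq_one_or σ with rfl | rfl
  · have := hg.symbol.comp_linear (L₁.prod L₂)
    simpa [h1] using this
  · have := (hg.symbol.comp_neg fun x => neg_mem_offLattice).comp_linear (L₁.prod L₂)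
    simpa [h1] using this

theorem PeriodicSymbol.contDiff_comp (hg : PeriodicSymbol a ν g) (L₁ L₂ L₃ : Vec × Z →L[ℝ] Vec)
    (σ : ℤˣ) (hL : ∀ w, L₃ w - L₁ w = (σ : ℤ) • w.1) :
    ContDiff ℝ ∞ (fun z : Z => g (L₁ (0, z)) (L₂ (0, z)) (L₃ (0, z))) := by
  have h1 : ∀ z, L₃ (0, z) = L₁ (0, z) := fun z => by
    have := hL (0, z)
    rwa [smul_zero, sub_eq_zero] at this
  simp only [h1]
  exact ContDiff.comp (g := fun y : Vec × Vec => g y.1 y.2 y.1)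
    (f := fun z => (L₁ (0, z), L₂ (0, z))) hg.diag (by fun_prop)

end Linear

theorem PeriodicSymbol.add (hg : PeriodicSymbol a ν g) (hh : PeriodicSymbol a ν h) :
    PeriodicSymbol a ν (fun k₁ k₂ k₃ => g k₁ k₂ k₃ + h k₁ k₂ k₃) where
  periodic₁ G hG k₁ k₂ k₃ := by rw [hg.periodic₁ G hG, hh.periodic₁ G hG]
  periodic₂ G hG k₁ k₂ k₃ := by rw [hg.periodic₂ G hG, hh.periodic₂ G hG]
  periodic₃ G hG k₁ k₂ k₃ := by rw [hg.periodic₃ G hG, hh.periodic₃ G hG]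
  symbol := hg.symbol.add hh.symbol
  diag := hg.diag.add hh.diag

theorem PeriodicSymbol.const_mul (c : ℂ) (hg : PeriodicSymbol a ν g) :
    PeriodicSymbol a ν (fun k₁ k₂ k₃ => c * g k₁ k₂ k₃) where
  periodic₁ G hG k₁ k₂ k₃ := by rw [hg.periodic₁ G hG]
  periodic₂ G hG k₁ k₂ k₃ := by rw [hg.periodic₂ G hG]
  periodic₃ G hG k₁ k₂ k₃ := by rw [hg.periodic₃ G hG]
  symbol := hg.symbol.const_mul c
  diag := contDiff_const.mul hg.diag

theorem PeriodicSymbol.sub (hg : PeriodicSymbol a ν g) (hh : PeriodicSymbol a ν h) :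
    PeriodicSymbol a ν (fun k₁ k₂ k₃ => g k₁ k₂ k₃ - h k₁ k₂ k₃) := by
  simpa [sub_eq_add_neg] using hg.add (hh.const_mul (-1))

theorem PeriodicSymbol.mul (hg : PeriodicSymbol a 0 g) (hh : PeriodicSymbol a 0 h) :
    PeriodicSymbol a 0 (fun k₁ k₂ k₃ => g k₁ k₂ k₃ * h k₁ k₂ k₃) where
  periodic₁ G hG k₁ k₂ k₃ := by rw [hg.periodic₁ G hG, hh.periodic₁ G hG]
  periodic₂ G hG k₁ k₂ k₃ := by rw [hg.periodic₂ G hG, hh.periodic₂ G hG]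
  periodic₃ G hG k₁ k₂ k₃ := by rw [hg.periodic₃ G hG, hh.periodic₃ G hG]
  symbol := hg.symbol.mul hh.symbol
  diag := hg.diag.mul hh.diag

theorem PeriodicSymbol.of_contDiff
    (periodic₁ : ∀ G ∈ recipLattice a, ∀ k₁ k₂ k₃, g (k₁ + G) k₂ k₃ = g k₁ k₂ k₃)
    (periodic₂ : ∀ G ∈ recipLattice a, ∀ k₁ k₂ k₃, g k₁ (k₂ + G) k₃ = g k₁ k₂ k₃)
    (periodic₃ : ∀ G ∈ recipLattice a, ∀ k₁ k₂ k₃, g k₁ k₂ (k₃ + G) = g k₁ k₂ k₃)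
    (hg : ContDiff ℝ ∞ (fun p : Vec × Vec × Vec => g p.1 p.2.1 p.2.2)) : PeriodicSymbol a 0 g where
  periodic₁ := periodic₁
  periodic₂ := periodic₂
  periodic₃ := periodic₃
  symbol := SymbolOn.of_contDiff (ContDiff.comp (g := fun p : Vec × Vec × Vec => g p.1 p.2.1 p.2.2)
    (f := fun p : Vec × Vec × Vec => (p.2.1, p.2.2, p.2.1 + p.1)) hg (by fun_prop))
  diag := ContDiff.comp (g := fun p : Vec × Vec × Vec => g p.1 p.2.1 p.2.2)
    (f := fun p : Vec × Vec => (p.1, p.2, p.1)) hg (by fun_prop)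

theorem PeriodicSymbol.const (c : ℂ) : PeriodicSymbol a 0 (fun _ _ _ => c) :=
  .of_contDiff (fun _ _ _ _ _ => rfl) (fun _ _ _ _ _ => rfl) (fun _ _ _ _ _ => rfl) contDiff_const

theorem PeriodicSymbol.of_zero (hg : PeriodicSymbol a 0 g) (ν : ℕ) : PeriodicSymbol a ν g :=
  { hg with symbol := hg.symbol.of_le (fun _ hx => hx) (Nat.zero_le ν) }

theorem PeriodicSymbol.sum {ι : Type*} {s : Finset ι} {g : ι → Vec → Vec → Vec → ℂ}
    (hg : ∀ i ∈ s, PeriodicSymbol a ν (g i)) :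
    PeriodicSymbol a ν (fun k₁ k₂ k₃ => ∑ i ∈ s, g i k₁ k₂ k₃) where
  periodic₁ G hG _ _ _ := Finset.sum_congr rfl fun i hi => (hg i hi).periodic₁ G hG _ _ _
  periodic₂ G hG _ _ _ := Finset.sum_congr rfl fun i hi => (hg i hi).periodic₂ G hG _ _ _
  periodic₃ G hG _ _ _ := Finset.sum_congr rfl fun i hi => (hg i hi).periodic₃ G hG _ _ _
  symbol := SymbolOn.sum fun i hi => (hg i hi).symbol
  diag := ContDiff.sum fun i hi => (hg i hi).diag

theorem exists_add_mem_zone (k : Vec) : ∃ G ∈ recipLattice a, k + G ∈ zone a := by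
  obtain ⟨⟨G, hG⟩, h, -⟩ := ZSpan.exist_unique_vadd_mem_fundamentalDomain (recipBasis a) k
  refine ⟨G, hG, ?_⟩
  rw [add_comm]
  exact h

/-- A periodic symbol is bounded by `1 / d²` up to a constant, also on the lattice, where the
quotient has the value `0`. -/
theorem PeriodicSymbol.exists_norm_le (hg : PeriodicSymbol a ν g) :
    ∃ C, 0 ≤ C ∧ ∀ k₁ k₂ k₃, ‖g k₁ k₂ k₃‖ ≤ C * (1 / latDist a (k₃ - k₁) ^ ν + 1) := by
  obtain ⟨ρ, hρ⟩ := isBounded_iff_forall_norm_le.1 (isBounded_zone a)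
  obtain ⟨C, hC0, hC⟩ := hg.symbol.exists_bound_norm ρ
  obtain ⟨C', hC'⟩ := (isCompact_closedBall (0 : Vec × Vec) ρ).exists_bound_of_continuousOn
    hg.diag.continuous.continuousOn
  refine ⟨max C C', le_max_of_le_left hC0, fun k₁ k₂ k₃ => ?_⟩
  have hm : 0 ≤ max C C' := le_max_of_le_left hC0
  obtain ⟨G₁, h₁, h₁'⟩ := exists_add_mem_zone (a := a) k₁
  obtain ⟨G₂, h₂, h₂'⟩ := exists_add_mem_zone (a := a) k₂
  have hnn : 0 ≤ 1 / latDist a (k₃ - k₁) ^ ν := by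
    have := latDist_nonneg (a := a) (k₃ - k₁)
    positivity
  by_cases hk : k₃ - k₁ ∈ recipLattice a
  · rw [hg.eq_diag hk, ← hg.periodic h₁ h₂ h₁]
    refine ((hC' (k₁ + G₁, k₂ + G₂) ?_).trans (le_max_right C C')).trans ?_
    · rw [mem_closedBall_zero_iff]
      exact max_le (hρ _ h₁') (hρ _ h₂')
    · nlinarith
  · obtain ⟨G₃, h₃, h₃'⟩ := exists_add_mem_zone (a := a) (k₃ - k₁)
    have e : g k₁ k₂ k₃ = g (k₁ + G₁) (k₂ + G₂) ((k₁ + G₁) + (k₃ - k₁ + G₃)) := by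
      rw [show (k₁ + G₁) + (k₃ - k₁ + G₃) = k₃ + (G₁ + G₃) by abel,
        hg.periodic h₁ h₂ (add_mem h₁ h₃)]
    have h4 := hC (k₃ - k₁ + G₃) (fun h => hk (by simpa using sub_mem h h₃))
      (k₁ + G₁, k₂ + G₂) (hρ _ h₃') (max_le (hρ _ h₁') (hρ _ h₂'))
    rw [e]
    refine h4.trans ?_
    rw [latDist_add_of_mem h₃, div_eq_mul_one_div]
    exact mul_le_mul (le_max_left _ _) (by linarith) hnn hm

theorem PeriodicSymbol.contDiffAt (hg : PeriodicSymbol a ν g) {k₁ k₂ k₃ : Vec}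
    (hk : k₃ - k₁ ∉ recipLattice a) :
    ContDiffAt ℝ ∞ (fun p : Vec × Vec × Vec => g p.1 p.2.1 p.2.2) (k₁, k₂, k₃) := by
  have h1 : ContDiffAt ℝ ∞ (fun p : Vec × Vec × Vec => (p.2.2 - p.1, (p.1, p.2.1))) (k₁, k₂, k₃) := by
    fun_prop
  have h2 := ContDiffAt.comp (g := fun p : Vec × (Vec × Vec) => g p.2.1 p.2.2 (p.2.1 + p.1))
    (k₁, k₂, k₃) (hg.symbol.smooth (k₃ - k₁) hk (k₁, k₂)) h1
  refine h2.congr_of_eventuallyEq (Eventually.of_forall fun p => ?_)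
  simp

theorem PeriodicSymbol.measurable (hg : PeriodicSymbol a ν g) :
    Measurable (fun p : Vec × Vec × Vec => g p.1 p.2.1 p.2.2) := by
  classical
  have hop : IsOpen {p : Vec × Vec × Vec | p.2.2 - p.1 ∉ recipLattice a} :=
    (isOpen_offLattice (a := a)).preimage (by fun_prop)
  have e : (fun p : Vec × Vec × Vec => g p.1 p.2.1 p.2.2) =
      Set.piecewise {p : Vec × Vec × Vec | p.2.2 - p.1 ∉ recipLattice a}
        (fun p => g p.1 p.2.1 p.2.2) (fun p => g p.1 p.2.1 p.1) := by
    ext p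
    by_cases hp : p.2.2 - p.1 ∈ recipLattice a
    · rw [Set.piecewise_eq_of_notMem _ _ _ (by simpa using hp), hg.eq_diag hp]
    · rw [Set.piecewise_eq_of_mem _ _ _ (by simpa using hp)]
  rw [e]
  refine ContinuousOn.measurable_piecewise (fun p hp => ?_) ?_ hop.measurableSet
  · exact (hg.contDiffAt hp).continuousAt.continuousWithinAt
  · exact (Continuous.comp (g := fun y : Vec × Vec => g y.1 y.2 y.1)
      (f := fun p : Vec × Vec × Vec => (p.1, p.2.1)) hg.diag.continuous
      (by fun_prop)).continuousOn

end PeriodicSymbols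

/-! ### Substitutions and integrals of periodic symbols -/

section PeriodicSymbolIntegrals

variable {a : Module.Basis (Fin 3) ℝ Vec} {ν : ℕ} {g h h' : Vec → Vec → Vec → ℂ}
  {f P α₁ α₂ α₃ β₁ β₂ β₃ γ₁ γ₂ γ₃ : Vec → Vec → Vec → Vec → Vec}

theorem IsIntComb.exists_add (hf : IsIntComb f) {G₀ G₁ G₂ G₃ : Vec} (h₀ : G₀ ∈ recipLattice a)
    (h₁ : G₁ ∈ recipLattice a) (h₂ : G₂ ∈ recipLattice a) (h₃ : G₃ ∈ recipLattice a)
    (κ k₁ k₂ k₃ : Vec) : ∃ G ∈ recipLattice a,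
      f (κ + G₀) (k₁ + G₁) (k₂ + G₂) (k₃ + G₃) = f κ k₁ k₂ k₃ + G := by
  obtain ⟨c₀, c₁, c₂, c₃, h⟩ := hf
  refine ⟨c₀ • G₀ + c₁ • G₁ + c₂ • G₂ + c₃ • G₃, ?_, ?_⟩
  · exact add_mem (add_mem (add_mem (zsmul_mem h₀ _) (zsmul_mem h₁ _)) (zsmul_mem h₂ _))
      (zsmul_mem h₃ _)
  · rw [h, h]
    module

theorem IsIntComb.exists_clm (hf : IsIntComb f) :
    ∃ L : Vec × Vec × Vec × Vec →L[ℝ] Vec, ∀ v, L v = f v.1 v.2.1 v.2.2.1 v.2.2.2 := by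
  obtain ⟨c₀, c₁, c₂, c₃, h⟩ := hf
  refine ⟨c₀ • ContinuousLinearMap.fst ℝ Vec (Vec × Vec × Vec) +
    (c₁ • ContinuousLinearMap.fst ℝ Vec (Vec × Vec) +
    (c₂ • ContinuousLinearMap.fst ℝ Vec Vec + c₃ • ContinuousLinearMap.snd ℝ Vec Vec).comp
      (ContinuousLinearMap.snd ℝ Vec (Vec × Vec))).comp
      (ContinuousLinearMap.snd ℝ Vec (Vec × Vec × Vec)), fun v => ?_⟩
  rw [h]
  simp [add_assoc]

theorem IsIntComb.continuous (hf : IsIntComb f) (k₁ k₂ k₃ : Vec) :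
    Continuous fun κ => f κ k₁ k₂ k₃ := by
  obtain ⟨L, hL⟩ := hf.exists_clm
  have : (fun κ => f κ k₁ k₂ k₃) = fun κ => L (κ, k₁, k₂, k₃) := by ext1 κ; rw [hL]
  rw [this]
  fun_prop

theorem PeriodicSymbol.comp_periodic (hg : PeriodicSymbol a ν g) (hα₁ : IsIntComb α₁)
    (hα₂ : IsIntComb α₂) (hα₃ : IsIntComb α₃) {G₀ G₁ G₂ G₃ : Vec} (h₀ : G₀ ∈ recipLattice a)
    (h₁ : G₁ ∈ recipLattice a) (h₂ : G₂ ∈ recipLattice a) (h₃ : G₃ ∈ recipLattice a)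
    (κ k₁ k₂ k₃ : Vec) :
    g (α₁ (κ + G₀) (k₁ + G₁) (k₂ + G₂) (k₃ + G₃)) (α₂ (κ + G₀) (k₁ + G₁) (k₂ + G₂) (k₃ + G₃))
      (α₃ (κ + G₀) (k₁ + G₁) (k₂ + G₂) (k₃ + G₃)) =
    g (α₁ κ k₁ k₂ k₃) (α₂ κ k₁ k₂ k₃) (α₃ κ k₁ k₂ k₃) := by
  obtain ⟨G, hG, e⟩ := hα₁.exists_add h₀ h₁ h₂ h₃ κ k₁ k₂ k₃
  obtain ⟨G', hG', e'⟩ := hα₂.exists_add h₀ h₁ h₂ h₃ κ k₁ k₂ k₃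
  obtain ⟨G'', hG'', e''⟩ := hα₃.exists_add h₀ h₁ h₂ h₃ κ k₁ k₂ k₃
  rw [e, e', e'', hg.periodic hG hG' hG'']

/-- The linear map from the variables `(p, (x, (y₁, y₂)))` of a symbol to the variables
`(κ, k₁, k₂, k₃)`, where `k₁ = y₁`, `k₂ = y₂`, `k₃ = y₁ + x`, and where `p = ε κ + P(0, k₁, k₂, k₃)`
is solved for `κ`. -/
theorem exists_substitution (ε : ℤˣ) (hP : IsIntComb P) :
    ∃ T : Vec × (Vec × (Vec × Vec)) →L[ℝ] Vec × Vec × Vec × Vec, ∀ p x y,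
      T (p, (x, y)) = ((ε : ℤ) • (p - P 0 y.1 y.2 (y.1 + x)), y.1, y.2, y.1 + x) := by
  obtain ⟨c₀, c₁, c₂, c₃, h⟩ := hP
  refine ⟨((ε : ℤ) • (ContinuousLinearMap.fst ℝ Vec (Vec × (Vec × Vec)) -
    (c₃ • ContinuousLinearMap.fst ℝ Vec (Vec × Vec) +
    ((c₁ + c₃) • ContinuousLinearMap.fst ℝ Vec Vec + c₂ • ContinuousLinearMap.snd ℝ Vec Vec).comp
      (ContinuousLinearMap.snd ℝ Vec (Vec × Vec))).comp
      (ContinuousLinearMap.snd ℝ Vec (Vec × Vec × Vec)))).prod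
    (((ContinuousLinearMap.fst ℝ Vec Vec).comp (ContinuousLinearMap.snd ℝ Vec (Vec × Vec))).prod
    (((ContinuousLinearMap.snd ℝ Vec Vec).comp (ContinuousLinearMap.snd ℝ Vec (Vec × Vec))).prod
    ((ContinuousLinearMap.fst ℝ Vec Vec).comp (ContinuousLinearMap.snd ℝ Vec (Vec × Vec)) +
      ContinuousLinearMap.fst ℝ Vec (Vec × Vec))) |>.comp
      (ContinuousLinearMap.snd ℝ Vec (Vec × Vec × Vec))), fun p x y => ?_⟩
  rw [h]
  simp
  module

/-- Averages of periodic functions can be computed in shifted and reflected variables. -/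
theorem zoneAvg_substitution {F : Vec → ℂ}
    (hF : ∀ G ∈ recipLattice a, ∀ x, F (x + G) = F x) (ε : ℤˣ) (s : Vec) :
    zoneAvg a F = zoneAvg a fun p => F ((ε : ℤ) • (p - s)) := by
  unfold zoneAvg zone
  congr 1
  rcases Int.units_eq_one_or ε with rfl | rfl
  · rw [← setIntegral_comp_add_of_periodic (recipBasis a) hF (-s)]
    simp [sub_eq_neg_add]
  · rw [← setIntegral_comp_sub_left_of_periodic (recipBasis a) hF s]
    simp

/-- Integral substitutions that preserve the distance to the singular set `k₃ = k₁`. -/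
theorem PeriodicSymbol.comp {α₁ α₂ α₃ : Vec → Vec → Vec → Vec} (hg : PeriodicSymbol a ν g)
    (hα₁ : IsIntComb fun _ => α₁) (hα₂ : IsIntComb fun _ => α₂) (hα₃ : IsIntComb fun _ => α₃)
    (σ : ℤˣ) (hα : ∀ k₁ k₂ k₃, α₃ k₁ k₂ k₃ - α₁ k₁ k₂ k₃ = (σ : ℤ) • (k₃ - k₁)) :
    PeriodicSymbol a ν (fun k₁ k₂ k₃ => g (α₁ k₁ k₂ k₃) (α₂ k₁ k₂ k₃) (α₃ k₁ k₂ k₃)) := by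
  have hper := fun G₁ G₂ G₃ => hg.comp_periodic hα₁ hα₂ hα₃ (zero_mem _) (G₁ := G₁) (G₂ := G₂)
    (G₃ := G₃)
  obtain ⟨T, hT⟩ := exists_substitution (P := fun _ _ _ _ => 0) 1 ⟨0, 0, 0, 0, by simp⟩
  obtain ⟨L₁, hL₁⟩ := hα₁.exists_clm
  obtain ⟨L₂, hL₂⟩ := hα₂.exists_clm
  obtain ⟨L₃, hL₃⟩ := hα₃.exists_clm
  have hL : ∀ w : Vec × (Vec × Vec), (L₃.comp (T.comp (ContinuousLinearMap.inr ℝ _ _))) w -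
      (L₁.comp (T.comp (ContinuousLinearMap.inr ℝ _ _))) w = (σ : ℤ) • w.1 := fun w => by
    simp [hL₁, hL₃, hT, hα]
  refine ⟨fun G hG k₁ k₂ k₃ => ?_, fun G hG k₁ k₂ k₃ => ?_, fun G hG k₁ k₂ k₃ => ?_, ?_, ?_⟩
  · simpa using hper G 0 0 hG (zero_mem _) (zero_mem _) 0 k₁ k₂ k₃
  · simpa using hper 0 G 0 (zero_mem _) hG (zero_mem _) 0 k₁ k₂ k₃
  · simpa using hper 0 0 G (zero_mem _) (zero_mem _) hG 0 k₁ k₂ k₃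
  · have := hg.symbolOn_comp _ (L₂.comp (T.comp (ContinuousLinearMap.inr ℝ _ _))) _ σ hL
    simpa [hL₁, hL₂, hL₃, hT] using this
  · have := hg.contDiff_comp _ (L₂.comp (T.comp (ContinuousLinearMap.inr ℝ _ _))) _ σ hL
    simpa [hL₁, hL₂, hL₃, hT] using this

/-- The singularity at `ε κ + s = 0` of the first factor is integrable, and the other factors are
bounded. -/
theorem PeriodicSymbol.integrableOn_mul (hg : PeriodicSymbol a 2 g) (hh : PeriodicSymbol a 0 h)
    (hh' : PeriodicSymbol a 0 h') (hα₁ : IsIntComb α₁) (hα₂ : IsIntComb α₂) (hα₃ : IsIntComb α₃)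
    (hβ₁ : IsIntComb β₁) (hβ₂ : IsIntComb β₂) (hβ₃ : IsIntComb β₃)
    (hγ₁ : IsIntComb γ₁) (hγ₂ : IsIntComb γ₂) (hγ₃ : IsIntComb γ₃)
    (ε : ℤˣ) {k₁ k₂ k₃ s : Vec}
    (hα : ∀ κ, α₃ κ k₁ k₂ k₃ - α₁ κ k₁ k₂ k₃ = (ε : ℤ) • κ + s) :
    IntegrableOn (fun κ => g (α₁ κ k₁ k₂ k₃) (α₂ κ k₁ k₂ k₃) (α₃ κ k₁ k₂ k₃) *
      (h (β₁ κ k₁ k₂ k₃) (β₂ κ k₁ k₂ k₃) (β₃ κ k₁ k₂ k₃) *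
      h' (γ₁ κ k₁ k₂ k₃) (γ₂ κ k₁ k₂ k₃) (γ₃ κ k₁ k₂ k₃))) (zone a) := by
  obtain ⟨C, hC0, hC⟩ := hg.exists_norm_le
  obtain ⟨C', hC0', hC'⟩ := hh.exists_norm_le
  obtain ⟨C'', hC0'', hC''⟩ := hh'.exists_norm_le
  have hfin : IsFiniteMeasure (volume.restrict (ZSpan.fundamentalDomain (recipBasis a))) :=
    ⟨by rw [Measure.restrict_apply_univ]; exact (isBounded_zone a).measure_lt_top⟩
  have hper : ∀ G ∈ recipLattice a, ∀ p, 1 / latDist a (p + G) ^ 2 = 1 / latDist a p ^ 2 :=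
    fun G hG p => by rw [latDist_add_of_mem hG]
  have hd : ∀ κ, latDist a ((ε : ℤ) • κ + s) = latDist a (-((ε : ℤ) • s) - κ) := fun κ => by
    rcases Int.units_eq_one_or ε with rfl | rfl
    · rw [← latDist_neg]
      congr 1
      simp
      abel
    · congr 1
      simp
      abel
  have hint := (integrableOn_comp_sub_left_of_periodic (recipBasis a)
    (F := fun p => 1 / latDist a p ^ 2) hper (-((ε : ℤ) • s))).2 (integrableOn_one_div_latDist_sq a)
  have hint' := ((hint.add (integrable_const (1 : ℝ))).const_mul (C * ((C' * 2) * (C'' * 2))))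
  refine Integrable.mono' hint' (Measurable.aestronglyMeasurable ?_) (Eventually.of_forall
    fun κ => ?_)
  · refine Measurable.mul ?_ (Measurable.mul ?_ ?_)
    · exact hg.measurable.comp ((hα₁.continuous k₁ k₂ k₃).measurable.prodMk
        ((hα₂.continuous k₁ k₂ k₃).measurable.prodMk (hα₃.continuous k₁ k₂ k₃).measurable))
    · exact hh.measurable.comp ((hβ₁.continuous k₁ k₂ k₃).measurable.prodMk
        ((hβ₂.continuous k₁ k₂ k₃).measurable.prodMk (hβ₃.continuous k₁ k₂ k₃).measurable))
    · exact hh'.measurable.comp ((hγ₁.continuous k₁ k₂ k₃).measurable.prodMk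
        ((hγ₂.continuous k₁ k₂ k₃).measurable.prodMk (hγ₃.continuous k₁ k₂ k₃).measurable))
  · have h1 := hC (α₁ κ k₁ k₂ k₃) (α₂ κ k₁ k₂ k₃) (α₃ κ k₁ k₂ k₃)
    have h2 := hC' (β₁ κ k₁ k₂ k₃) (β₂ κ k₁ k₂ k₃) (β₃ κ k₁ k₂ k₃)
    have h3 := hC'' (γ₁ κ k₁ k₂ k₃) (γ₂ κ k₁ k₂ k₃) (γ₃ κ k₁ k₂ k₃)
    rw [hα, hd] at h1
    rw [pow_zero, div_one, one_add_one_eq_two] at h2 h3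
    rw [norm_mul, norm_mul]
    refine (mul_le_mul h1 (mul_le_mul h2 h3 (norm_nonneg _) (by positivity)) (by positivity)
      (by positivity)).trans (le_of_eq ?_)
    simp only [Pi.add_apply]
    ring

theorem PeriodicSymbol.zoneAvg_periodic {F : Vec → Vec → Vec → Vec → ℂ} {ν : ℕ}
    (hF : ∀ G₁ ∈ recipLattice a, ∀ G₂ ∈ recipLattice a, ∀ G₃ ∈ recipLattice a, ∀ κ k₁ k₂ k₃,
      F κ (k₁ + G₁) (k₂ + G₂) (k₃ + G₃) = F κ k₁ k₂ k₃)
    (hs : SymbolOn a (offLattice a) ν (fun p : Vec × (Vec × Vec) =>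
      zoneAvg a fun κ => F κ p.2.1 p.2.2 (p.2.1 + p.1)))
    (hd : ContDiff ℝ ∞ (fun y : Vec × Vec => zoneAvg a fun κ => F κ y.1 y.2 y.1)) :
    PeriodicSymbol a ν (fun k₁ k₂ k₃ => zoneAvg a fun κ => F κ k₁ k₂ k₃) where
  periodic₁ G hG k₁ k₂ k₃ := by
    congr 1; ext κ; simpa using hF G hG 0 (zero_mem _) 0 (zero_mem _) κ k₁ k₂ k₃
  periodic₂ G hG k₁ k₂ k₃ := by
    congr 1; ext κ; simpa using hF 0 (zero_mem _) G hG 0 (zero_mem _) κ k₁ k₂ k₃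
  periodic₃ G hG k₁ k₂ k₃ := by
    congr 1; ext κ; simpa using hF 0 (zero_mem _) 0 (zero_mem _) G hG κ k₁ k₂ k₃
  symbol := hs
  diag := hd

/-- If the singularities of the two factors are at `P = 0` and at `P = k₃ - k₁`, where `P` moves
with the variable of integration, then the average is a convolution of symbols. -/
theorem PeriodicSymbol.convolution (hg : PeriodicSymbol a 2 g) (hh : PeriodicSymbol a 0 h)
    (hP : IsIntComb P) (hα₁ : IsIntComb α₁) (hα₂ : IsIntComb α₂) (hα₃ : IsIntComb α₃)
    (hβ₁ : IsIntComb β₁) (hβ₂ : IsIntComb β₂) (hβ₃ : IsIntComb β₃) (ε σ τ : ℤˣ)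
    (hPε : ∀ κ k₁ k₂ k₃, P κ k₁ k₂ k₃ = (ε : ℤ) • κ + P 0 k₁ k₂ k₃)
    (hα : ∀ κ k₁ k₂ k₃, α₃ κ k₁ k₂ k₃ - α₁ κ k₁ k₂ k₃ = (σ : ℤ) • P κ k₁ k₂ k₃)
    (hβ : ∀ κ k₁ k₂ k₃, β₃ κ k₁ k₂ k₃ - β₁ κ k₁ k₂ k₃ = (τ : ℤ) • (k₃ - k₁ - P κ k₁ k₂ k₃)) :
    PeriodicSymbol a 0 (fun k₁ k₂ k₃ => zoneAvg a fun κ =>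
      g (α₁ κ k₁ k₂ k₃) (α₂ κ k₁ k₂ k₃) (α₃ κ k₁ k₂ k₃) *
      h (β₁ κ k₁ k₂ k₃) (β₂ κ k₁ k₂ k₃) (β₃ κ k₁ k₂ k₃)) := by
  obtain ⟨T, hT⟩ := exists_substitution ε hP
  obtain ⟨L₁, hL₁⟩ := hα₁.exists_clm
  obtain ⟨L₂, hL₂⟩ := hα₂.exists_clm
  obtain ⟨L₃, hL₃⟩ := hα₃.exists_clm
  obtain ⟨M₁, hM₁⟩ := hβ₁.exists_clm
  obtain ⟨M₂, hM₂⟩ := hβ₂.exists_clm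
  obtain ⟨M₃, hM₃⟩ := hβ₃.exists_clm
  have hεε : ∀ v : Vec, (ε : ℤ) • (ε : ℤ) • v = v := fun v => by
    rw [smul_smul, Int.units_coe_mul_self, one_smul]
  -- the reflection `p ↦ x - p`
  let U : Vec × (Vec × (Vec × Vec)) →L[ℝ] Vec × (Vec × (Vec × Vec)) :=
    ((ContinuousLinearMap.fst ℝ Vec (Vec × Vec)).comp (ContinuousLinearMap.snd ℝ _ _) -
      ContinuousLinearMap.fst ℝ Vec (Vec × (Vec × Vec))).prod (ContinuousLinearMap.snd ℝ _ _)
  have hU : ∀ p x y, U (p, (x, y)) = (x - p, (x, y)) := fun p x y => rfl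
  have hLL : ∀ w : Vec × (Vec × (Vec × Vec)), (L₃.comp T) w - (L₁.comp T) w = (σ : ℤ) • w.1 := by
    rintro ⟨p, x, y⟩
    rw [ContinuousLinearMap.comp_apply, ContinuousLinearMap.comp_apply, hT, hL₁, hL₃, hα, hPε, hεε,
      sub_add_cancel]
  have hMM : ∀ w : Vec × (Vec × (Vec × Vec)), (M₃.comp (T.comp U)) w - (M₁.comp (T.comp U)) w =
      (τ : ℤ) • w.1 := by
    rintro ⟨p, x, y⟩
    simp only [ContinuousLinearMap.comp_apply, hU, hT, hM₁, hM₃]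
    rw [hβ, hPε, hεε]
    congr 1
    abel
  have hA := hg.symbolOn_comp _ (L₂.comp T) _ σ hLL
  have hB := hh.symbolOn_comp _ (M₂.comp (T.comp U)) _ τ hMM
  set A : Vec × (Vec × (Vec × Vec)) → ℂ :=
    fun w => g ((L₁.comp T) w) ((L₂.comp T) w) ((L₃.comp T) w) with hAdef
  set B : Vec × (Vec × (Vec × Vec)) → ℂ := fun w =>
    h ((M₁.comp (T.comp U)) w) ((M₂.comp (T.comp U)) w) ((M₃.comp (T.comp U)) w) with hBdef
  have e1 : ∀ p G c : Vec, (ε : ℤ) • (p + G - c) = (ε : ℤ) • (p - c) + (ε : ℤ) • G :=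
    fun p G c => by module
  have pA : ∀ G ∈ recipLattice a, ∀ x z, A (x + G, z) = A (x, z) := by
    rintro G hG p ⟨x, y⟩
    have := hg.comp_periodic hα₁ hα₂ hα₃ (zsmul_mem hG ε) (zero_mem _) (zero_mem _) (zero_mem _)
      ((ε : ℤ) • (p - P 0 y.1 y.2 (y.1 + x))) y.1 y.2 (y.1 + x)
    simp only [hAdef, ContinuousLinearMap.comp_apply, hL₁, hL₂, hL₃, hT, e1]
    simpa only [add_zero] using this
  have pB : ∀ G ∈ recipLattice a, ∀ x z, B (x + G, z) = B (x, z) := by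
    rintro G hG p ⟨x, y⟩
    have e2 : x - (p + G) = x - p + -G := by abel
    have := hh.comp_periodic hβ₁ hβ₂ hβ₃ (zsmul_mem (neg_mem hG) ε) (zero_mem _) (zero_mem _)
      (zero_mem _) ((ε : ℤ) • (x - p - P 0 y.1 y.2 (y.1 + x))) y.1 y.2 (y.1 + x)
    simp only [hBdef, ContinuousLinearMap.comp_apply, hU, e2, hM₁, hM₂, hM₃, hT, e1]
    simpa only [add_zero] using this
  have hconv := (hA.convolution hB pA pB).comp_linear
    (ContinuousLinearMap.id ℝ (Vec × (Vec × Vec)))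
  have key : ∀ p : Vec × (Vec × Vec), (zoneAvg a fun κ =>
      g (α₁ κ p.2.1 p.2.2 (p.2.1 + p.1)) (α₂ κ p.2.1 p.2.2 (p.2.1 + p.1))
        (α₃ κ p.2.1 p.2.2 (p.2.1 + p.1)) *
      h (β₁ κ p.2.1 p.2.2 (p.2.1 + p.1)) (β₂ κ p.2.1 p.2.2 (p.2.1 + p.1))
        (β₃ κ p.2.1 p.2.2 (p.2.1 + p.1))) =
      (1 / (volume.real (zone a) : ℂ)) * ∫ q in zone a, A (q, p) * B (p.1 - q, p) := by
    rintro ⟨x, y⟩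
    rw [zoneAvg_substitution (fun G hG κ => ?_) ε (P 0 y.1 y.2 (y.1 + x))]
    · simp only [hAdef, hBdef, ContinuousLinearMap.comp_apply, hU, hT, hL₁, hL₂, hL₃, hM₁, hM₂,
        hM₃, sub_sub_cancel]
      rfl
    · have h1 := hg.comp_periodic hα₁ hα₂ hα₃ hG (zero_mem _) (zero_mem _) (zero_mem _) κ y.1 y.2
        (y.1 + x)
      have h2 := hh.comp_periodic hβ₁ hβ₂ hβ₃ hG (zero_mem _) (zero_mem _) (zero_mem _) κ y.1 y.2
        (y.1 + x)
      simp only [add_zero] at h1 h2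
      simp only [h1, h2]
  refine PeriodicSymbol.zoneAvg_periodic (fun G₁ h₁ G₂ h₂ G₃ h₃ κ k₁ k₂ k₃ => ?_) ?_ ?_
  · have e3 := hg.comp_periodic hα₁ hα₂ hα₃ (zero_mem _) h₁ h₂ h₃ κ k₁ k₂ k₃
    have e4 := hh.comp_periodic hβ₁ hβ₂ hβ₃ (zero_mem _) h₁ h₂ h₃ κ k₁ k₂ k₃
    simp only [add_zero] at e3 e4
    simp only [e3, e4]
  · simp only [key]
    exact hconv.const_mul _
  · have e5 : ∀ y : Vec × Vec, _ := fun y => key (0, y)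
    simp only [add_zero, zero_sub] at e5
    simp only [e5]
    refine contDiff_const.mul ?_
    have hB' := (hB.comp_neg fun x => neg_mem_offLattice)
    exact ((hA.mul hB').comp_linear
      ((ContinuousLinearMap.inr ℝ Vec (Vec × Vec)).comp (ContinuousLinearMap.snd ℝ Vec _))
      ).contDiff_integral

/-- If one factor is singular at `P = 0`, where `P` moves with the variable of integration, and the
singularity of the others at `k₃ = k₁` does not move, then the average is a symbol. -/
theorem PeriodicSymbol.average (hg : PeriodicSymbol a 2 g) (hh : PeriodicSymbol a 0 h)
    (hh' : PeriodicSymbol a 0 h')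
    (hP : IsIntComb P) (hα₁ : IsIntComb α₁) (hα₂ : IsIntComb α₂) (hα₃ : IsIntComb α₃)
    (hβ₁ : IsIntComb β₁) (hβ₂ : IsIntComb β₂) (hβ₃ : IsIntComb β₃)
    (hγ₁ : IsIntComb γ₁) (hγ₂ : IsIntComb γ₂) (hγ₃ : IsIntComb γ₃) (ε σ τ τ' : ℤˣ)
    (hPε : ∀ κ k₁ k₂ k₃, P κ k₁ k₂ k₃ = (ε : ℤ) • κ + P 0 k₁ k₂ k₃)
    (hα : ∀ κ k₁ k₂ k₃, α₃ κ k₁ k₂ k₃ - α₁ κ k₁ k₂ k₃ = (σ : ℤ) • P κ k₁ k₂ k₃)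
    (hβ : ∀ κ k₁ k₂ k₃, β₃ κ k₁ k₂ k₃ - β₁ κ k₁ k₂ k₃ = (τ : ℤ) • (k₃ - k₁))
    (hγ : ∀ κ k₁ k₂ k₃, γ₃ κ k₁ k₂ k₃ - γ₁ κ k₁ k₂ k₃ = (τ' : ℤ) • (k₃ - k₁)) :
    PeriodicSymbol a 0 (fun k₁ k₂ k₃ => zoneAvg a fun κ =>
      g (α₁ κ k₁ k₂ k₃) (α₂ κ k₁ k₂ k₃) (α₃ κ k₁ k₂ k₃) *
      (h (β₁ κ k₁ k₂ k₃) (β₂ κ k₁ k₂ k₃) (β₃ κ k₁ k₂ k₃) *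
      h' (γ₁ κ k₁ k₂ k₃) (γ₂ κ k₁ k₂ k₃) (γ₃ κ k₁ k₂ k₃))) := by
  obtain ⟨T, hT⟩ := exists_substitution ε hP
  obtain ⟨L₁, hL₁⟩ := hα₁.exists_clm
  obtain ⟨L₂, hL₂⟩ := hα₂.exists_clm
  obtain ⟨L₃, hL₃⟩ := hα₃.exists_clm
  obtain ⟨M₁, hM₁⟩ := hβ₁.exists_clm
  obtain ⟨M₂, hM₂⟩ := hβ₂.exists_clm
  obtain ⟨M₃, hM₃⟩ := hβ₃.exists_clm
  obtain ⟨N₁, hN₁⟩ := hγ₁.exists_clm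
  obtain ⟨N₂, hN₂⟩ := hγ₂.exists_clm
  obtain ⟨N₃, hN₃⟩ := hγ₃.exists_clm
  have hεε : ∀ v : Vec, (ε : ℤ) • (ε : ℤ) • v = v := fun v => by
    rw [smul_smul, Int.units_coe_mul_self, one_smul]
  -- the exchange of `p` and `x`
  let U : Vec × (Vec × (Vec × Vec)) →L[ℝ] Vec × (Vec × (Vec × Vec)) :=
    ((ContinuousLinearMap.fst ℝ Vec (Vec × Vec)).comp (ContinuousLinearMap.snd ℝ _ _)).prod
      ((ContinuousLinearMap.fst ℝ Vec (Vec × (Vec × Vec))).prod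
        ((ContinuousLinearMap.snd ℝ _ _).comp (ContinuousLinearMap.snd ℝ _ _)))
  have hU : ∀ p x y, U (p, (x, y)) = (x, (p, y)) := fun p x y => rfl
  have hLL : ∀ w : Vec × (Vec × (Vec × Vec)), (L₃.comp T) w - (L₁.comp T) w = (σ : ℤ) • w.1 := by
    rintro ⟨p, x, y⟩
    rw [ContinuousLinearMap.comp_apply, ContinuousLinearMap.comp_apply, hT, hL₁, hL₃, hα, hPε, hεε,
      sub_add_cancel]
  have hMM : ∀ w : Vec × (Vec × (Vec × Vec)), (M₃.comp (T.comp U)) w - (M₁.comp (T.comp U)) w =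
      (τ : ℤ) • w.1 := by
    rintro ⟨p, x, y⟩
    simp only [ContinuousLinearMap.comp_apply, hU, hT, hM₁, hM₃]
    rw [hβ, add_sub_cancel_left]
  have hNN : ∀ w : Vec × (Vec × (Vec × Vec)), (N₃.comp (T.comp U)) w - (N₁.comp (T.comp U)) w =
      (τ' : ℤ) • w.1 := by
    rintro ⟨p, x, y⟩
    simp only [ContinuousLinearMap.comp_apply, hU, hT, hN₁, hN₃]
    rw [hγ, add_sub_cancel_left]
  have hA := hg.symbolOn_comp _ (L₂.comp T) _ σ hLL
  have hB := (hh.symbolOn_comp _ (M₂.comp (T.comp U)) _ τ hMM).mul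
    (hh'.symbolOn_comp _ (N₂.comp (T.comp U)) _ τ' hNN)
  have hB0 := (hh.contDiff_comp _ (M₂.comp (T.comp U)) _ τ hMM).mul
    (hh'.contDiff_comp _ (N₂.comp (T.comp U)) _ τ' hNN)
  set A : Vec × (Vec × (Vec × Vec)) → ℂ :=
    fun w => g ((L₁.comp T) w) ((L₂.comp T) w) ((L₃.comp T) w) with hAdef
  set B : Vec × (Vec × (Vec × Vec)) → ℂ := fun w =>
    h ((M₁.comp (T.comp U)) w) ((M₂.comp (T.comp U)) w) ((M₃.comp (T.comp U)) w) *
    h' ((N₁.comp (T.comp U)) w) ((N₂.comp (T.comp U)) w) ((N₃.comp (T.comp U)) w) with hBdef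
  have hsym := SymbolOn.integral_mul hA hB
  have key : ∀ p : Vec × (Vec × Vec), (zoneAvg a fun κ =>
      g (α₁ κ p.2.1 p.2.2 (p.2.1 + p.1)) (α₂ κ p.2.1 p.2.2 (p.2.1 + p.1))
        (α₃ κ p.2.1 p.2.2 (p.2.1 + p.1)) *
      (h (β₁ κ p.2.1 p.2.2 (p.2.1 + p.1)) (β₂ κ p.2.1 p.2.2 (p.2.1 + p.1))
        (β₃ κ p.2.1 p.2.2 (p.2.1 + p.1)) *
      h' (γ₁ κ p.2.1 p.2.2 (p.2.1 + p.1)) (γ₂ κ p.2.1 p.2.2 (p.2.1 + p.1))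
        (γ₃ κ p.2.1 p.2.2 (p.2.1 + p.1)))) =
      (1 / (volume.real (zone a) : ℂ)) * ∫ q in zone a, A (q, (p.1, p.2)) * B (p.1, (q, p.2)) := by
    rintro ⟨x, y⟩
    rw [zoneAvg_substitution (fun G hG κ => ?_) ε (P 0 y.1 y.2 (y.1 + x))]
    · simp only [hAdef, hBdef, ContinuousLinearMap.comp_apply, hU, hT, hL₁, hL₂, hL₃, hM₁, hM₂,
        hM₃, hN₁, hN₂, hN₃]
      rfl
    · have h1 := hg.comp_periodic hα₁ hα₂ hα₃ hG (zero_mem _) (zero_mem _) (zero_mem _) κ y.1 y.2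
        (y.1 + x)
      have h2 := hh.comp_periodic hβ₁ hβ₂ hβ₃ hG (zero_mem _) (zero_mem _) (zero_mem _) κ y.1 y.2
        (y.1 + x)
      have h3 := hh'.comp_periodic hγ₁ hγ₂ hγ₃ hG (zero_mem _) (zero_mem _) (zero_mem _) κ y.1 y.2
        (y.1 + x)
      simp only [add_zero] at h1 h2 h3
      simp only [h1, h2, h3]
  refine PeriodicSymbol.zoneAvg_periodic (fun G₁ h₁ G₂ h₂ G₃ h₃ κ k₁ k₂ k₃ => ?_) ?_ ?_
  · have e3 := hg.comp_periodic hα₁ hα₂ hα₃ (zero_mem _) h₁ h₂ h₃ κ k₁ k₂ k₃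
    have e4 := hh.comp_periodic hβ₁ hβ₂ hβ₃ (zero_mem _) h₁ h₂ h₃ κ k₁ k₂ k₃
    have e5 := hh'.comp_periodic hγ₁ hγ₂ hγ₃ (zero_mem _) h₁ h₂ h₃ κ k₁ k₂ k₃
    simp only [add_zero] at e3 e4 e5
    simp only [e3, e4, e5]
  · simp only [key]
    exact hsym.const_mul _
  · have e5 : ∀ y : Vec × Vec, _ := fun y => key (0, y)
    simp only [add_zero] at e5
    simp only [e5]
    refine contDiff_const.mul ?_
    have hA' := hA.comp_linear
      ((ContinuousLinearMap.inr ℝ Vec (Vec × Vec)).comp (ContinuousLinearMap.snd ℝ Vec _))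
    exact (hA'.mul (SymbolOn.of_contDiff (S := offLattice a) hB0)).contDiff_integral

end PeriodicSymbolIntegrals

/-! ### The function space `𝕋(Ω*)` as a space of periodic symbols -/

section FunctionSpace

variable {a : Module.Basis (Fin 3) ℝ Vec} {f : Vec → Vec → Vec → ℂ}

/-- The mixed partial derivatives control the total derivative after the dilation by `‖q‖`, and
periodicity extends the bounds from `q` near `0` to all `q`. -/
theorem MemT.periodicSymbol (hf : MemT a f) : PeriodicSymbol a 0 f := by
  refine ⟨hf.periodic_i, hf.periodic_j, hf.periodic_a, ?_, hf.smooth_diag⟩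
  obtain ⟨δ, hδ, hsm, hbd⟩ := hf.singular.singular
  simp only [sub_zero] at hsm hbd
  obtain ⟨r, hr0, hr⟩ := exists_latticeGap a
  choose C hC using hbd
  refine SymbolOn.of_near_zero (r := min δ r) (lt_min hδ hr0) ⟨?_, fun R n => ?_⟩ ?_ ?_
  · exact fun x hx z => hsm x z hx.1 (hx.2.trans_le (min_le_left _ _))
  · refine ⟨2 ^ n * ∑ m ∈ Finset.range (n + 1), |C m (n - m)|, fun x hx z _ _ => ?_⟩
    have hx1 : ‖x‖ < δ := hx.2.trans_le (min_le_left _ _)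
    have hx0 : 0 < ‖x‖ := hx.1
    have hsmn := (hsm x z hx.1 hx1).of_infty n
    rw [latDist_eq_norm hr (hx.2.trans_le (min_le_right _ _)), pow_zero, div_one,
      iteratedFDeriv_comp_affine (f := fun p : Vec × (Vec × Vec) => f p.2.1 p.2.2 (p.2.1 + p.1))
        (x, z) _ (by simpa using hsmn)]
    refine ContinuousMultilinearMap.opNorm_le_bound (by positivity) fun w => ?_
    rw [ContinuousMultilinearMap.compContinuousLinearMap_apply, map_zero, add_zero]
    refine norm_iteratedFDeriv_apply_le_of_partial hsmn (fun m l hml => ?_) hx0.le w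
    have h1 := hC m l x z hx0 hx1
    rw [zero_sub, Real.rpow_neg hx0.le, Real.rpow_natCast] at h1
    calc _ ≤ (C m l * (‖x‖ ^ m)⁻¹) * ‖x‖ ^ m := by gcongr
      _ = C m l := by field_simp
      _ ≤ |C m l| := le_abs_self _
      _ = |C m (n - m)| := by rw [← hml, Nat.add_sub_cancel_left]
      _ ≤ _ := Finset.single_le_sum (f := fun m => |C m (n - m)|)
        (fun _ _ => abs_nonneg _) (Finset.mem_range.2 (by omega))
  · intro x hx z
    exact ContDiffAt.comp (g := fun p : Vec × Vec × Vec => f p.1 p.2.1 p.2.2)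
      (f := fun p : Vec × (Vec × Vec) => (p.2.1, p.2.2, p.2.1 + p.1)) (x, z)
      (hf.smooth _ _ _ (by simpa using hx)) (by fun_prop)
  · intro G hG x z
    rw [← add_assoc, hf.periodic_a G hG]

/-- The mixed partial derivatives are components of the total derivative; the bounds are uniform in
`(k_i, k_j)` by periodicity. -/
theorem PeriodicSymbol.memT (hf : PeriodicSymbol a 0 f) : MemT a f where
  periodic_i := hf.periodic₁
  periodic_j := hf.periodic₂
  periodic_a := hf.periodic₃
  smooth _ _ _ h := hf.contDiffAt h
  smooth_diag := hf.diag
  singular := by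
    refine ⟨fun x => ?_, ?_⟩
    · by_cases hx : x ∈ recipLattice a
      · simp only [hf.periodic₃ x hx]
        exact hf.diag
      · refine contDiff_iff_contDiffAt.2 fun z => ?_
        exact ContDiffAt.comp (g := fun p : Vec × (Vec × Vec) => f p.2.1 p.2.2 (p.2.1 + p.1))
          (f := fun z => (x, z)) z (hf.symbol.smooth x hx z) (by fun_prop)
    · obtain ⟨r, hr0, hr⟩ := exists_latticeGap a
      have hoff : ∀ x : Vec, 0 < ‖x‖ → ‖x‖ < r → x ∈ offLattice a := fun x hx hxr h =>
        (norm_pos_iff.1 hx) (hr x h (by linarith))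
      refine ⟨r, hr0, ?_, fun m l => ?_⟩
      · simp only [sub_zero]
        exact fun x z hx hxr => hf.symbol.smooth x (hoff x hx hxr) z
      · obtain ⟨ρ, hρ⟩ := isBounded_iff_forall_norm_le.1 (isBounded_zone a)
        obtain ⟨C, hC0, hC⟩ := hf.symbol.exists_bound (max r ρ) (m + l)
        refine ⟨C, fun x z hx hxr => ?_⟩
        simp only [sub_zero] at hx hxr ⊢
        set F : Vec × (Vec × Vec) → ℂ := fun p => f p.2.1 p.2.2 (p.2.1 + p.1) with hF
        have hsm := (hf.symbol.smooth x (hoff x hx hxr) z).of_infty (m + l)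
        have hr' : 0 ≤ ‖x‖ ^ (0 - (m : ℝ)) := by positivity
        -- the constant does not depend on `z`, which can be moved to the Brillouin zone
        have hD : ‖iteratedFDeriv ℝ (m + l) (fun w => F ((x, z) + scaleMap _ ‖x‖ w)) 0‖ ≤ C := by
          obtain ⟨G₁, h₁, h₁'⟩ := exists_add_mem_zone (a := a) z.1
          obtain ⟨G₂, h₂, h₂'⟩ := exists_add_mem_zone (a := a) z.2
          have h := hC x (hoff x hx hxr) (z.1 + G₁, z.2 + G₂) (hxr.le.trans (le_max_left _ _))
            ((max_le (hρ _ h₁') (hρ _ h₂')).trans (le_max_right _ _))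
          rw [latDist_eq_norm hr hxr, pow_zero, div_one] at h
          convert h using 4 with w
          simp only [hF, Prod.fst_add, Prod.snd_add, scaleMap_apply]
          rw [← hf.periodic h₁ h₂ h₁]
          congr 1 <;> abel
        rw [iteratedFDeriv_comp_affine (f := F) (x, z) _ (by simpa using hsm)] at hD
        change ‖iteratedFDeriv ℝ m (fun x' => iteratedFDeriv ℝ l (fun y' => F (x', y')) z) x‖ ≤ _
        have hpa := fun u v => iteratedFDeriv_partial_apply (f := F) hsm u v
        generalize iteratedFDeriv ℝ m (fun x' => iteratedFDeriv ℝ l (fun y' => F (x', y')) z) x = D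
          at hpa ⊢
        refine ContinuousMultilinearMap.opNorm_le_bound (mul_nonneg hC0 hr') fun u => ?_
        refine ContinuousMultilinearMap.opNorm_le_bound (mul_nonneg (mul_nonneg hC0 hr')
          (Finset.prod_nonneg fun _ _ => norm_nonneg _)) fun v => ?_
        rw [hpa]
        -- undoing the dilation in `m` directions gives the factor `‖x‖ ^ (-m)`
        have happ : (Fin.append (fun i => (u i, (0 : Vec × Vec))) (fun j => ((0 : Vec), v j))) =
            fun i => scaleMap _ ‖x‖ (Fin.append (fun i => (‖x‖⁻¹ • u i, (0 : Vec × Vec)))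
              (fun j => ((0 : Vec), v j)) i) := by
          ext1 i
          refine Fin.addCases (fun i => ?_) (fun j => ?_) i
          · simp [smul_smul, mul_inv_cancel₀ hx.ne']
          · simp
        clear hpa
        have h5 := ContinuousMultilinearMap.le_of_opNorm_le (C := C)
          (m := Fin.append (fun i => (‖x‖⁻¹ • u i, (0 : Vec × Vec))) (fun j => ((0 : Vec), v j))) hD
        rw [ContinuousMultilinearMap.compContinuousLinearMap_apply, ← happ, map_zero, add_zero] at h5
        refine h5.trans (le_of_eq ?_)
        rw [Fin.prod_univ_add]
        simp only [Fin.append_left, Fin.append_right, Prod.norm_mk, norm_zero, norm_smul, norm_inv,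
          norm_norm]
        have e1 : ∀ i, max (‖x‖⁻¹ * ‖u i‖) 0 = ‖x‖⁻¹ * ‖u i‖ := fun i =>
          max_eq_left (by positivity)
        have e2 : ∀ j, max 0 ‖v j‖ = ‖v j‖ := fun j => max_eq_right (norm_nonneg _)
        simp only [e1, e2, Finset.prod_mul_distrib, Finset.prod_const, Finset.card_univ,
          Fintype.card_fin]
        rw [zero_sub, Real.rpow_neg hx.le, Real.rpow_natCast, inv_pow]
        ring

end FunctionSpace

/-! ### Smooth functions with values in a space of continuous functions -/

section ContinuousMapValued

variable {X K : Type} [NormedAddCommGroup X] [NormedSpace ℝ X] [TopologicalSpace K]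
  [CompactSpace K]

/-- The continuous functions with values in a normed space, with the topology of the norm. -/
abbrev NormedC (K F : Type) [TopologicalSpace K] [NormedAddCommGroup F] : Type := C(K, F)

/-- Evaluation of a continuous family of linear maps at a vector. -/
def evalFamily (X K F : Type) [NormedAddCommGroup X] [NormedSpace ℝ X] [TopologicalSpace K]
    [CompactSpace K] [NormedAddCommGroup F] [NormedSpace ℝ F] :
    NormedC K (X →L[ℝ] F) →L[ℝ] X →L[ℝ] NormedC K F :=
  LinearMap.mkContinuous₂ (LinearMap.mk₂ ℝ
    (fun (Φ : NormedC K (X →L[ℝ] F)) (v : X) => (⟨fun r => Φ r v, by fun_prop⟩ : NormedC K F))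
    (fun _ _ _ => rfl) (fun _ _ _ => rfl)
    (fun Φ v w => by ext r; exact map_add (Φ r) v w)
    (fun c Φ v => by ext r; exact map_smul (Φ r) c v)) 1 (fun Φ v => by
      refine (ContinuousMap.norm_le _ (by positivity)).2 fun r => ?_
      rw [one_mul]
      exact (Φ r).le_of_opNorm_le (Φ.norm_coe_le_norm r) v)

/-- A function into `C(K, F)` is smooth if all derivatives of its values exist and are jointly
continuous. -/
theorem contDiffOn_continuousMap {F : Type} [NormedAddCommGroup F] [NormedSpace ℝ F] {U : Set X}
    (hU : IsOpen U) {Φ : X → NormedC K F} (hΦ : ∀ r, ContDiffOn ℝ ∞ (fun x => Φ x r) U)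
    (hc : ∀ m : ℕ, ContinuousOn
      (fun p : X × K => iteratedFDeriv ℝ m (fun x => Φ x p.2) p.1) (U ×ˢ univ)) (n : ℕ) :
    ContDiffOn ℝ n Φ U := by
  induction n generalizing F with
  | zero =>
    rw [Nat.cast_zero, contDiffOn_zero, continuousOn_iff_continuous_domRestrict]
    refine ContinuousMap.continuous_of_continuous_uncurry _ ?_
    have h0 := hc 0
    have h1 : ContinuousOn (fun p : X × K => Φ p.1 p.2) (U ×ˢ univ) := by
      have := (continuousMultilinearCurryFin0 ℝ X F).continuous.comp_continuousOn h0
      refine this.congr fun p _ => ?_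
      simp
    exact h1.comp_continuous (f := fun p : U × K => ((p.1 : X), p.2)) (by fun_prop)
      fun p => ⟨p.1.2, mem_univ _⟩
  | succ n ih =>
    have hfd : ContinuousOn (fun p : X × K => fderiv ℝ (fun x => Φ x p.2) p.1) (U ×ˢ univ) := by
      have := (continuousMultilinearCurryFin1 ℝ X F).continuous.comp_continuousOn (hc 1)
      refine this.congr fun p _ => ?_
      ext v
      simp [iteratedFDeriv_one_apply]
    classical
    -- the candidate for the derivative, as a continuous family of linear maps
    let Φ' : X → NormedC K (X →L[ℝ] F) := fun x => if hx : x ∈ U then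
      ⟨fun r => fderiv ℝ (fun x => Φ x r) x, hfd.comp_continuous (f := fun r => (x, r))
        (by fun_prop) fun r => ⟨hx, mem_univ _⟩⟩ else 0
    have hΦ' : ∀ x ∈ U, ∀ r, Φ' x r = fderiv ℝ (fun x => Φ x r) x := fun x hx r => by
      simp [Φ', hx]
    have hev : ∀ x ∈ U, ∀ r, (fun x => Φ' x r) =ᶠ[𝓝 x] fderiv ℝ (fun x => Φ x r) := fun x hx r => by
      filter_upwards [hU.mem_nhds hx] with y hy using hΦ' y hy r
    have ih' := ih (Φ := Φ') (fun r => by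
      refine ((contDiffOn_infty_iff_fderiv_of_isOpen hU).1 (hΦ r)).2.congr fun x hx => ?_
      exact hΦ' x hx r) (fun m => by
      have h2 := (continuousMultilinearCurryRightEquiv' ℝ m X F).symm.symm.continuous.comp_continuousOn
        (hc (m + 1))
      refine h2.congr fun p hp => ?_
      rw [iteratedFDeriv_congr (hev p.1 hp.1 p.2)]
      simp only [Function.comp_apply, iteratedFDeriv_succ_eq_comp_right]
      rw [LinearIsometryEquiv.symm_symm]
      exact ((continuousMultilinearCurryRightEquiv' ℝ m X F).apply_symm_apply _).symm)
    have hder : ∀ x ∈ U, HasFDerivAt Φ (evalFamily X K F (Φ' x)) x := fun x hx => by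
      rw [hasFDerivAt_iff_isLittleO, Asymptotics.isLittleO_iff]
      intro ε hε
      have hcont : ContinuousAt Φ' x := (ih'.continuousOn).continuousAt (hU.mem_nhds hx)
      obtain ⟨δ, hδ, hball⟩ := Metric.mem_nhds_iff.1
        (inter_mem (hU.mem_nhds hx) (hcont.preimage_mem_nhds (Metric.closedBall_mem_nhds (Φ' x) hε)))
      filter_upwards [Metric.ball_mem_nhds x hδ] with y hy
      refine (ContinuousMap.norm_le _ (by positivity)).2 fun r => ?_
      -- the mean value inequality for each `r`, where continuity of `Φ'` gives a bound uniform in `r`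
      have hmv := (convex_ball x δ).norm_image_sub_le_of_norm_hasFDerivWithin_le'
        (f := fun x => Φ x r) (f' := fun z => fderiv ℝ (fun x => Φ x r) z) (φ := Φ' x r) (C := ε)
        (fun z hz => ((((hΦ r).contDiffAt (hU.mem_nhds (hball hz).1)).differentiableAt
          (by simp)).hasFDerivAt).hasFDerivWithinAt) (fun z hz => ?_)
        (Metric.mem_ball_self hδ) hy
      · exact hmv
      · have h3 : ‖Φ' z - Φ' x‖ ≤ ε := by
          rw [← dist_eq_norm]
          exact (hball hz).2
        rw [← hΦ' z (hball hz).1]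
        exact ((Φ' z - Φ' x).norm_coe_le_norm r).trans h3
    rw [Nat.cast_succ, contDiffOn_succ_iff_fderiv_of_isOpen hU]
    refine ⟨fun x hx => (hder x hx).differentiableAt.differentiableWithinAt,
      fun h => absurd h (by simp), ?_⟩
    have hcomp : ContDiffOn ℝ n (fun x => evalFamily X K F (Φ' x)) U :=
      ContDiff.comp_contDiffOn (g := fun Ψ => evalFamily X K F Ψ) (evalFamily X K F).contDiff ih'
    exact hcomp.congr fun x hx => (hder x hx).fderiv

end ContinuousMapValued

/-! ### Fourier coefficients on the unit cell -/

section Fourier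

/-- The square summable sequence of the coefficients of a vector with respect to an orthonormal
family. -/
def coefficients {E : Type} {ι : Type} [NormedAddCommGroup E] [InnerProductSpace ℂ E] {v : ι → E}
    (hv : Orthonormal ℂ v) : E →L[ℂ] lp (fun _ : ι => ℂ) 2 :=
  LinearMap.mkContinuous
    { toFun := fun x => ⟨fun i => inner ℂ (v i) x, memℓp_gen (by
        simpa using hv.inner_products_summable x)⟩
      map_add' := fun x y => by ext i; exact inner_add_right _ _ _
      map_smul' := fun c x => by ext i; exact inner_smul_right _ _ _ } 1 (fun x => by
    rw [one_mul]
    refine lp.norm_le_of_tsum_le (by simp) (norm_nonneg _) ?_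
    simpa using hv.tsum_inner_products_le (x := x))

/-- The multiplication of square summable sequences by the values of a continuous function at a
family of points. -/
def diagonalMul (ι Y : Type) [TopologicalSpace Y] [CompactSpace Y] (y : ι → Y) :
    C(Y, ℂ) →L[ℝ] lp (fun _ : ι => ℂ) 2 →L[ℝ] lp (fun _ : ι => ℂ) 2 :=
  LinearMap.mkContinuous₂ (LinearMap.mk₂ ℝ
    (fun (m : C(Y, ℂ)) (u : lp (fun _ : ι => ℂ) 2) =>
      (⟨fun i => m (y i) * u i, ((lp.memℓp u).const_smul (‖m‖ : ℂ)).mono' fun i => by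
        rw [Pi.smul_apply, norm_smul, norm_mul]
        gcongr
        simpa using m.norm_coe_le_norm (y i)⟩ : lp (fun _ : ι => ℂ) 2))
    (fun m m' u => by ext i; exact add_mul _ _ _)
    (fun c m u => by ext i; exact smul_mul_assoc c (m (y i)) (u i))
    (fun m u u' => by ext i; exact mul_add _ _ _)
    (fun c m u => by ext i; exact mul_smul_comm c (m (y i)) (u i))) 1 (fun m u => by
      rw [one_mul]
      calc _ ≤ ‖((‖m‖ : ℂ) • u : lp (fun _ : ι => ℂ) 2)‖ := by
            refine lp.norm_mono two_ne_zero fun i => ?_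
            rw [lp.coeFn_smul, Pi.smul_apply, norm_smul]
            refine (norm_mul_le _ _).trans ?_
            gcongr
            simpa using m.norm_coe_le_norm (y i)
        _ = _ := by rw [norm_smul]; simp)

theorem diagonalMul_apply {ι Y : Type} [TopologicalSpace Y] [CompactSpace Y] (y : ι → Y)
    (m : C(Y, ℂ)) (u : lp (fun _ : ι => ℂ) 2) (i : ι) :
    diagonalMul ι Y y m u i = m (y i) * u i := rfl

variable (a : Module.Basis (Fin 3) ℝ Vec)

/-- The closure of the unit cell. -/
def closedCell : Set Vec := closure (cell a)

theorem measurableSet_closedCell : MeasurableSet (closedCell a) := isClosed_closure.measurableSet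

instance : CompactSpace (closedCell a) :=
  isCompact_iff_compactSpace.1 (ZSpan.fundamentalDomain_isBounded a).isCompact_closure

/-- The Lebesgue measure on the unit cell, as a measure on its closure. -/
def cellMeasure : Measure (closedCell a) := Measure.comap Subtype.val (volume.restrict (cell a))

theorem integral_cellMeasure (f : Vec → ℂ) :
    ∫ r : closedCell a, f r ∂(cellMeasure a) = ∫ r in cell a, f r := by
  rw [cellMeasure, integral_subtype_comap (measurableSet_closedCell a),
    Measure.restrict_restrict (measurableSet_closedCell a),
    inter_eq_right.2 (show cell a ⊆ closedCell a from subset_closure)]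

theorem measureReal_cell_pos : 0 < volume.real (cell a) :=
  ENNReal.toReal_pos (ZSpan.measure_fundamentalDomain_ne_zero a)
    (ZSpan.fundamentalDomain_isBounded a).measure_lt_top.ne

instance : IsFiniteMeasure (cellMeasure a) := by
  refine ⟨?_⟩
  rw [cellMeasure, (MeasurableEmbedding.subtype_coe (measurableSet_closedCell a)).comap_apply]
  exact (measure_mono (subset_univ _)).trans_lt (by
    rw [Measure.restrict_apply_univ]
    exact (ZSpan.fundamentalDomain_isBounded a).measure_lt_top)

/-- The plane wave `e^{iQ·r}` on the unit cell. -/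
def planeWave (Q : Vec) : C(closedCell a, ℂ) :=
  ⟨fun r => Complex.exp (Complex.I * (inner ℝ Q (r : Vec) : ℝ)), by fun_prop⟩

variable {a}

theorem exists_inner_eq {G R : Vec} (hG : G ∈ recipLattice a) (hR : R ∈ lattice a) :
    ∃ n : ℤ, (inner ℝ G R : ℝ) = 2 * Real.pi * n := by
  refine Submodule.span_induction (p := fun G _ => ∃ n : ℤ, (inner ℝ G R : ℝ) = 2 * Real.pi * n)
    ?_ ⟨0, by simp⟩ ?_ ?_ hG
  · rintro _ ⟨i, rfl⟩
    refine Submodule.span_induction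
      (p := fun R _ => ∃ n : ℤ, (inner ℝ (recipBasis a i) R : ℝ) = 2 * Real.pi * n)
      ?_ ⟨0, by simp⟩ ?_ ?_ hR
    · rintro _ ⟨j, rfl⟩
      refine ⟨if i = j then 1 else 0, ?_⟩
      rw [inner_recipBasis]
      split_ifs <;> simp
    · rintro x y _ _ ⟨n, hn⟩ ⟨m, hm⟩
      exact ⟨n + m, by rw [inner_add_right, hn, hm]; push_cast; ring⟩
    · rintro c x _ ⟨n, hn⟩
      exact ⟨c * n, by
        rw [← Int.cast_smul_eq_zsmul ℝ, inner_smul_right, hn]; push_cast; ring⟩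
  · rintro x y _ _ ⟨n, hn⟩ ⟨m, hm⟩
    exact ⟨n + m, by rw [inner_add_left, hn, hm]; push_cast; ring⟩
  · rintro c x _ ⟨n, hn⟩
    exact ⟨c * n, by
      rw [← Int.cast_smul_eq_zsmul ℝ, real_inner_smul_left, hn]; push_cast; ring⟩

/-- Plane waves with a nonzero reciprocal lattice vector have mean zero: a translation multiplies
the integral by a phase. -/
theorem integral_planeWave {G : Vec} (hG : G ∈ recipLattice a) (hG0 : G ≠ 0) :
    ∫ r in cell a, Complex.exp (Complex.I * (inner ℝ G r : ℝ)) = 0 := by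
  have hper : ∀ R ∈ Submodule.span ℤ (Set.range a), ∀ r,
      Complex.exp (Complex.I * (inner ℝ G (r + R) : ℝ)) =
        Complex.exp (Complex.I * (inner ℝ G r : ℝ)) := fun R hR r => by
    obtain ⟨n, hn⟩ := exists_inner_eq hG hR
    rw [inner_add_right, hn, Complex.exp_eq_exp_iff_exists_int]
    exact ⟨n, by push_cast; ring⟩
  have hG' : (‖G‖ ^ 2 : ℝ) ≠ 0 := by positivity
  -- half a wavelength in the direction of `G`
  have h1 := setIntegral_comp_add_of_periodic a
    (F := fun r => Complex.exp (Complex.I * (inner ℝ G r : ℝ))) hper ((Real.pi / ‖G‖ ^ 2) • G)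
  have h2 : ∀ r, Complex.exp (Complex.I * (inner ℝ G ((Real.pi / ‖G‖ ^ 2) • G + r) : ℝ)) =
      -Complex.exp (Complex.I * (inner ℝ G r : ℝ)) := fun r => by
    rw [inner_add_right, real_inner_smul_right, real_inner_self_eq_norm_sq, div_mul_cancel₀ _ hG',
      Complex.ofReal_add, mul_add, Complex.exp_add, mul_comm Complex.I, Complex.exp_pi_mul_I]
    ring
  simp only [h2, integral_neg] at h1
  exact self_eq_neg.1 h1.symm

theorem conj_planeWave (Q r : Vec) : conj (Complex.exp (Complex.I * (inner ℝ Q r : ℝ))) =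
    Complex.exp (Complex.I * (inner ℝ (-Q) r : ℝ)) := by
  rw [← Complex.exp_conj]
  simp

variable (a) in
/-- The normalized plane waves. -/
def normalizedWave (G : recipLattice a) : Lp ℂ 2 (cellMeasure a) :=
  ((1 / Real.sqrt (volume.real (cell a)) : ℝ) : ℂ) •
    ContinuousMap.toLp 2 (cellMeasure a) ℂ (planeWave a G)

theorem inner_normalizedWave (G : recipLattice a) (f : C(closedCell a, ℂ)) :
    inner ℂ (normalizedWave a G) (ContinuousMap.toLp 2 (cellMeasure a) ℂ f) =
      ((1 / Real.sqrt (volume.real (cell a)) : ℝ) : ℂ) *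
        ∫ r, f r * conj (planeWave a G r) ∂(cellMeasure a) := by
  rw [normalizedWave, inner_smul_left, Complex.conj_ofReal, ContinuousMap.inner_toLp]

theorem orthonormal_normalizedWave : Orthonormal ℂ (normalizedWave a) := by
  classical
  refine orthonormal_iff_ite.2 fun G G' => ?_
  rw [normalizedWave.eq_def a G', inner_smul_right, inner_normalizedWave]
  have h1 : ∀ r : closedCell a, planeWave a G' r * conj (planeWave a G r) =
      Complex.exp (Complex.I * (inner ℝ ((G' : Vec) - G) (r : Vec) : ℝ)) := fun r => by
    change Complex.exp _ * conj (Complex.exp _) = _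
    rw [conj_planeWave, ← Complex.exp_add, ← mul_add, ← Complex.ofReal_add, ← inner_add_left,
      sub_eq_add_neg]
  simp only [h1]
  rw [integral_cellMeasure a fun r => Complex.exp (Complex.I * (inner ℝ ((G' : Vec) - G) r : ℝ))]
  split_ifs with h
  · subst h
    have hs : Real.sqrt (volume.real (cell a)) ^ 2 = volume.real (cell a) :=
      Real.sq_sqrt (measureReal_cell_pos a).le
    have hs0 : Real.sqrt (volume.real (cell a)) ≠ 0 :=
      (Real.sqrt_pos.2 (measureReal_cell_pos a)).ne'
    simp only [sub_self, inner_zero_left, Complex.ofReal_zero, mul_zero, Complex.exp_zero,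
      integral_const, measureReal_restrict_apply_univ, Complex.real_smul, mul_one]
    rw [← Complex.ofReal_mul, ← Complex.ofReal_mul]
    have : 1 / √(volume.real (cell a)) * (1 / √(volume.real (cell a)) * volume.real (cell a)) = 1 := by
      field_simp
      exact hs.symm
    rw [this, Complex.ofReal_one]
  · rw [integral_planeWave (sub_mem G'.2 G.2) (fun h' => h (Subtype.ext (sub_eq_zero.1 h').symm)),
      mul_zero, mul_zero]

variable (a) in
/-- The Fourier coefficients of a continuous function on the unit cell. -/
def fourier : C(closedCell a, ℂ) →L[ℂ] lp (fun _ : recipLattice a => ℂ) 2 :=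
  (coefficients (orthonormal_normalizedWave (a := a))).comp
    (ContinuousMap.toLp 2 (cellMeasure a) ℂ)

theorem fourier_apply (f : C(closedCell a, ℂ)) (G : recipLattice a) :
    fourier a f G = ((1 / Real.sqrt (volume.real (cell a)) : ℝ) : ℂ) *
      ∫ r, f r * conj (planeWave a G r) ∂(cellMeasure a) := inner_normalizedWave G f

end Fourier

/-! ### Smoothness of the lattice sum with the singular terms removed -/

section LatticeSum

variable {X K E F : Type} [NormedAddCommGroup X] [NormedSpace ℝ X] [TopologicalSpace K]
  [CompactSpace K] [NormedAddCommGroup E] [NormedSpace ℝ E] [NormedAddCommGroup F]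
  [NormedSpace ℝ F]

/-- A jointly smooth function gives a smooth map into the continuous functions of the second
variable. -/
theorem exists_contDiffOn_continuousMap {U : Set X} (hU : IsOpen U) {f : X × E → F} {j : K → E}
    (hj : Continuous j) (hf : ∀ x ∈ U, ∀ r, ContDiffAt ℝ ∞ f (x, j r)) :
    ∃ Φ : X → NormedC K F, (∀ x ∈ U, ∀ r, Φ x r = f (x, j r)) ∧ ∀ n : ℕ, ContDiffOn ℝ n Φ U := by
  classical
  let Φ : X → NormedC K F := fun x => if hx : x ∈ U then
    ⟨fun r => f (x, j r), continuous_iff_continuousAt.2 fun r =>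
      ContinuousAt.comp (f := fun r => (x, j r)) (hf x hx r).continuousAt (by fun_prop)⟩ else 0
  have hΦ : ∀ x ∈ U, ∀ r, Φ x r = f (x, j r) := fun x hx r => by simp [Φ, hx]
  have hev : ∀ x ∈ U, ∀ r, (fun x => Φ x r) =ᶠ[𝓝 x] fun x => f (x, j r) := fun x hx r => by
    filter_upwards [hU.mem_nhds hx] with y hy using hΦ y hy r
  have hcomp : ∀ x ∈ U, ∀ r, ContDiffAt ℝ ∞ (fun x => f (x, j r)) x := fun x hx r =>
    ContDiffAt.comp (f := fun x => (x, j r)) x (hf x hx r) (by fun_prop)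
  refine ⟨Φ, hΦ, contDiffOn_continuousMap hU (fun r x hx =>
    ((hcomp x hx r).congr_of_eventuallyEq (hev x hx r)).contDiffWithinAt) fun m p hp => ?_⟩
  refine ContinuousAt.continuousWithinAt ?_
  have e : (fun p : X × K => iteratedFDeriv ℝ m (fun x => Φ x p.2) p.1) =ᶠ[𝓝 p] fun p =>
      ContinuousMultilinearMap.compContinuousLinearMapL (𝕜 := ℝ) (F := F)
        (fun _ : Fin m => ContinuousLinearMap.inl ℝ X E) (iteratedFDeriv ℝ m f (p.1, j p.2)) := by
    filter_upwards [(hU.preimage continuous_fst).mem_nhds (show p ∈ Prod.fst ⁻¹' U from hp.1)]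
      with q hq
    rw [iteratedFDeriv_congr (hev q.1 hq q.2)]
    have h1 := iteratedFDeriv_comp_affine (f := f) (0, j q.2) (ContinuousLinearMap.inl ℝ X E)
      (x := q.1) (n := m) (by simpa using (hf q.1 hq q.2).of_infty m)
    simpa using h1
  refine ContinuousAt.congr ?_ e.symm
  refine (ContinuousLinearMap.continuous _).continuousAt.comp ?_
  have h2 : ContinuousAt (iteratedFDeriv ℝ m f) (p.1, j p.2) :=
    ((hf p.1 hp.1 p.2).of_infty (m + 1)).continuousAt_iteratedFDeriv
      (by exact_mod_cast Nat.le_succ m)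
  exact ContinuousAt.comp (f := fun p : X × K => (p.1, j p.2)) h2 (by fun_prop)

/-- The denominator of the inverted kernel is positive for `|x| |y| ≤ 1 / 2`. -/
theorem inversion_pos {R : ℝ} (hR : 0 < R) {x y : Vec} (hx : ‖x‖ < R) (hy : ‖y‖ ≤ 1 / (2 * R)) :
    0 < 1 + 2 * inner ℝ x y + ‖x‖ ^ 2 * ‖y‖ ^ 2 := by
  have h1 : |inner ℝ x y| ≤ ‖x‖ * ‖y‖ := abs_real_inner_le_norm x y
  have h2 : ‖x‖ * ‖y‖ ≤ 1 / 2 := by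
    calc ‖x‖ * ‖y‖ ≤ R * (1 / (2 * R)) := by gcongr
      _ = 1 / 2 := by field_simp
  have h3 := neg_abs_le (inner ℝ x y)
  nlinarith [mul_nonneg (norm_nonneg x) (norm_nonneg y)]

/-- With `y = G / |G|²` the kernel `1 / |x + G|²` is `|y|² / (1 + 2 x·y + |x|² |y|²)`, which is
smooth up to `y = 0`, the image of infinity. -/
theorem inversion_eq {x G : Vec} (hG : G ≠ 0) :
    ‖(‖G‖ ^ 2)⁻¹ • G‖ ^ 2 / (1 + 2 * inner ℝ x ((‖G‖ ^ 2)⁻¹ • G) +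
      ‖x‖ ^ 2 * ‖(‖G‖ ^ 2)⁻¹ • G‖ ^ 2) = 1 / ‖x + G‖ ^ 2 := by
  have h0 : ‖G‖ ≠ 0 := norm_ne_zero_iff.2 hG
  rw [norm_smul, real_inner_smul_right, norm_inv, norm_pow, norm_norm, norm_add_sq_real]
  have e : 1 + 2 * ((‖G‖ ^ 2)⁻¹ * inner ℝ x G) + ‖x‖ ^ 2 * ((‖G‖ ^ 2)⁻¹ * ‖G‖) ^ 2 =
      (‖x‖ ^ 2 + 2 * inner ℝ x G + ‖G‖ ^ 2) * ((‖G‖ ^ 2)⁻¹ * ‖G‖) ^ 2 := by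
    field_simp
    ring
  rw [e]
  have h1 : ((‖G‖ ^ 2)⁻¹ * ‖G‖) ^ 2 ≠ 0 := by positivity
  rw [div_mul_cancel_right₀ h1, one_div]

open Classical in
/-- The images of the lattice points outside a ball of radius `2 R` under the inversion in the unit
sphere; the other lattice points are sent to `0`. -/
def inversionPoint (a : Module.Basis (Fin 3) ℝ Vec) (R : ℝ) (G : recipLattice a) : Vec :=
  if ‖(G : Vec)‖ < 2 * R then 0 else (‖(G : Vec)‖ ^ 2)⁻¹ • (G : Vec)

theorem norm_inversionPoint_le {a : Module.Basis (Fin 3) ℝ Vec} {R : ℝ} (hR : 0 < R)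
    (G : recipLattice a) : inversionPoint a R G ∈ Metric.closedBall (0 : Vec) (1 / (2 * R)) := by
  rw [mem_closedBall_zero_iff, inversionPoint]
  split_ifs with h
  · rw [norm_zero]
    positivity
  · have h0 : 0 < ‖(G : Vec)‖ := by linarith
    rw [norm_smul, norm_inv, norm_pow, norm_norm, inv_mul_eq_div, pow_two,
      div_mul_cancel_left₀ h0.ne', ← one_div]
    exact one_div_le_one_div_of_le (by positivity) (not_lt.1 h)

/-- After an inversion, the factors `1 / |x + G|²` are the values at fixed points of a continuous
function that depends smoothly on `x`. -/
theorem exists_multiplier (a : Module.Basis (Fin 3) ℝ Vec) {R : ℝ} (hR : 0 < R) :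
    ∃ m : Vec → C(Metric.closedBall (0 : Vec) (1 / (2 * R)), ℂ),
      (∀ n : ℕ, ContDiffOn ℝ n m (Metric.ball 0 R)) ∧
      ∀ x ∈ Metric.ball 0 R, ∀ G : recipLattice a,
        m x ⟨inversionPoint a R G, norm_inversionPoint_le hR G⟩ =
          if ‖(G : Vec)‖ < 2 * R then 0 else ((1 / ‖x + G‖ ^ 2 : ℝ) : ℂ) := by
  have hK : CompactSpace (Metric.closedBall (0 : Vec) (1 / (2 * R))) :=
    isCompact_iff_compactSpace.1 (isCompact_closedBall _ _)
  obtain ⟨m, hm, hsm⟩ := exists_contDiffOn_continuousMap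
    (K := Metric.closedBall (0 : Vec) (1 / (2 * R))) (Metric.isOpen_ball (x := (0 : Vec)) (ε := R))
    (f := fun p : Vec × Vec => ((‖p.2‖ ^ 2 / (1 + 2 * inner ℝ p.1 p.2 + ‖p.1‖ ^ 2 * ‖p.2‖ ^ 2) : ℝ) : ℂ))
    (j := Subtype.val) continuous_subtype_val (fun x hx r => by
      have h1 : ContDiff ℝ ∞ (fun p : Vec × Vec => ‖p.2‖ ^ 2) := contDiff_snd.norm_sq ℝ
      have h2 : ContDiff ℝ ∞ (fun p : Vec × Vec => ‖p.1‖ ^ 2) := contDiff_fst.norm_sq ℝ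
      have h3 : ContDiff ℝ ∞ (fun p : Vec × Vec => (inner ℝ p.1 p.2 : ℝ)) :=
        contDiff_fst.inner ℝ contDiff_snd
      have h4 : ContDiff ℝ ∞ (fun p : Vec × Vec => 1 + 2 * inner ℝ p.1 p.2 + ‖p.1‖ ^ 2 * ‖p.2‖ ^ 2) :=
        (contDiff_const.add (contDiff_const.mul h3)).add (h2.mul h1)
      exact Complex.ofRealCLM.contDiff.contDiffAt.comp _ (h1.contDiffAt.div h4.contDiffAt
        (inversion_pos hR (mem_ball_zero_iff.1 hx) (mem_closedBall_zero_iff.1 r.2)).ne'))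
  refine ⟨m, hsm, fun x hx G => ?_⟩
  rw [hm x hx]
  simp only [inversionPoint]
  split_ifs with h
  · simp
  · rw [inversion_eq]
    rintro h0
    rw [h0, norm_zero] at h
    exact h (by positivity)

end LatticeSum

/-! ### Hadamard's lemma and the symbols of the Coulomb kernel -/

section Hadamard

variable {Z : Type} [NormedAddCommGroup Z] [NormedSpace ℝ Z] [FiniteDimensional ℝ Z]

/-- Integrals over the unit interval of functions that depend smoothly on parameters are smooth. -/
theorem contDiff_integral_unitInterval {W : Type} [NormedAddCommGroup W] [NormedSpace ℝ W]
    [FiniteDimensional ℝ W] {h : ℝ × W → ℂ} (hh : ContDiff ℝ ∞ h) :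
    ContDiff ℝ ∞ (fun w => ∫ t in Icc (0 : ℝ) 1, h (t, w)) := by
  have : ProperSpace W := FiniteDimensional.proper ℝ W
  refine contDiff_iff_contDiffAt.2 fun w₀ => contDiffAt_infty.2 fun n => ?_
  have hcont : ∀ n : ℕ, Continuous fun p : ℝ × W => iteratedFDeriv ℝ n (fun w => h (p.1, w)) p.2 := by
    intro n
    have e : (fun p : ℝ × W => iteratedFDeriv ℝ n (fun w => h (p.1, w)) p.2) = fun p =>
        ContinuousMultilinearMap.compContinuousLinearMapL (𝕜 := ℝ) (F := ℂ)
          (fun _ : Fin n => ContinuousLinearMap.inr ℝ ℝ W) (iteratedFDeriv ℝ n h p) := by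
      ext1 p
      have h1 := iteratedFDeriv_comp_affine (f := h) (p.1, 0) (ContinuousLinearMap.inr ℝ ℝ W)
        (x := p.2) (n := n) (hh.contDiffAt.of_infty n)
      simpa using h1
    rw [e]
    exact (ContinuousLinearMap.continuous _).comp
      (hh.continuous_iteratedFDeriv (by exact_mod_cast le_top))
  have hb : ∀ n : ℕ, ∃ C, ∀ p ∈ Icc (0 : ℝ) 1 ×ˢ Metric.closedBall w₀ 1,
      ‖iteratedFDeriv ℝ n (fun w => h (p.1, w)) p.2‖ ≤ C := fun n =>
    (isCompact_Icc.prod (isCompact_closedBall w₀ 1)).exists_bound_of_continuousOn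
      (hcont n).continuousOn
  choose C hC using hb
  have key := contDiffOn_integral_of_dominated (μ := volume.restrict (Icc (0 : ℝ) 1)) (N := ∅)
    isClosed_empty measure_empty (Metric.isOpen_ball (x := w₀) (ε := 1))
    (integrable_const (1 : ℝ)) (h := h) (fun p _ w _ => hh.contDiffAt) (C := C) (fun n => by
      refine (ae_restrict_iff' measurableSet_Icc).2 (Eventually.of_forall fun t ht _ w hw => ?_)
      rw [mul_one]
      exact hC n (t, w) ⟨ht, Metric.ball_subset_closedBall hw⟩) n
  exact key.1.contDiffAt (Metric.ball_mem_nhds _ one_pos)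

/-- Hadamard's lemma. -/
theorem exists_eq_sum_mul {f : Vec × Z → ℂ} (hf : ContDiff ℝ ∞ f) (h0 : ∀ z, f (0, z) = 0) :
    ∃ Φ : Fin 3 → Vec × Z → ℂ, (∀ j, ContDiff ℝ ∞ (Φ j)) ∧
      ∀ x z, f (x, z) = ∑ j, ((x j : ℝ) : ℂ) * Φ j (x, z) := by
  let D : Fin 3 → ℝ × (Vec × Z) → ℂ := fun j p =>
    fderiv ℝ f (p.1 • p.2.1, p.2.2) (EuclideanSpace.single j 1, 0)
  have hD : ∀ j, ContDiff ℝ ∞ (D j) := fun j => by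
    have h1 : ContDiff ℝ ∞ (fderiv ℝ f) := hf.fderiv_right (by simp)
    have h2 : ContDiff ℝ ∞ (fun p : ℝ × (Vec × Z) => (p.1 • p.2.1, p.2.2)) := by fun_prop
    exact (h1.comp h2).clm_apply contDiff_const
  refine ⟨fun j w => ∫ t in Icc (0 : ℝ) 1, D j (t, w), fun j =>
    contDiff_integral_unitInterval (hD j), fun x z => ?_⟩
  have hder : ∀ t ∈ uIcc (0 : ℝ) 1, HasDerivAt (fun t : ℝ => f (t • x, z))
      (∑ j, ((x j : ℝ) : ℂ) * D j (t, (x, z))) t := fun t _ => by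
    have h1 : HasDerivAt (fun t : ℝ => (t • x, z)) (x, (0 : Z)) t := by
      simpa using ((hasDerivAt_id t).smul_const x).prodMk (hasDerivAt_const t z)
    have h2 := ((hf.differentiable (by simp)) (t • x, z)).hasFDerivAt.comp_hasDerivAt t h1
    have e : (x, (0 : Z)) = ∑ j, x j • ((EuclideanSpace.single j 1 : Vec), (0 : Z)) := by
      ext i
      · simp [Prod.fst_sum, Finset.sum_apply, Pi.single_apply]
      · simp [Prod.snd_sum]
    rw [e, map_sum] at h2
    simp only [map_smul, Complex.real_smul] at h2
    exact h2
  have hcont : ∀ j, Continuous fun t : ℝ => D j (t, (x, z)) := fun j =>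
    (hD j).continuous.comp (by fun_prop)
  have hint := intervalIntegral.integral_eq_sub_of_hasDerivAt hder
    (Continuous.intervalIntegrable (by fun_prop) _ _)
  rw [one_smul, zero_smul, h0, sub_zero] at hint
  rw [← hint, intervalIntegral.integral_of_le zero_le_one, ← integral_Icc_eq_integral_Ioc,
    integral_finsetSum _ fun j _ => ?_]
  · simp only [integral_const_mul]
  · exact (Continuous.integrableOn_Icc (by fun_prop))

variable {a : Module.Basis (Fin 3) ℝ Vec} {r : ℝ}

theorem contDiffAt_inv_norm_sq {x : Vec} (hx : x ≠ 0) :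
    ContDiffAt ℝ ∞ (fun x : Vec => ((1 / ‖x‖ ^ 2 : ℝ) : ℂ)) x :=
  Complex.ofRealCLM.contDiff.contDiffAt.comp x (contDiffAt_const.div
    (contDiff_id.norm_sq ℝ).contDiffAt (by simpa using hx))

/-- The Coulomb kernel times a smooth function has order `2`. -/
theorem symbolOn_coulomb (hr : ∀ G ∈ recipLattice a, ‖G‖ < 2 * r → G = 0) {f : Vec × Z → ℂ}
    (hf : ContDiff ℝ ∞ f) : SymbolOn a {x | 0 < ‖x‖ ∧ ‖x‖ < r} 2
      (fun p : Vec × Z => ((1 / ‖p.1‖ ^ 2 : ℝ) : ℂ) * f p) := by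
  have h1 := SymbolOn.of_homogeneous (Z := Z) (ν := 2) hr
    (η := fun x => ((1 / ‖x‖ ^ 2 : ℝ) : ℂ)) (fun x hx => contDiffAt_inv_norm_sq hx)
    (fun t ht x => by
      rw [norm_smul, Real.norm_of_nonneg ht.le, mul_pow, one_div, mul_inv, ← one_div (‖x‖ ^ 2)]
      push_cast
      rfl)
  exact h1.mul (SymbolOn.of_contDiff hf)

/-- The Coulomb kernel times two smooth factors that vanish at `x = 0` has order `0`. -/
theorem symbolOn_coulomb_of_vanishing (hr : ∀ G ∈ recipLattice a, ‖G‖ < 2 * r → G = 0)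
    {f g : Vec × Z → ℂ} (hf : ContDiff ℝ ∞ f) (hg : ContDiff ℝ ∞ g) (hf0 : ∀ z, f (0, z) = 0)
    (hg0 : ∀ z, g (0, z) = 0) : SymbolOn a {x | 0 < ‖x‖ ∧ ‖x‖ < r} 0
      (fun p : Vec × Z => ((1 / ‖p.1‖ ^ 2 : ℝ) : ℂ) * (f p * g p)) := by
  obtain ⟨Φ, hΦ, hfΦ⟩ := exists_eq_sum_mul hf hf0
  obtain ⟨Ψ, hΨ, hgΨ⟩ := exists_eq_sum_mul hg hg0
  have h1 : ∀ j l : Fin 3, SymbolOn a {x | 0 < ‖x‖ ∧ ‖x‖ < r} 0 (fun p : Vec × Z =>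
      (((1 / ‖p.1‖ ^ 2 : ℝ) : ℂ) * (((p.1 j : ℝ) : ℂ) * ((p.1 l : ℝ) : ℂ))) *
        (Φ j p * Ψ l p)) := fun j l => by
    refine SymbolOn.mul (ν := 0) (ν' := 0) ?_ (SymbolOn.of_contDiff ((hΦ j).mul (hΨ l)))
    refine SymbolOn.of_homogeneous (Z := Z) (ν := 0) hr
      (η := fun x => ((1 / ‖x‖ ^ 2 : ℝ) : ℂ) * (((x j : ℝ) : ℂ) * ((x l : ℝ) : ℂ)))
      (fun x hx => (contDiffAt_inv_norm_sq hx).mul (ContDiffAt.mul ?_ ?_)) (fun t ht x => ?_)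
    · exact (Complex.ofRealCLM.contDiff.comp
        (by fun_prop : ContDiff ℝ ∞ fun x : Vec => x j)).contDiffAt
    · exact (Complex.ofRealCLM.contDiff.comp
        (by fun_prop : ContDiff ℝ ∞ fun x : Vec => x l)).contDiffAt
    · have ht' : (t : ℂ) ≠ 0 := by exact_mod_cast ht.ne'
      rw [norm_smul, Real.norm_of_nonneg ht.le, pow_zero, inv_one, Complex.ofReal_one,
        one_mul]
      simp only [PiLp.smul_apply, smul_eq_mul]
      push_cast
      field_simp
  have e : (fun p : Vec × Z => ((1 / ‖p.1‖ ^ 2 : ℝ) : ℂ) * (f p * g p)) = fun p => ∑ j, ∑ l,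
      (((1 / ‖p.1‖ ^ 2 : ℝ) : ℂ) * (((p.1 j : ℝ) : ℂ) * ((p.1 l : ℝ) : ℂ))) *
        (Φ j p * Ψ l p) := by
    ext1 ⟨x, z⟩
    rw [hfΦ, hgΨ, Finset.sum_mul_sum, Finset.mul_sum]
    refine Finset.sum_congr rfl fun j _ => ?_
    rw [Finset.mul_sum]
    refine Finset.sum_congr rfl fun l _ => ?_
    ring
  rw [e]
  exact SymbolOn.sum fun j _ => SymbolOn.sum fun l _ => h1 j l

end Hadamard

/-! ### The electron repulsion integrals -/

namespace Bands

variable {a : Module.Basis (Fin 3) ℝ Vec} {nocc nvir : ℕ} (S : Bands a nocc nvir)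

/-- The orbital `ψ_{nk}` on the unit cell. -/
def orbMap (n : Fin nocc ⊕ Fin nvir) (k : Vec) : C(closedCell a, ℂ) :=
  ⟨fun r => S.orb n k r, by
    have h := (continuousMultilinearCurryFin0 ℝ Vec ℂ).continuous.comp (S.orb_deriv_continuous n 0)
    have h2 : Continuous fun p : Vec × Vec => S.orb n p.1 p.2 := by
      refine h.congr fun p => ?_
      simp
    exact h2.comp (f := fun r : closedCell a => (k, (r : Vec))) (by fun_prop)⟩

theorem contDiff_orbMap (n : Fin nocc ⊕ Fin nvir) : ContDiff ℝ ∞ (S.orbMap n) := by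
  refine contDiff_infty.2 fun m => contDiffOn_univ.1 ?_
  refine contDiffOn_continuousMap (K := closedCell a) (Φ := S.orbMap n) isOpen_univ
    (fun r => (S.orb_smooth n r).contDiffOn) (fun l => Continuous.continuousOn ?_) m
  exact (S.orb_deriv_continuous n l).comp
    (f := fun p : Vec × closedCell a => (p.1, (p.2 : Vec))) (by fun_prop)

theorem contDiff_planeWave : ContDiff ℝ ∞ (planeWave a) := by
  obtain ⟨Φ, hΦ, hs⟩ := exists_contDiffOn_continuousMap (K := closedCell a) (isOpen_univ (X := Vec))
    (f := fun p : Vec × Vec => Complex.exp (Complex.I * (inner ℝ p.1 p.2 : ℝ))) (j := Subtype.val)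
    continuous_subtype_val (fun x _ r => by
      have h3 : ContDiff ℝ ∞ (fun p : Vec × Vec => (inner ℝ p.1 p.2 : ℝ)) :=
        contDiff_fst.inner ℝ contDiff_snd
      exact (contDiff_const.mul (Complex.ofRealCLM.contDiff.comp h3)).cexp.contDiffAt)
  have e : planeWave a = Φ := by
    ext Q r
    rw [hΦ Q (mem_univ _)]
    rfl
  rw [e]
  exact contDiff_infty.2 fun m => contDiffOn_univ.1 (hs m)

/-- The pair density `conj ψ_{nk} e^{-iQ·r} ψ_{n'k'}` on the unit cell. -/
def pairMap (n n' : Fin nocc ⊕ Fin nvir) (k k' Q : Vec) : C(closedCell a, ℂ) :=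
  star (S.orbMap n k) * planeWave a (-Q) * S.orbMap n' k'

/-- The integral of the pair density `conj ψ_{nk} e^{-iQ·r} ψ_{n'k'}`. -/
def pair (n n' : Fin nocc ⊕ Fin nvir) (k k' Q : Vec) : ℂ :=
  ∫ r in cell a, conj (S.orb n k r) * Complex.exp (Complex.I * (inner ℝ (-Q) r : ℝ)) * S.orb n' k' r

theorem contDiff_pairMap (n n' : Fin nocc ⊕ Fin nvir) {W : Type} [NormedAddCommGroup W]
    [NormedSpace ℝ W] {k k' Q : W → Vec} (hk : ContDiff ℝ ∞ k) (hk' : ContDiff ℝ ∞ k')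
    (hQ : ContDiff ℝ ∞ Q) : ContDiff ℝ ∞ (fun w => S.pairMap n n' (k w) (k' w) (Q w)) := by
  have h1 : ContDiff ℝ ∞ (fun w => star (S.orbMap n (k w))) :=
    (starL' ℝ : C(closedCell a, ℂ) ≃L[ℝ] C(closedCell a, ℂ)).contDiff.comp
      ((S.contDiff_orbMap n).comp hk)
  exact (h1.mul ((contDiff_planeWave (a := a)).comp hQ.neg)).mul ((S.contDiff_orbMap n').comp hk')

theorem fourier_pairMap (n n' : Fin nocc ⊕ Fin nvir) (k k' Q : Vec) (G : recipLattice a) :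
    fourier a (S.pairMap n n' k k' Q) G =
      ((1 / Real.sqrt (volume.real (cell a)) : ℝ) : ℂ) * S.pair n n' k k' (Q + G) := by
  rw [fourier_apply, pair, ← integral_cellMeasure]
  congr 2
  ext r
  have h1 : Complex.exp (Complex.I * (inner ℝ (-(Q + G)) (r : Vec) : ℝ)) =
      Complex.exp (Complex.I * (inner ℝ (-Q) (r : Vec) : ℝ)) * conj (planeWave a G r) := by
    change _ = _ * conj (Complex.exp _)
    rw [conj_planeWave, ← Complex.exp_add, ← mul_add, ← Complex.ofReal_add, ← inner_add_left,
      neg_add]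
  rw [h1]
  change conj (S.orb n k r) * _ * S.orb n' k' r * _ = _
  change conj (S.orb n k r) * Complex.exp (Complex.I * (inner ℝ (-Q) (r : Vec) : ℝ)) *
    S.orb n' k' r * _ = _
  ring

theorem fourier_star_pairMap (n n' : Fin nocc ⊕ Fin nvir) (k k' Q : Vec) (G : recipLattice a) :
    fourier a (star (S.pairMap n n' k k' (-Q))) G =
      ((1 / Real.sqrt (volume.real (cell a)) : ℝ) : ℂ) * conj (S.pair n n' k k' (-(Q + G))) := by
  rw [fourier_apply, pair, ← integral_conj, ← integral_cellMeasure]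
  congr 2
  ext r
  have h1 : Complex.exp (Complex.I * (inner ℝ (-(-(Q + G))) (r : Vec) : ℝ)) =
      Complex.exp (Complex.I * (inner ℝ (-(-Q)) (r : Vec) : ℝ)) * planeWave a G r := by
    change _ = _ * Complex.exp _
    rw [← Complex.exp_add, ← mul_add, ← Complex.ofReal_add, ← inner_add_left, neg_neg, neg_neg]
  rw [h1]
  change conj (conj (S.orb n k r) * Complex.exp (Complex.I * (inner ℝ (-(-Q)) (r : Vec) : ℝ)) *
    S.orb n' k' r) * _ = _
  simp only [map_mul]
  ring

/-- Up to normalization, the pair product is the Fourier coefficient of the pair density at `0`. -/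
theorem contDiff_pair (n n' : Fin nocc ⊕ Fin nvir) {W : Type} [NormedAddCommGroup W]
    [NormedSpace ℝ W] {k k' Q : W → Vec} (hk : ContDiff ℝ ∞ k) (hk' : ContDiff ℝ ∞ k')
    (hQ : ContDiff ℝ ∞ Q) : ContDiff ℝ ∞ (fun w => S.pair n n' (k w) (k' w) (Q w)) := by
  have h1 : ∀ k k' Q, S.pair n n' k k' Q = (Real.sqrt (volume.real (cell a)) : ℂ) *
      inner ℂ (normalizedWave a 0) (ContinuousMap.toLp 2 (cellMeasure a) ℂ
        (S.pairMap n n' k k' Q)) := fun k k' Q => by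
    have h2 := S.fourier_pairMap n n' k k' Q 0
    rw [fourier_apply, ← inner_normalizedWave] at h2
    rw [h2, ← mul_assoc, ← Complex.ofReal_mul, mul_one_div_cancel
      (Real.sqrt_pos.2 (measureReal_cell_pos a)).ne', Complex.ofReal_one, one_mul,
      Submodule.coe_zero, add_zero]
  simp only [h1]
  exact contDiff_const.mul (contDiff_const.inner ℂ
    (((ContinuousMap.toLp 2 (cellMeasure a) ℂ).restrictScalars ℝ).contDiff.comp
      (S.contDiff_pairMap n n' hk hk' hQ)))

variable (n₁ n₂ n₃ n₄ : Fin nocc ⊕ Fin nvir)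

open Classical in
/-- A term of the electron repulsion integral, where `Q = k₃ - k₁ + G`. -/
def eriTerm (k₁ k₂ k₃ Q : Vec) : ℂ :=
  if Q = 0 then 0 else ((1 / ‖Q‖ ^ 2 : ℝ) : ℂ) *
    (S.pair n₁ n₃ k₁ k₃ Q * S.pair n₂ n₄ k₂ (k₂ - (k₃ - k₁)) (-Q))

theorem eri_eq_tsum (k₁ k₂ k₃ : Vec) : S.eri n₁ n₂ n₃ n₄ k₁ k₂ k₃ =
    (4 * Real.pi / volume.real (cell a) : ℝ) *
      ∑' G : recipLattice a, S.eriTerm n₁ n₂ n₃ n₄ k₁ k₂ k₃ (k₃ - k₁ + G) := by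
  unfold eri eriTerm pairProduct pair
  congr 2
  ext G
  congr 1
  rw [mul_assoc]
  have e1 : k₁ - (k₁ + (k₃ - k₁)) - (G : Vec) = -(k₃ - k₁ + G) := by abel
  have e2 : k₂ - (k₂ - (k₃ - k₁)) - -(G : Vec) = - -(k₃ - k₁ + G) := by abel
  rw [e1, e2, add_sub_cancel]

/-- The part of the lattice sum that is smooth for `|k₃ - k₁| < R`: an inner product in `ℓ²` of the
Fourier coefficients of two pair densities, one of them multiplied by `1 / |k₃ - k₁ + G|²`. -/
theorem exists_smooth_part {R : ℝ} (hR : 0 < R) :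
    ∃ F : Vec × Vec × Vec → ℂ,
      (∀ p : Vec × Vec × Vec, ‖p.2.2 - p.1‖ < R → ContDiffAt ℝ ∞ F p) ∧
      ∀ p : Vec × Vec × Vec, ‖p.2.2 - p.1‖ < R → HasSum (fun G : recipLattice a =>
        if ‖(G : Vec)‖ < 2 * R then 0 else
          S.eriTerm n₁ n₂ n₃ n₄ p.1 p.2.1 p.2.2 (p.2.2 - p.1 + G)) (F p) := by
  have hK : CompactSpace (Metric.closedBall (0 : Vec) (1 / (2 * R))) :=
    isCompact_iff_compactSpace.1 (isCompact_closedBall _ _)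
  obtain ⟨m, hm, hmG⟩ := exists_multiplier a hR
  let y : recipLattice a → Metric.closedBall (0 : Vec) (1 / (2 * R)) := fun G =>
    ⟨inversionPoint a R G, norm_inversionPoint_le hR G⟩
  let u : Vec × Vec × Vec → lp (fun _ : recipLattice a => ℂ) 2 := fun p =>
    fourier a (S.pairMap n₁ n₃ p.1 p.2.2 (p.2.2 - p.1))
  let v : Vec × Vec × Vec → lp (fun _ : recipLattice a => ℂ) 2 := fun p =>
    fourier a (star (S.pairMap n₂ n₄ p.2.1 (p.2.1 - (p.2.2 - p.1)) (-(p.2.2 - p.1))))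
  have hu : ContDiff ℝ ∞ u := ((fourier a).restrictScalars ℝ).contDiff.comp
    (S.contDiff_pairMap n₁ n₃ (by fun_prop) (by fun_prop) (by fun_prop))
  have hv : ContDiff ℝ ∞ v := ((fourier a).restrictScalars ℝ).contDiff.comp
    ((starL' ℝ : C(closedCell a, ℂ) ≃L[ℝ] C(closedCell a, ℂ)).contDiff.comp
      (S.contDiff_pairMap n₂ n₄ (by fun_prop) (by fun_prop) (by fun_prop)))
  refine ⟨fun p => (volume.real (cell a) : ℂ) *
    inner ℂ (v p) (diagonalMul _ _ y (m (p.2.2 - p.1)) (u p)), fun p hp => ?_, fun p hp => ?_⟩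
  · refine contDiffAt_const.mul (hv.contDiffAt.inner ℂ (ContDiffAt.clm_apply ?_ hu.contDiffAt))
    have h1 : ContDiffAt ℝ ∞ m (p.2.2 - p.1) := contDiffAt_infty.2 fun n =>
      (hm n).contDiffAt (Metric.isOpen_ball.mem_nhds (mem_ball_zero_iff.2 hp))
    have h2 : ContDiffAt ℝ ∞ (fun p : Vec × Vec × Vec => m (p.2.2 - p.1)) p :=
      ContDiffAt.comp (g := m) (f := fun p : Vec × Vec × Vec => p.2.2 - p.1) p h1 (by fun_prop)
    exact (diagonalMul _ _ y).contDiff.contDiffAt.comp p h2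
  · have h1 := (lp.hasSum_inner (𝕜 := ℂ) (v p) (diagonalMul _ _ y (m (p.2.2 - p.1)) (u p))).mul_left
      (volume.real (cell a) : ℂ)
    refine h1.congr_fun ?_
    intro G
    have hs : ((Real.sqrt (volume.real (cell a)) : ℝ) : ℂ) ^ 2 = (volume.real (cell a) : ℂ) := by
      rw [← Complex.ofReal_pow, Real.sq_sqrt (measureReal_cell_pos a).le]
    have hs0 : ((Real.sqrt (volume.real (cell a)) : ℝ) : ℂ) ≠ 0 := by
      exact_mod_cast (Real.sqrt_pos.2 (measureReal_cell_pos a)).ne'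
    rw [diagonalMul_apply, hmG _ (mem_ball_zero_iff.2 hp)]
    simp only [u, v]
    rw [fourier_pairMap, fourier_star_pairMap]
    by_cases h : ‖(G : Vec)‖ < 2 * R
    · simp [h]
    · have h0 : p.2.2 - p.1 + (G : Vec) ≠ 0 := fun h0 => by
        rw [add_eq_zero_iff_neg_eq] at h0
        rw [← h0, norm_neg] at h
        exact h (by linarith)
      rw [if_neg h, if_neg h, eriTerm, if_neg h0, RCLike.inner_apply]
      simp only [map_mul, Complex.conj_ofReal, Complex.conj_conj]
      rw [← hs]
      push_cast
      field_simp

end Bands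

/-! ### The singularity of the electron repulsion integrals -/

namespace Bands

variable {a : Module.Basis (Fin 3) ℝ Vec} {nocc nvir : ℕ} (S : Bands a nocc nvir)
  (n₁ n₂ n₃ n₄ : Fin nocc ⊕ Fin nvir)

theorem pair_add (n n' : Fin nocc ⊕ Fin nvir) {G G' : Vec} (hG : G ∈ recipLattice a)
    (hG' : G' ∈ recipLattice a) (k k' Q : Vec) :
    S.pair n n' (k + G) (k' + G') Q = S.pair n n' k k' Q := by
  simp only [pair, S.orb_periodic _ _ _ _ hG, S.orb_periodic _ _ _ _ hG']

theorem eriTerm_add {G₁ G₂ G₃ : Vec} (h₁ : G₁ ∈ recipLattice a) (h₂ : G₂ ∈ recipLattice a)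
    (h₃ : G₃ ∈ recipLattice a) (k₁ k₂ k₃ Q : Vec) :
    S.eriTerm n₁ n₂ n₃ n₄ (k₁ + G₁) (k₂ + G₂) (k₃ + G₃) Q = S.eriTerm n₁ n₂ n₃ n₄ k₁ k₂ k₃ Q := by
  have e : k₂ + G₂ - (k₃ + G₃ - (k₁ + G₁)) = k₂ - (k₃ - k₁) + (G₂ - (G₃ - G₁)) := by abel
  simp only [eriTerm, e, S.pair_add _ _ h₁ h₃, S.pair_add _ _ h₂ (sub_mem h₂ (sub_mem h₃ h₁))]

/-- The electron repulsion integral depends on the momenta only modulo the reciprocal lattice. -/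
theorem eri_add {G₁ G₂ G₃ : Vec} (h₁ : G₁ ∈ recipLattice a) (h₂ : G₂ ∈ recipLattice a)
    (h₃ : G₃ ∈ recipLattice a) (k₁ k₂ k₃ : Vec) :
    S.eri n₁ n₂ n₃ n₄ (k₁ + G₁) (k₂ + G₂) (k₃ + G₃) = S.eri n₁ n₂ n₃ n₄ k₁ k₂ k₃ := by
  rw [eri_eq_tsum, eri_eq_tsum,
    ← (Equiv.subRight (⟨G₃ - G₁, sub_mem h₃ h₁⟩ : recipLattice a)).tsum_eq]
  congr 2
  ext G
  have e : k₃ + G₃ - (k₁ + G₁) + ((G : Vec) - (G₃ - G₁)) = k₃ - k₁ + G := by abel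
  simp only [Equiv.subRight_apply, Submodule.coe_sub, e, S.eriTerm_add _ _ _ _ h₁ h₂ h₃]

theorem contDiffAt_eriTerm {p : Vec × Vec × Vec} {G : Vec} (hp : p.2.2 - p.1 + G ≠ 0) :
    ContDiffAt ℝ ∞ (fun p : Vec × Vec × Vec =>
      S.eriTerm n₁ n₂ n₃ n₄ p.1 p.2.1 p.2.2 (p.2.2 - p.1 + G)) p := by
  have hc : ContDiff ℝ ∞ (fun p : Vec × Vec × Vec => p.2.2 - p.1 + G) := by fun_prop
  have h1 := S.contDiff_pair n₁ n₃ (W := Vec × Vec × Vec) (k := fun p => p.1) (k' := fun p => p.2.2)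
    (by fun_prop) (by fun_prop) hc
  have h2 := S.contDiff_pair n₂ n₄ (W := Vec × Vec × Vec) (k := fun p => p.2.1)
    (k' := fun p => p.2.1 - (p.2.2 - p.1)) (by fun_prop) (by fun_prop) hc.neg
  have h3 : ContDiffAt ℝ ∞ (fun p : Vec × Vec × Vec => ((1 / ‖p.2.2 - p.1 + G‖ ^ 2 : ℝ) : ℂ)) p :=
    ContDiffAt.comp (g := fun x : Vec => ((1 / ‖x‖ ^ 2 : ℝ) : ℂ))
      (f := fun p : Vec × Vec × Vec => p.2.2 - p.1 + G) p (contDiffAt_inv_norm_sq hp) hc.contDiffAt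
  refine (h3.mul (h1.mul h2).contDiffAt).congr_of_eventuallyEq ?_
  filter_upwards [hc.continuous.continuousAt.eventually_ne hp] with p' hp'
  rw [eriTerm, if_neg hp']

theorem finite_recipLattice_norm_lt (R : ℝ) : {G : recipLattice a | ‖(G : Vec)‖ < R}.Finite := by
  have h := Metric.finite_isBounded_inter_isClosed (s := (recipLattice a : Set Vec))
    (K := Metric.ball 0 R) (isDiscrete_iff_discreteTopology.2
      (inferInstanceAs (DiscreteTopology (recipLattice a)))) Metric.isBounded_ball
    (isClosed_recipLattice a)
  refine Set.Finite.of_finite_image (f := Subtype.val) (h.subset ?_) Subtype.val_injective.injOn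
  rintro _ ⟨G, hG, rfl⟩
  exact ⟨mem_ball_zero_iff.2 hG, G.2⟩

/-- For `|k₃ - k₁| < R` the electron repulsion integral is a finite sum up to a smooth function. -/
theorem exists_eri_eq {R : ℝ} (hR : 0 < R) :
    ∃ F : Vec × Vec × Vec → ℂ,
      (∀ p : Vec × Vec × Vec, ‖p.2.2 - p.1‖ < R → ContDiffAt ℝ ∞ F p) ∧
      ∀ p : Vec × Vec × Vec, ‖p.2.2 - p.1‖ < R → S.eri n₁ n₂ n₃ n₄ p.1 p.2.1 p.2.2 =
        (4 * Real.pi / volume.real (cell a) : ℝ) *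
        (∑ G ∈ (finite_recipLattice_norm_lt (a := a) (2 * R)).toFinset,
          S.eriTerm n₁ n₂ n₃ n₄ p.1 p.2.1 p.2.2 (p.2.2 - p.1 + G) + F p) := by
  classical
  obtain ⟨F, hF, hsum⟩ := S.exists_smooth_part n₁ n₂ n₃ n₄ hR
  refine ⟨F, hF, fun p hp => ?_⟩
  rw [eri_eq_tsum]
  congr 1
  have h1 : HasSum (fun G : recipLattice a => if ‖(G : Vec)‖ < 2 * R then
      S.eriTerm n₁ n₂ n₃ n₄ p.1 p.2.1 p.2.2 (p.2.2 - p.1 + G) else 0)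
      (∑ G ∈ (finite_recipLattice_norm_lt (a := a) (2 * R)).toFinset,
        if ‖(G : Vec)‖ < 2 * R then
          S.eriTerm n₁ n₂ n₃ n₄ p.1 p.2.1 p.2.2 (p.2.2 - p.1 + G) else 0) :=
    hasSum_sum_of_ne_finset_zero fun G hG => if_neg (by simpa using hG)
  have h2 := h1.add (hsum p hp)
  have e : (∑ G ∈ (finite_recipLattice_norm_lt (a := a) (2 * R)).toFinset,
        if ‖(G : Vec)‖ < 2 * R then
          S.eriTerm n₁ n₂ n₃ n₄ p.1 p.2.1 p.2.2 (p.2.2 - p.1 + G) else 0) =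
      ∑ G ∈ (finite_recipLattice_norm_lt (a := a) (2 * R)).toFinset,
          S.eriTerm n₁ n₂ n₃ n₄ p.1 p.2.1 p.2.2 (p.2.2 - p.1 + G) :=
    Finset.sum_congr rfl fun G hG => if_pos (by simpa using hG)
  rw [e] at h2
  rw [← h2.tsum_eq]
  congr 1
  ext G
  split_ifs <;> simp

theorem contDiffAt_eri {p : Vec × Vec × Vec} (hp : p.2.2 - p.1 ∉ recipLattice a) :
    ContDiffAt ℝ ∞ (fun p : Vec × Vec × Vec => S.eri n₁ n₂ n₃ n₄ p.1 p.2.1 p.2.2) p := by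
  obtain ⟨F, hF, heq⟩ := S.exists_eri_eq n₁ n₂ n₃ n₄ (R := ‖p.2.2 - p.1‖ + 1) (by positivity)
  have hlt : ‖p.2.2 - p.1‖ < ‖p.2.2 - p.1‖ + 1 := lt_add_one _
  have hop : IsOpen {p' : Vec × Vec × Vec | ‖p'.2.2 - p'.1‖ < ‖p.2.2 - p.1‖ + 1} :=
    isOpen_lt (by fun_prop) continuous_const
  have hs : ContDiffAt ℝ ∞ (fun p' : Vec × Vec × Vec =>
      ∑ G ∈ (finite_recipLattice_norm_lt (a := a) (2 * (‖p.2.2 - p.1‖ + 1))).toFinset,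
        S.eriTerm n₁ n₂ n₃ n₄ p'.1 p'.2.1 p'.2.2 (p'.2.2 - p'.1 + G)) p := by
    refine ContDiffAt.sum fun G _ => S.contDiffAt_eriTerm n₁ n₂ n₃ n₄ fun h0 => hp ?_
    rw [eq_neg_of_add_eq_zero_left h0]
    exact neg_mem G.2
  exact (contDiffAt_const.mul (hs.add (hF p hlt))).congr_of_eventuallyEq
    (Filter.eventuallyEq_of_mem (hop.mem_nhds hlt) heq)

/-- Near `k₃ = k₁` only the term of the vector `0` is singular. -/
theorem exists_eri_eq_near {r : ℝ} (hr0 : 0 < r) (hr : ∀ G ∈ recipLattice a, ‖G‖ < 2 * r → G = 0) :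
    ∃ F : Vec × Vec × Vec → ℂ,
      (∀ p : Vec × Vec × Vec, ‖p.2.2 - p.1‖ < r → ContDiffAt ℝ ∞ F p) ∧
      ∀ p : Vec × Vec × Vec, ‖p.2.2 - p.1‖ < r → S.eri n₁ n₂ n₃ n₄ p.1 p.2.1 p.2.2 =
        (4 * Real.pi / volume.real (cell a) : ℝ) *
        (S.eriTerm n₁ n₂ n₃ n₄ p.1 p.2.1 p.2.2 (p.2.2 - p.1) + F p) := by
  obtain ⟨F, hF, heq⟩ := S.exists_eri_eq n₁ n₂ n₃ n₄ hr0
  refine ⟨F, hF, fun p hp => ?_⟩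
  rw [heq p hp]
  have e : (finite_recipLattice_norm_lt (a := a) (2 * r)).toFinset = {0} := by
    ext G
    rw [Set.Finite.mem_toFinset, mem_ofPred_eq, Finset.mem_singleton]
    refine ⟨fun h => Subtype.ext (hr G G.2 h), fun h => ?_⟩
    rw [h, Submodule.coe_zero, norm_zero]
    positivity
  rw [e, Finset.sum_singleton, Submodule.coe_zero, add_zero]

/-- The singularity of the term of the vector `0` determines the singularity of the electron
repulsion integral. -/
theorem periodicSymbol_eri_of_near {ν : ℕ} (h : ∀ r, (∀ G ∈ recipLattice a, ‖G‖ < 2 * r → G = 0) →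
    SymbolOn a {x | 0 < ‖x‖ ∧ ‖x‖ < r} ν (fun p : Vec × (Vec × Vec) => ((1 / ‖p.1‖ ^ 2 : ℝ) : ℂ) *
      (S.pair n₁ n₃ p.2.1 (p.2.1 + p.1) p.1 * S.pair n₂ n₄ p.2.2 (p.2.2 - p.1) (-p.1)))) :
    PeriodicSymbol a ν (S.eri n₁ n₂ n₃ n₄) := by
  obtain ⟨r, hr0, hr⟩ := exists_latticeGap a
  obtain ⟨F, hF, heq⟩ := S.exists_eri_eq_near n₁ n₂ n₃ n₄ hr0 hr
  refine ⟨fun G hG k₁ k₂ k₃ => ?_, fun G hG k₁ k₂ k₃ => ?_, fun G hG k₁ k₂ k₃ => ?_, ?_, ?_⟩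
  · simpa using S.eri_add n₁ n₂ n₃ n₄ hG (zero_mem _) (zero_mem _) k₁ k₂ k₃
  · simpa using S.eri_add n₁ n₂ n₃ n₄ (zero_mem _) hG (zero_mem _) k₁ k₂ k₃
  · simpa using S.eri_add n₁ n₂ n₃ n₄ (zero_mem _) (zero_mem _) hG k₁ k₂ k₃
  · refine SymbolOn.of_near_zero (half_pos hr0) ?_ (fun x hx z => ?_) (fun G hG x z => ?_)
    · have hr' : ∀ G ∈ recipLattice a, ‖G‖ < 2 * (r / 2) → G = 0 := fun G hG hlt =>
        hr G hG (by linarith)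
      have hop : IsOpen {x : Vec | 0 < ‖x‖ ∧ ‖x‖ < r / 2} :=
        (isOpen_lt continuous_const continuous_norm).inter
          (isOpen_lt continuous_norm continuous_const)
      have hoff : ∀ x ∈ {x : Vec | 0 < ‖x‖ ∧ ‖x‖ < r / 2}, x ∉ recipLattice a := fun x hx h =>
        (norm_pos_iff.1 hx.1) (hr' x h (by linarith [hx.2]))
      have h1 : SymbolOn a {x | 0 < ‖x‖ ∧ ‖x‖ < r / 2} 0
          (fun p : Vec × (Vec × Vec) => F (p.2.1, p.2.2, p.2.1 + p.1)) := by
        refine SymbolOn.of_contDiffAt (K := Metric.closedBall 0 (r / 2)) Metric.isClosed_closedBall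
          (fun x hx => mem_closedBall_zero_iff.2 hx.2.le) fun x hx z => ?_
        refine ContDiffAt.comp (g := F)
          (f := fun p : Vec × (Vec × Vec) => (p.2.1, p.2.2, p.2.1 + p.1)) (x, z) (hF _ ?_)
          (by fun_prop)
        rw [add_sub_cancel_left]
        exact (mem_closedBall_zero_iff.1 hx).trans_lt (half_lt_self hr0)
      refine SymbolOn.congr (((h (r / 2) hr').add (h1.of_le hoff (Nat.zero_le ν))).const_mul
        ((4 * Real.pi / volume.real (cell a) : ℝ) : ℂ)) hop fun x hx z => ?_
      have h2 := heq (z.1, z.2, z.1 + x) (by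
        rw [add_sub_cancel_left]; exact hx.2.trans (half_lt_self hr0))
      rw [add_sub_cancel_left] at h2
      rw [h2, eriTerm, if_neg (norm_pos_iff.1 hx.1), add_sub_cancel_left]
    · exact ContDiffAt.comp (g := fun p : Vec × Vec × Vec => S.eri n₁ n₂ n₃ n₄ p.1 p.2.1 p.2.2)
        (f := fun p : Vec × (Vec × Vec) => (p.2.1, p.2.2, p.2.1 + p.1)) (x, z)
        (S.contDiffAt_eri n₁ n₂ n₃ n₄ (by simpa using hx)) (by fun_prop)
    · rw [← add_assoc]
      simpa using S.eri_add n₁ n₂ n₃ n₄ (zero_mem _) (zero_mem _) hG z.1 z.2 (z.1 + x)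
  · have h3 : ∀ y : Vec × Vec, S.eri n₁ n₂ n₃ n₄ y.1 y.2 y.1 =
        (4 * Real.pi / volume.real (cell a) : ℝ) * F (y.1, y.2, y.1) := fun y => by
      have h2 := heq (y.1, y.2, y.1) (by rwa [sub_self, norm_zero])
      rw [sub_self, eriTerm, if_pos rfl, zero_add] at h2
      exact h2
    simp only [h3]
    refine contDiff_const.mul (contDiff_iff_contDiffAt.2 fun y => ?_)
    exact ContDiffAt.comp (g := F) (f := fun y : Vec × Vec => (y.1, y.2, y.1)) y
      (hF _ (by rwa [sub_self, norm_zero])) (by fun_prop)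

theorem contDiff_pair_left : ContDiff ℝ ∞
    (fun p : Vec × (Vec × Vec) => S.pair n₁ n₃ p.2.1 (p.2.1 + p.1) p.1) :=
  S.contDiff_pair n₁ n₃ (by fun_prop) (by fun_prop) (by fun_prop)

theorem contDiff_pair_right : ContDiff ℝ ∞
    (fun p : Vec × (Vec × Vec) => S.pair n₂ n₄ p.2.2 (p.2.2 - p.1) (-p.1)) :=
  S.contDiff_pair n₂ n₄ (by fun_prop) (by fun_prop) (by fun_prop)

/-- In general the order is `2`, that of the Coulomb kernel. -/
theorem periodicSymbol_eri : PeriodicSymbol a 2 (S.eri n₁ n₂ n₃ n₄) :=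
  S.periodicSymbol_eri_of_near n₁ n₂ n₃ n₄ fun _ hr =>
    symbolOn_coulomb hr ((S.contDiff_pair_left n₁ n₃).mul (S.contDiff_pair_right n₂ n₄))

variable {n₁ n₂ n₃ n₄}

theorem pair_zero {n n' : Fin nocc ⊕ Fin nvir} (hn : n ≠ n') (k : Vec) : S.pair n n' k k 0 = 0 := by
  have := S.orthonormal n n' k
  rw [if_neg hn] at this
  simpa [pair] using this

/-- If both pairs of orbitals belong to different bands, then by orthogonality the pair densities
vanish at zero momentum transfer, and they cancel the singularity of the Coulomb kernel up to a
bounded factor. -/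
theorem periodicSymbol_eri_of_ne (h₁₃ : n₁ ≠ n₃) (h₂₄ : n₂ ≠ n₄) :
    PeriodicSymbol a 0 (S.eri n₁ n₂ n₃ n₄) :=
  S.periodicSymbol_eri_of_near n₁ n₂ n₃ n₄ fun _ hr =>
    symbolOn_coulomb_of_vanishing hr (S.contDiff_pair_left n₁ n₃) (S.contDiff_pair_right n₂ n₄)
      (fun z => by simpa using S.pair_zero h₁₃ z.1) (fun z => by simpa using S.pair_zero h₂₄ z.2)

end Bands

/-! ### Averages that are periodic symbols of order zero -/

section Averages

variable {a : Module.Basis (Fin 3) ℝ Vec} {g h : Vec → Vec → Vec → ℂ}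
  {F F' : Vec → Vec → Vec → Vec → ℂ} {P α₁ α₂ α₃ β₁ β₂ β₃ : Vec → Vec → Vec → Vec → Vec}

/-- `F κ k₁ k₂ k₃` is integrable in `κ`, and its average over `κ` belongs to `𝕋(Ω*)`. -/
structure AvgSymbol (a : Module.Basis (Fin 3) ℝ Vec) (F : Vec → Vec → Vec → Vec → ℂ) : Prop where
  integrableOn : ∀ k₁ k₂ k₃, IntegrableOn (fun κ => F κ k₁ k₂ k₃) (zone a)
  average : PeriodicSymbol a 0 (fun k₁ k₂ k₃ => zoneAvg a fun κ => F κ k₁ k₂ k₃)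

theorem AvgSymbol.add (hF : AvgSymbol a F) (hF' : AvgSymbol a F') :
    AvgSymbol a (fun κ k₁ k₂ k₃ => F κ k₁ k₂ k₃ + F' κ k₁ k₂ k₃) := by
  refine ⟨fun k₁ k₂ k₃ => (hF.integrableOn k₁ k₂ k₃).add (hF'.integrableOn k₁ k₂ k₃), ?_⟩
  convert hF.average.add hF'.average using 4 with k₁ k₂ k₃
  rw [zoneAvg, integral_add (hF.integrableOn k₁ k₂ k₃) (hF'.integrableOn k₁ k₂ k₃), mul_add]
  rfl

theorem AvgSymbol.const_mul (c : ℂ) (hF : AvgSymbol a F) :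
    AvgSymbol a (fun κ k₁ k₂ k₃ => c * F κ k₁ k₂ k₃) := by
  refine ⟨fun k₁ k₂ k₃ => (hF.integrableOn k₁ k₂ k₃).const_mul c, ?_⟩
  convert hF.average.const_mul c using 4 with k₁ k₂ k₃
  rw [zoneAvg, integral_const_mul, mul_left_comm]
  rfl

theorem AvgSymbol.sub (hF : AvgSymbol a F) (hF' : AvgSymbol a F') :
    AvgSymbol a (fun κ k₁ k₂ k₃ => F κ k₁ k₂ k₃ - F' κ k₁ k₂ k₃) := by
  simpa [sub_eq_add_neg] using hF.add (hF'.const_mul (-1))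

theorem AvgSymbol.sum {ι : Type} {s : Finset ι} {F : ι → Vec → Vec → Vec → Vec → ℂ}
    (hF : ∀ i ∈ s, AvgSymbol a (F i)) : AvgSymbol a (fun κ k₁ k₂ k₃ => ∑ i ∈ s, F i κ k₁ k₂ k₃) := by
  refine ⟨fun k₁ k₂ k₃ => integrable_finsetSum _ fun i hi => (hF i hi).integrableOn k₁ k₂ k₃, ?_⟩
  convert PeriodicSymbol.sum fun i hi => (hF i hi).average using 4 with k₁ k₂ k₃
  rw [zoneAvg, integral_finsetSum _ fun i hi => (hF i hi).integrableOn k₁ k₂ k₃, Finset.mul_sum]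
  rfl

/-- The variable of integration. -/
theorem isIntComb_integrated : IsIntComb fun κ _ _ _ => κ := ⟨1, 0, 0, 0, by simp⟩

theorem isIntComb_first : IsIntComb fun _ k₁ _ _ => k₁ := ⟨0, 1, 0, 0, by simp⟩

theorem isIntComb_second : IsIntComb fun _ _ k₂ _ => k₂ := ⟨0, 0, 1, 0, by simp⟩

theorem isIntComb_third : IsIntComb fun _ _ _ k₃ => k₃ := ⟨0, 0, 0, 1, by simp⟩

theorem IsIntComb.add (hα : IsIntComb α₁) (hβ : IsIntComb β₁) :
    IsIntComb fun κ k₁ k₂ k₃ => α₁ κ k₁ k₂ k₃ + β₁ κ k₁ k₂ k₃ := by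
  obtain ⟨c₀, c₁, c₂, c₃, h⟩ := hα
  obtain ⟨d₀, d₁, d₂, d₃, h'⟩ := hβ
  exact ⟨c₀ + d₀, c₁ + d₁, c₂ + d₂, c₃ + d₃, fun κ k₁ k₂ k₃ => by simp only [h, h']; module⟩

theorem IsIntComb.sub (hα : IsIntComb α₁) (hβ : IsIntComb β₁) :
    IsIntComb fun κ k₁ k₂ k₃ => α₁ κ k₁ k₂ k₃ - β₁ κ k₁ k₂ k₃ := by
  obtain ⟨c₀, c₁, c₂, c₃, h⟩ := hα
  obtain ⟨d₀, d₁, d₂, d₃, h'⟩ := hβ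
  exact ⟨c₀ - d₀, c₁ - d₁, c₂ - d₂, c₃ - d₃, fun κ k₁ k₂ k₃ => by simp only [h, h']; module⟩

/-- A convolution: the singularities of the factors are at `P = 0` and `P = k₃ - k₁`. -/
theorem AvgSymbol.convolution (hg : PeriodicSymbol a 2 g) (hh : PeriodicSymbol a 0 h)
    (hα₁ : IsIntComb α₁) (hα₂ : IsIntComb α₂) (hα₃ : IsIntComb α₃)
    (hβ₁ : IsIntComb β₁) (hβ₂ : IsIntComb β₂) (hβ₃ : IsIntComb β₃) (hP : IsIntComb P) (ε σ τ : ℤˣ)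
    (hPε : ∀ κ k₁ k₂ k₃, P κ k₁ k₂ k₃ = (ε : ℤ) • κ + P 0 k₁ k₂ k₃)
    (hα : ∀ κ k₁ k₂ k₃, α₃ κ k₁ k₂ k₃ - α₁ κ k₁ k₂ k₃ = (σ : ℤ) • P κ k₁ k₂ k₃)
    (hβ : ∀ κ k₁ k₂ k₃, β₃ κ k₁ k₂ k₃ - β₁ κ k₁ k₂ k₃ = (τ : ℤ) • (k₃ - k₁ - P κ k₁ k₂ k₃)) :
    AvgSymbol a (fun κ k₁ k₂ k₃ => g (α₁ κ k₁ k₂ k₃) (α₂ κ k₁ k₂ k₃) (α₃ κ k₁ k₂ k₃) *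
      h (β₁ κ k₁ k₂ k₃) (β₂ κ k₁ k₂ k₃) (β₃ κ k₁ k₂ k₃)) := by
  refine ⟨fun k₁ k₂ k₃ => ?_, hg.convolution hh hP hα₁ hα₂ hα₃ hβ₁ hβ₂ hβ₃ ε σ τ hPε hα hβ⟩
  have := hg.integrableOn_mul hh (PeriodicSymbol.const 1) hα₁ hα₂ hα₃ hβ₁ hβ₂ hβ₃ hβ₁ hβ₂ hβ₃
    (σ * ε) (k₁ := k₁) (k₂ := k₂) (k₃ := k₃) (s := (σ : ℤ) • P 0 k₁ k₂ k₃) (fun κ => by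
      rw [hα, hPε, smul_add, smul_smul, Units.val_mul])
  simpa using this

/-- Only the singularity of the first factor moves with the variable of integration. -/
theorem AvgSymbol.mul_fixed (hg : PeriodicSymbol a 2 g) (hh : PeriodicSymbol a 0 h)
    (hα₁ : IsIntComb α₁) (hα₂ : IsIntComb α₂) (hα₃ : IsIntComb α₃)
    (hβ₁ : IsIntComb β₁) (hβ₂ : IsIntComb β₂) (hβ₃ : IsIntComb β₃) (ε τ : ℤˣ)
    (hα : ∀ κ k₁ k₂ k₃, α₃ κ k₁ k₂ k₃ - α₁ κ k₁ k₂ k₃ =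
      (ε : ℤ) • κ + (α₃ 0 k₁ k₂ k₃ - α₁ 0 k₁ k₂ k₃))
    (hβ : ∀ κ k₁ k₂ k₃, β₃ κ k₁ k₂ k₃ - β₁ κ k₁ k₂ k₃ = (τ : ℤ) • (k₃ - k₁)) :
    AvgSymbol a (fun κ k₁ k₂ k₃ => g (α₁ κ k₁ k₂ k₃) (α₂ κ k₁ k₂ k₃) (α₃ κ k₁ k₂ k₃) *
      h (β₁ κ k₁ k₂ k₃) (β₂ κ k₁ k₂ k₃) (β₃ κ k₁ k₂ k₃)) := by
  refine ⟨fun k₁ k₂ k₃ => ?_, ?_⟩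
  · have := hg.integrableOn_mul hh (PeriodicSymbol.const 1) hα₁ hα₂ hα₃ hβ₁ hβ₂ hβ₃ hβ₁ hβ₂ hβ₃ ε
      (fun κ => hα κ k₁ k₂ k₃)
    simpa using this
  · have := hg.average hh (PeriodicSymbol.const 1) (hα₃.sub hα₁) hα₁ hα₂ hα₃ hβ₁ hβ₂ hβ₃ hβ₁ hβ₂ hβ₃
      ε 1 τ τ hα (by simp) hβ hβ
    simpa using this

/-- Only the singularity of the second factor moves with the variable of integration. -/
theorem AvgSymbol.fixed_mul (hh : PeriodicSymbol a 0 h) (hg : PeriodicSymbol a 2 g)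
    (hβ₁ : IsIntComb β₁) (hβ₂ : IsIntComb β₂) (hβ₃ : IsIntComb β₃)
    (hα₁ : IsIntComb α₁) (hα₂ : IsIntComb α₂) (hα₃ : IsIntComb α₃) (ε τ : ℤˣ)
    (hα : ∀ κ k₁ k₂ k₃, α₃ κ k₁ k₂ k₃ - α₁ κ k₁ k₂ k₃ =
      (ε : ℤ) • κ + (α₃ 0 k₁ k₂ k₃ - α₁ 0 k₁ k₂ k₃))
    (hβ : ∀ κ k₁ k₂ k₃, β₃ κ k₁ k₂ k₃ - β₁ κ k₁ k₂ k₃ = (τ : ℤ) • (k₃ - k₁)) :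
    AvgSymbol a (fun κ k₁ k₂ k₃ => h (β₁ κ k₁ k₂ k₃) (β₂ κ k₁ k₂ k₃) (β₃ κ k₁ k₂ k₃) *
      g (α₁ κ k₁ k₂ k₃) (α₂ κ k₁ k₂ k₃) (α₃ κ k₁ k₂ k₃)) := by
  have := AvgSymbol.mul_fixed hg hh hα₁ hα₂ hα₃ hβ₁ hβ₂ hβ₃ ε τ hα hβ
  simpa only [mul_comm] using this

/-- None of the singularities moves with the variable of integration. -/
theorem AvgSymbol.fixed_mul_fixed (hg : PeriodicSymbol a 0 g) (hh : PeriodicSymbol a 0 h)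
    (hα₁ : IsIntComb α₁) (hα₂ : IsIntComb α₂) (hα₃ : IsIntComb α₃)
    (hβ₁ : IsIntComb β₁) (hβ₂ : IsIntComb β₂) (hβ₃ : IsIntComb β₃) (σ τ : ℤˣ)
    (hα : ∀ κ k₁ k₂ k₃, α₃ κ k₁ k₂ k₃ - α₁ κ k₁ k₂ k₃ = (σ : ℤ) • (k₃ - k₁))
    (hβ : ∀ κ k₁ k₂ k₃, β₃ κ k₁ k₂ k₃ - β₁ κ k₁ k₂ k₃ = (τ : ℤ) • (k₃ - k₁)) :
    AvgSymbol a (fun κ k₁ k₂ k₃ => g (α₁ κ k₁ k₂ k₃) (α₂ κ k₁ k₂ k₃) (α₃ κ k₁ k₂ k₃) *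
      h (β₁ κ k₁ k₂ k₃) (β₂ κ k₁ k₂ k₃) (β₃ κ k₁ k₂ k₃)) := by
  have h1 : ∀ κ k₁ k₂ k₃ : Vec, κ - k₁ = ((1 : ℤˣ) : ℤ) • κ + (0 - k₁) := fun κ k₁ _ _ => by
    rw [Units.val_one, one_smul, zero_sub, sub_eq_add_neg]
  refine ⟨fun k₁ k₂ k₃ => ?_, ?_⟩
  · have := ((PeriodicSymbol.const 1).of_zero 2).integrableOn_mul hg hh isIntComb_first
      isIntComb_second isIntComb_integrated hα₁ hα₂ hα₃ hβ₁ hβ₂ hβ₃ 1 (k₁ := k₁) (k₂ := k₂)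
      (k₃ := k₃) (fun κ => h1 κ k₁ k₂ k₃)
    simpa using this
  · have := ((PeriodicSymbol.const 1).of_zero 2).average hg hh
      (isIntComb_integrated.sub isIntComb_first) isIntComb_first isIntComb_second
      isIntComb_integrated hα₁ hα₂ hα₃ hβ₁ hβ₂ hβ₃ 1 1 σ τ h1 (by simp) hα hβ
    simpa using this

/-- The average of one symbol over a variable that moves the singularity. -/
theorem AvgSymbol.single (hg : PeriodicSymbol a 2 g) (hα₁ : IsIntComb α₁) (hα₂ : IsIntComb α₂)
    (hα₃ : IsIntComb α₃) (ε : ℤˣ)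
    (hα : ∀ κ k₁ k₂ k₃, α₃ κ k₁ k₂ k₃ - α₁ κ k₁ k₂ k₃ =
      (ε : ℤ) • κ + (α₃ 0 k₁ k₂ k₃ - α₁ 0 k₁ k₂ k₃)) :
    AvgSymbol a (fun κ k₁ k₂ k₃ => g (α₁ κ k₁ k₂ k₃) (α₂ κ k₁ k₂ k₃) (α₃ κ k₁ k₂ k₃)) := by
  have := AvgSymbol.mul_fixed hg (PeriodicSymbol.const 1) hα₁ hα₂ hα₃ isIntComb_first
    isIntComb_second isIntComb_third ε 1 hα (by simp)
  simpa using this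

/-- Products of symbols of order `0` are integrable in two momenta. -/
theorem PeriodicSymbol.integrableOn_prod (hg : PeriodicSymbol a 0 g) (hh : PeriodicSymbol a 0 h)
    {α₁ α₂ α₃ β₁ β₂ β₃ : Vec × Vec → Vec} (hα₁ : Continuous α₁) (hα₂ : Continuous α₂)
    (hα₃ : Continuous α₃) (hβ₁ : Continuous β₁) (hβ₂ : Continuous β₂) (hβ₃ : Continuous β₃) :
    IntegrableOn (fun p => g (α₁ p) (α₂ p) (α₃ p) * h (β₁ p) (β₂ p) (β₃ p)) (zone a ×ˢ zone a) := by
  obtain ⟨C, hC0, hC⟩ := hg.exists_norm_le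
  obtain ⟨C', hC0', hC'⟩ := hh.exists_norm_le
  have hfin : IsFiniteMeasure (volume.restrict (zone a ×ˢ zone a)) :=
    ⟨by
      rw [Measure.restrict_apply_univ]
      exact ((isBounded_zone a).prod (isBounded_zone a)).measure_lt_top⟩
  refine Integrable.mono' (integrable_const ((C * 2) * (C' * 2)))
    (Measurable.aestronglyMeasurable ?_) (Eventually.of_forall fun p => ?_)
  · refine Measurable.mul ?_ ?_
    · exact hg.measurable.comp (hα₁.measurable.prodMk (hα₂.measurable.prodMk hα₃.measurable))
    · exact hh.measurable.comp (hβ₁.measurable.prodMk (hβ₂.measurable.prodMk hβ₃.measurable))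
  · have h1 := hC (α₁ p) (α₂ p) (α₃ p)
    have h2 := hC' (β₁ p) (β₂ p) (β₃ p)
    rw [pow_zero, div_one, one_add_one_eq_two] at h1 h2
    rw [norm_mul]
    exact mul_le_mul h1 h2 (norm_nonneg _) (by positivity)

/-- Fubini's theorem for averages. -/
theorem zoneAvg₂_eq {f : Vec → Vec → ℂ}
    (hf : IntegrableOn (fun p : Vec × Vec => f p.1 p.2) (zone a ×ˢ zone a)) :
    zoneAvg₂ a f = zoneAvg a fun k => zoneAvg a fun k' => f k k' := by
  unfold zoneAvg₂ zoneAvg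
  rw [Measure.volume_eq_prod, setIntegral_prod _ hf, integral_const_mul, ← mul_assoc]
  congr 1
  ring

end Averages

/-! ### The terms of the amplitude equation -/

namespace Bands

variable {a : Module.Basis (Fin 3) ℝ Vec} {nocc nvir : ℕ} (S : Bands a nocc nvir)
  {t : Amplitude nocc nvir}

/-- The singularity at `k_k = k_i` is that of the electron repulsion integral; the average is a
convolution. -/
theorem periodicSymbol_chiOcc (ht : ∀ i j e b, PeriodicSymbol a 0 (t i j e b))
    (i j k l : Fin nocc) : PeriodicSymbol a 2 (S.chiOcc t i j k l) := by
  refine PeriodicSymbol.add ?_ (PeriodicSymbol.of_zero (AvgSymbol.average ?_) 2)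
  · exact (S.periodicSymbol_eri _ _ _ _).comp isIntComb_third
      ((isIntComb_first.add isIntComb_second).sub isIntComb_third) isIntComb_first (-1)
      (by intros; simp only [Units.val_neg, Units.val_one]; module)
  · refine AvgSymbol.sum fun c _ => AvgSymbol.sum fun d _ => ?_
    exact AvgSymbol.convolution (S.periodicSymbol_eri _ _ _ _) (ht i j c d)
      isIntComb_third ((isIntComb_first.add isIntComb_second).sub isIntComb_third)
      isIntComb_integrated isIntComb_first isIntComb_second isIntComb_integrated
      (isIntComb_third.sub isIntComb_integrated) (-1) (-1) 1
      (by intros; simp only [Units.val_neg, Units.val_one]; module)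
      (by intros; simp only [Units.val_neg, Units.val_one]; module)
      (by intros; simp only [Units.val_one]; module)

theorem periodicSymbol_term4h2p (ht : ∀ i j e b, PeriodicSymbol a 0 (t i j e b))
    (i j : Fin nocc) (e b : Fin nvir) : PeriodicSymbol a 0 (S.term4h2p t i j e b) := by
  refine AvgSymbol.average ?_
  refine AvgSymbol.sum fun k _ => AvgSymbol.sum fun l _ => ?_
  exact AvgSymbol.convolution (S.periodicSymbol_chiOcc ht i j k l) (ht k l e b)
    isIntComb_first isIntComb_second isIntComb_integrated isIntComb_integrated
    ((isIntComb_first.add isIntComb_second).sub isIntComb_integrated) isIntComb_third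
    (isIntComb_integrated.sub isIntComb_first) 1 1 1
    (by intros; simp only [Units.val_one]; module)
    (by intros; simp only [Units.val_one]; module)
    (by intros; simp only [Units.val_one]; module)

theorem periodicSymbol_term2h4p (ht : ∀ i j e b, PeriodicSymbol a 0 (t i j e b))
    (i j : Fin nocc) (e b : Fin nvir) : PeriodicSymbol a 0 (S.term2h4p t i j e b) := by
  refine AvgSymbol.average ?_
  refine AvgSymbol.sum fun c _ => AvgSymbol.sum fun d _ => ?_
  have A := AvgSymbol.convolution (S.periodicSymbol_eri (.inr e) (.inr b) (.inr c) (.inr d))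
    (ht i j c d)
    isIntComb_third ((isIntComb_first.add isIntComb_second).sub isIntComb_third)
    isIntComb_integrated isIntComb_first isIntComb_second isIntComb_integrated
    (isIntComb_third.sub isIntComb_integrated) (-1) (-1) 1
    (by intros; simp only [Units.val_neg, Units.val_one]; module)
    (by intros; simp only [Units.val_neg, Units.val_one]; module)
    (by intros; simp only [Units.val_one]; module)
  exact A

/-- Ordered as `(k_i, k_k, k_a)`, the singularity is at `k_a = k_i`. It has order `0`, since the
pairs `(A, I)` and `(K, C)` consist of different bands. -/
theorem periodicSymbol_chiIC (ht : ∀ i j e b, PeriodicSymbol a 0 (t i j e b))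
    (i : Fin nocc) (c e : Fin nvir) (k : Fin nocc) :
    PeriodicSymbol a 0 (fun ki kk ka => S.chiIC t i c e k ki ka kk) := by
  refine PeriodicSymbol.add ?_ (PeriodicSymbol.const_mul _ (AvgSymbol.average ?_))
  · exact (S.periodicSymbol_eri_of_ne Sum.inr_ne_inl Sum.inl_ne_inr).comp isIntComb_third
      isIntComb_second isIntComb_first (-1)
      (by intros; simp only [Units.val_neg, Units.val_one]; module)
  · refine AvgSymbol.sum fun l _ => AvgSymbol.sum fun d _ => ?_
    have hd : IsIntComb fun κ k₁ _ k₃ => k₁ + κ - k₃ :=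
      (isIntComb_first.add isIntComb_integrated).sub isIntComb_third
    have hc : IsIntComb fun _ k₁ k₂ k₃ => k₃ + k₂ - k₁ :=
      (isIntComb_third.add isIntComb_second).sub isIntComb_first
    have h₁ := S.periodicSymbol_eri_of_ne (n₁ := .inl l) (n₂ := .inl k) (n₃ := .inr d)
      (n₄ := .inr c) Sum.inl_ne_inr Sum.inl_ne_inr
    have h₂ := S.periodicSymbol_eri (.inl l) (.inl k) (.inr c) (.inr d)
    have A₁ := AvgSymbol.fixed_mul_fixed h₁ (ht i l e d) isIntComb_integrated isIntComb_second hd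
      isIntComb_first isIntComb_integrated isIntComb_third (-1) 1
      (by intros; simp only [Units.val_neg, Units.val_one]; module)
      (by intros; simp only [Units.val_one]; module)
    have A₂ := AvgSymbol.mul_fixed h₂ (ht i l e d) isIntComb_integrated isIntComb_second hc
      isIntComb_first isIntComb_integrated isIntComb_third (-1) 1
      (by intros; simp only [Units.val_neg, Units.val_one]; module)
      (by intros; simp only [Units.val_one]; module)
    have A₃ := AvgSymbol.fixed_mul h₁ ((ht i l d e).of_zero 2) isIntComb_integrated
      isIntComb_second hd isIntComb_first isIntComb_integrated hd 1 (-1)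
      (by intros; simp only [Units.val_one]; module)
      (by intros; simp only [Units.val_neg, Units.val_one]; module)
    convert ((A₁.const_mul 2).sub A₂).sub A₃ using 5
    ring

/-- The singularity is at `k_c = k_a`, that is at `k_k = k_i`. -/
theorem periodicSymbol_chiCI (ht : ∀ i j e b, PeriodicSymbol a 0 (t i j e b))
    (c : Fin nvir) (i : Fin nocc) (e : Fin nvir) (k : Fin nocc) :
    PeriodicSymbol a 2 (S.chiCI t c i e k) := by
  have hc : IsIntComb fun _ k₁ k₂ k₃ => k₂ + k₃ - k₁ :=
    (isIntComb_second.add isIntComb_third).sub isIntComb_first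
  refine PeriodicSymbol.sub ?_
    (PeriodicSymbol.of_zero (PeriodicSymbol.const_mul _ (AvgSymbol.average ?_)) 2)
  · exact (S.periodicSymbol_eri _ _ _ _).comp isIntComb_second isIntComb_third hc 1
      (by intros; simp only [Units.val_one]; module)
  · refine AvgSymbol.sum fun l _ => AvgSymbol.sum fun d _ => ?_
    exact AvgSymbol.convolution (S.periodicSymbol_eri _ _ _ _) (ht i l d e)
      isIntComb_integrated isIntComb_third hc isIntComb_first isIntComb_integrated
      ((isIntComb_first.add isIntComb_integrated).sub isIntComb_second)
      (hc.sub isIntComb_integrated) (-1) 1 1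
      (by intros; simp only [Units.val_neg, Units.val_one]; module)
      (by intros; simp only [Units.val_one]; module)
      (by intros; simp only [Units.val_one]; module)

/-- Only the product of `χ_{CJ}^{AK}` and `t_{KI}^{BC}` is a convolution. -/
theorem periodicSymbol_term3h3p (ht : ∀ i j e b, PeriodicSymbol a 0 (t i j e b))
    (i j : Fin nocc) (e b : Fin nvir) : PeriodicSymbol a 0 (S.term3h3p t i j e b) := by
  refine AvgSymbol.average ?_
  refine AvgSymbol.sum fun k _ => AvgSymbol.sum fun c _ => ?_
  have hb : IsIntComb fun _ k₁ k₂ k₃ => k₁ + k₂ - k₃ :=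
    (isIntComb_first.add isIntComb_second).sub isIntComb_third
  have hc : IsIntComb fun κ k₁ _ k₃ => k₃ + κ - k₁ :=
    (isIntComb_third.add isIntComb_integrated).sub isIntComb_first
  have A₁ := AvgSymbol.fixed_mul_fixed (S.periodicSymbol_chiIC ht i c e k) (ht k j c b)
    isIntComb_first isIntComb_integrated isIntComb_third isIntComb_integrated isIntComb_second hc
    1 1 (by intros; simp only [Units.val_one]; module)
    (by intros; simp only [Units.val_one]; module)
  have A₂ := AvgSymbol.mul_fixed (S.periodicSymbol_chiCI ht c i e k) (ht k j c b)
    isIntComb_first isIntComb_third isIntComb_integrated isIntComb_integrated isIntComb_second hc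
    1 1 (by intros; simp only [Units.val_one]; module)
    (by intros; simp only [Units.val_one]; module)
  have A₃ := AvgSymbol.fixed_mul (S.periodicSymbol_chiIC ht i c e k) ((ht k j b c).of_zero 2)
    isIntComb_first isIntComb_integrated isIntComb_third isIntComb_integrated isIntComb_second hb
    (-1) 1 (by intros; simp only [Units.val_neg, Units.val_one]; module)
    (by intros; simp only [Units.val_one]; module)
  have A₄ := AvgSymbol.convolution (S.periodicSymbol_chiCI ht c j e k) (ht k i b c)
    isIntComb_second isIntComb_third isIntComb_integrated isIntComb_integrated isIntComb_first hb
    (isIntComb_second.sub isIntComb_integrated) (-1) (-1) (-1)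
    (by intros; simp only [Units.val_neg, Units.val_one]; module)
    (by intros; simp only [Units.val_neg, Units.val_one]; module)
    (by intros; simp only [Units.val_neg, Units.val_one]; module)
  convert ((((A₁.const_mul 2).sub A₂).sub A₃).sub A₄) using 5
  ring

/-- The integrals between occupied and virtual bands have order `0`. The average over `k_l` is a
symbol of order `0` in `k_a - k_k`, and this singularity is averaged over `k_k`. -/
theorem periodicSymbol_kappaVir (ht : ∀ i j e b, PeriodicSymbol a 0 (t i j e b))
    (c e : Fin nvir) : PeriodicSymbol a 0 (fun _ _ ka => S.kappaVir t c e ka) := by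
  have h₁ := fun k l d => S.periodicSymbol_eri_of_ne (n₁ := .inl k) (n₂ := .inl l) (n₃ := .inr c)
      (n₄ := .inr d) Sum.inl_ne_inr Sum.inl_ne_inr
  have h₂ := fun k l d => S.periodicSymbol_eri_of_ne (n₁ := .inl k) (n₂ := .inl l) (n₃ := .inr d)
      (n₄ := .inr c) Sum.inl_ne_inr Sum.inl_ne_inr
  have hd : IsIntComb fun κ k₁ _ k₃ => k₁ + κ - k₃ :=
    (isIntComb_first.add isIntComb_integrated).sub isIntComb_third
  have hinner : AvgSymbol a fun κ k₁ k₂ k₃ => ∑ k, ∑ l, ∑ d,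
      (2 * S.eri (.inl k) (.inl l) (.inr c) (.inr d) k₁ κ k₃
        - S.eri (.inl k) (.inl l) (.inr d) (.inr c) k₁ κ (k₁ + κ - k₃)) * t k l e d k₁ κ k₃ := by
    refine AvgSymbol.sum fun k _ => AvgSymbol.sum fun l _ => AvgSymbol.sum fun d _ => ?_
    have A₁ := AvgSymbol.fixed_mul_fixed (h₁ k l d) (ht k l e d) isIntComb_first
      isIntComb_integrated isIntComb_third isIntComb_first isIntComb_integrated isIntComb_third
      1 1 (by intros; simp only [Units.val_one]; module)
      (by intros; simp only [Units.val_one]; module)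
    have A₂ := AvgSymbol.mul_fixed ((h₂ k l d).of_zero 2) (ht k l e d) isIntComb_first
      isIntComb_integrated hd isIntComb_first isIntComb_integrated isIntComb_third
      1 1 (by intros; simp only [Units.val_one]; module)
      (by intros; simp only [Units.val_one]; module)
    convert (A₁.const_mul 2).sub A₂ using 5
    ring
  have houter := AvgSymbol.single (hinner.average.of_zero 2) isIntComb_integrated isIntComb_second
    isIntComb_third (-1) (by intros; simp only [Units.val_neg, Units.val_one]; module)
  refine Eq.mp (congrArg (PeriodicSymbol a 0) (Eq.symm ?_)) (houter.average.const_mul (-1))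
  funext k₁ k₂ k₃
  rw [kappaVir, zoneAvg₂_eq, neg_one_mul]
  refine integrable_finsetSum _ fun k _ => integrable_finsetSum _ fun l _ =>
    integrable_finsetSum _ fun d _ => ?_
  have B₁ := (h₁ k l d).integrableOn_prod (ht k l e d) (α₁ := Prod.fst) (α₂ := Prod.snd)
    (α₃ := fun _ => k₃) (β₁ := Prod.fst) (β₂ := Prod.snd) (β₃ := fun _ => k₃)
    (by fun_prop) (by fun_prop) (by fun_prop) (by fun_prop) (by fun_prop) (by fun_prop)
  have B₂ := (h₂ k l d).integrableOn_prod (ht k l e d) (α₁ := Prod.fst) (α₂ := Prod.snd)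
    (α₃ := fun p => p.1 + p.2 - k₃) (β₁ := Prod.fst) (β₂ := Prod.snd) (β₃ := fun _ => k₃)
    (by fun_prop) (by fun_prop) (by fun_prop) (by fun_prop) (by fun_prop) (by fun_prop)
  refine ((B₁.const_mul 2).sub B₂).congr (Eventually.of_forall fun p => ?_)
  simp only [Pi.sub_apply]
  ring

/-- The average over `k_d` is a symbol of order `0` in `k_c - k_i`, and this singularity is averaged
over `k_c`. -/
theorem periodicSymbol_kappaOcc (ht : ∀ i j e b, PeriodicSymbol a 0 (t i j e b))
    (i k : Fin nocc) : PeriodicSymbol a 0 (fun ki _ _ => S.kappaOcc t i k ki) := by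
  have h₁ := fun l c d => S.periodicSymbol_eri_of_ne (n₁ := .inl k) (n₂ := .inl l) (n₃ := .inr c)
      (n₄ := .inr d) Sum.inl_ne_inr Sum.inl_ne_inr
  have h₂ := fun l c d => S.periodicSymbol_eri_of_ne (n₁ := .inl k) (n₂ := .inl l) (n₃ := .inr d)
      (n₄ := .inr c) Sum.inl_ne_inr Sum.inl_ne_inr
  have hl : IsIntComb fun κ k₁ _ k₃ => k₃ + κ - k₁ :=
    (isIntComb_third.add isIntComb_integrated).sub isIntComb_first
  have hinner : AvgSymbol a fun κ k₁ k₂ k₃ => ∑ l, ∑ c, ∑ d,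
      (2 * S.eri (.inl k) (.inl l) (.inr c) (.inr d) k₁ (k₃ + κ - k₁) k₃
        - S.eri (.inl k) (.inl l) (.inr d) (.inr c) k₁ (k₃ + κ - k₁) κ)
        * t i l c d k₁ (k₃ + κ - k₁) k₃ := by
    refine AvgSymbol.sum fun l _ => AvgSymbol.sum fun c _ => AvgSymbol.sum fun d _ => ?_
    have A₁ := AvgSymbol.fixed_mul_fixed (h₁ l c d) (ht i l c d) isIntComb_first
      hl isIntComb_third isIntComb_first hl isIntComb_third
      1 1 (by intros; simp only [Units.val_one]; module)
      (by intros; simp only [Units.val_one]; module)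
    have A₂ := AvgSymbol.mul_fixed ((h₂ l c d).of_zero 2) (ht i l c d) isIntComb_first
      hl isIntComb_integrated isIntComb_first hl isIntComb_third
      1 1 (by intros; simp only [Units.val_one]; module)
      (by intros; simp only [Units.val_one]; module)
    convert (A₁.const_mul 2).sub A₂ using 5
    ring
  have houter := AvgSymbol.single (hinner.average.of_zero 2) isIntComb_first isIntComb_second
    isIntComb_integrated 1 (by intros; simp only [Units.val_one]; module)
  convert houter.average using 4 with k₁ k₂ k₃
  rw [kappaOcc, zoneAvg₂_eq]
  refine integrable_finsetSum _ fun l _ => integrable_finsetSum _ fun c _ =>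
    integrable_finsetSum _ fun d _ => ?_
  have B₁ := (h₁ l c d).integrableOn_prod (ht i l c d) (α₁ := fun _ => k₁)
    (α₂ := fun p => p.1 + p.2 - k₁) (α₃ := Prod.fst) (β₁ := fun _ => k₁)
    (β₂ := fun p => p.1 + p.2 - k₁) (β₃ := Prod.fst)
    (by fun_prop) (by fun_prop) (by fun_prop) (by fun_prop) (by fun_prop) (by fun_prop)
  have B₂ := (h₂ l c d).integrableOn_prod (ht i l c d) (α₁ := fun _ => k₁)
    (α₂ := fun p => p.1 + p.2 - k₁) (α₃ := Prod.snd) (β₁ := fun _ => k₁)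
    (β₂ := fun p => p.1 + p.2 - k₁) (β₃ := Prod.fst)
    (by fun_prop) (by fun_prop) (by fun_prop) (by fun_prop) (by fun_prop) (by fun_prop)
  refine ((B₁.const_mul 2).sub B₂).congr (Eventually.of_forall fun p => ?_)
  simp only [Pi.sub_apply]
  ring

theorem periodicSymbol_kappaTerms (ht : ∀ i j e b, PeriodicSymbol a 0 (t i j e b))
    (i j : Fin nocc) (e b : Fin nvir) : PeriodicSymbol a 0 (S.kappaTerms t i j e b) := by
  refine PeriodicSymbol.sub (PeriodicSymbol.sum fun c _ => ?_) (PeriodicSymbol.sum fun k _ => ?_)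
  · exact (S.periodicSymbol_kappaVir ht c e).mul (ht i j c b)
  · exact (S.periodicSymbol_kappaOcc ht i k).mul (ht k j e b)

theorem periodicSymbol_perm {u : Amplitude nocc nvir}
    (hu : ∀ i j e b, PeriodicSymbol a 0 (u i j e b)) (i j : Fin nocc) (e b : Fin nvir) :
    PeriodicSymbol a 0 (perm u i j e b) := by
  refine (hu i j e b).add ?_
  exact (hu j i b e).comp isIntComb_second isIntComb_first
    ((isIntComb_first.add isIntComb_second).sub isIntComb_third) (-1)
    (by intros; simp only [Units.val_neg, Units.val_one]; module)

/-- The gap makes the reciprocal of the energy difference smooth. -/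
theorem periodicSymbol_inv_gapEnergy (i j : Fin nocc) (e b : Fin nvir) :
    PeriodicSymbol a 0 (fun ki kj ka => 1 / (S.gapEnergy i j e b ki kj ka : ℂ)) := by
  have hper := S.energy_periodic
  refine .of_contDiff (fun G hG k₁ k₂ k₃ => ?_) (fun G hG k₁ k₂ k₃ => ?_)
    (fun G hG k₁ k₂ k₃ => ?_) ?_
  · have : k₁ + G + k₂ - k₃ = k₁ + k₂ - k₃ + G := by abel
    simp only [gapEnergy, this, hper _ _ G hG]
  · have : k₁ + (k₂ + G) - k₃ = k₁ + k₂ - k₃ + G := by abel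
    simp only [gapEnergy, this, hper _ _ G hG]
  · have : k₁ + k₂ - (k₃ + G) = k₁ + k₂ - k₃ + -G := by abel
    simp only [gapEnergy, this, hper _ _ G hG, hper _ _ (-G) (neg_mem hG)]
  · have h : ContDiff ℝ ∞ (fun p : Vec × Vec × Vec => S.gapEnergy i j e b p.1 p.2.1 p.2.2) := by
      have := S.energy_smooth
      unfold gapEnergy
      exact (((this _).comp (f := fun p : Vec × Vec × Vec => p.1) (by fun_prop)).add
        ((this _).comp (f := fun p : Vec × Vec × Vec => p.2.1) (by fun_prop))).sub
        ((this _).comp (f := fun p : Vec × Vec × Vec => p.2.2) (by fun_prop)) |>.sub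
        ((this _).comp (f := fun p : Vec × Vec × Vec => p.1 + p.2.1 - p.2.2) (by fun_prop))
    simp only [one_div]
    refine ContDiff.inv (Complex.ofRealCLM.contDiff.comp h) fun p => ?_
    have := S.gap i j e b p.1 p.2.1 p.2.2
    change (S.gapEnergy i j e b p.1 p.2.1 p.2.2 : ℂ) ≠ 0
    rw [Complex.ofReal_ne_zero, gapEnergy]
    linarith

theorem periodicSymbol_amplitudeMap (ht : ∀ i j e b, PeriodicSymbol a 0 (t i j e b))
    (i j : Fin nocc) (e b : Fin nvir) : PeriodicSymbol a 0 (S.amplitudeMap t i j e b) := by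
  refine (S.periodicSymbol_inv_gapEnergy i j e b).mul ?_
  refine ((((?_ : PeriodicSymbol a 0 _).add ?_).add ?_).add ?_).add ?_
  · exact (S.periodicSymbol_eri_of_ne Sum.inr_ne_inl Sum.inr_ne_inl).comp isIntComb_third
      ((isIntComb_first.add isIntComb_second).sub isIntComb_third) isIntComb_first (-1)
      (by intros; simp only [Units.val_neg, Units.val_one]; module)
  · exact periodicSymbol_perm (S.periodicSymbol_kappaTerms ht) i j e b
  · exact S.periodicSymbol_term4h2p ht i j e b
  · exact S.periodicSymbol_term2h4p ht i j e b
  · exact periodicSymbol_perm (S.periodicSymbol_term3h3p ht) i j e b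

end Bands

end CCD

end

theorem mainTheorem4 (a : Module.Basis (Fin 3) ℝ CCD.Vec) (nocc nvir : ℕ)
    (S : CCD.Bands a nocc nvir) :
    (∀ n : ℕ, 0 < n → ∀ (i j : Fin nocc) (e b : Fin nvir),
      CCD.MemT a (S.ccdAmplitude n i j e b)) ∧
    (∀ t : CCD.Amplitude nocc nvir,
      (∀ (i j : Fin nocc) (e b : Fin nvir), CCD.MemT a (t i j e b)) →
      ∀ (i j : Fin nocc) (e b : Fin nvir), CCD.MemT a (S.amplitudeMap t i j e b)) := by
  refine ⟨fun n hn i j e b => ?_, fun t ht i j e b => ?_⟩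
  · have h : ∀ i j e b, CCD.PeriodicSymbol a 0 (S.ccdAmplitude n i j e b) := by
      clear hn
      induction n with
      | zero => exact fun _ _ _ _ => CCD.PeriodicSymbol.const 0
      | succ n ih => exact S.periodicSymbol_amplitudeMap ih
    exact (h i j e b).memT
  · exact (S.periodicSymbol_amplitudeMap (fun i j e b => (ht i j e b).periodicSymbol) i j e b).memT
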